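/- **Setting.** For each $n\in\mathbb N$ let $p=p_n\ge 1$ and let $(\tilde T,U,\{Z(t):t\in\mathcal T\})$ be a generic triple (whose law may depend on $n$): $\tilde T\ge 0$ is a failure time, $U\ge0$ a censoring time, $Z$ an $\mathbb R^p$-valued covariate process. Put $T=\min(\tilde T,U)$, $\delta=\mathbf 1\{\tilde T\le U\}$, $Y(t)=\mathbf 1\{T\ge t\}$, $N(t)=\mathbf 1\{T\le t,\delta=1\}$, $t_+=\inf\{t\ge0:\mathbb P(T\le t)=1\}$, and $\mathcal T=[0,t_+]$ if $t_+<\infty$, $\mathcal T=[0,\infty)$ otherwise. Given the covariate process, $\tilde T$ and $U$ are conditionally independent and $\tilde T$ has hazard $\lambda_0(t)\exp\{\beta^{o\top}Z(t)\}$, $t\in\mathcal T$, for a measurable baseline hazard $\lambda_0\ge0$ and some $\beta^o\in\mathbb R^p$, with $\sup_n\|\beta^o\|_1<\infty$. We observe $n$ independent copies $(T_i,\delta_i,Z_i)$ of $(T,\delta,Z)$, with corresponding $Y_i,N_i$. Let $\bar N=n^{-1}\sum_iN_i$ and $$\ell(\beta)=\frac1n\sum_{i=1}^n\int_{\mathcal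 T}\beta^\top Z_i(s)\,dN_i(s)-\int_{\mathcal T}\log\Bigl[\sum_{j=1}^nY_j(s)e^{\beta^\top Z_j(s)}\Bigr]d\bar N(s),$$ with gradient $\dot\ell$ and Hessian $\ddot\ell$, whose $j$th row is $\ddot\ell_j^\top$. Let $$\bar Z(s,\beta)=\frac{\sum_iZ_i(s)Y_i(s)e^{\beta^\top Z_i(s)}}{\sum_iY_i(s)e^{\beta^\top Z_i(s)}},\qquad \mu(s,\beta)=\frac{\mathbb E\{Z(s)Y(s)e^{\beta^\top Z(s)}\}}{\mathbb E\{Y(s)e^{\beta^\top Z(s)}\}}\qquad(0/0:=0),$$ $$\hat{\mathcal V}(\beta)=\frac1n\sum_{i=1}^n\delta_i\{Z_i(T_i)-\bar Z(T_i,\beta)\}\{Z_i(T_i)-\bar Z(T_i,\beta)\}^\top,\qquad \Sigma=\mathbb E\bigl[\delta\{Z(T)-\mu(T,\beta^o)\}\{Z(T)-\mu(T,\beta^o)\}^\top\bigr].$$ Write $\|A\|_{\mathrm{op},1}=\max_j\sum_i|A_{ij}|$, $\mathcal S=\{j:\beta^o_j\ne0\}$, $\mathcal N=\mathcal S^c$,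 $d_o=|\mathcal S|$. **Estimators.** $\hat\beta$ is any minimiser over $\beta\in\mathbb R^p$ of $-\ell(\beta)+\lambda\|\beta\|_1$. $\hat\Theta$ is any matrix whose $j$th row $\hat\Theta_j$ minimises $\|b\|_1$ subject to $\|\hat{\mathcal V}(\hat\beta)b-e_j\|_\infty\le\lambda_n$ (arbitrary if this constraint set is empty). For each $j$, $\tilde\beta_j$ is any point on the segment between $\hat\beta$ and $\beta^o$ with $\dot\ell_j(\hat\beta)=\dot\ell_j(\beta^o)+\ddot\ell_j(\tilde\beta_j)^\top(\hat\beta-\beta^o)$, and $M(\tilde\beta)$ is the matrix with $j$th row $\ddot\ell_j(\tilde\beta_j)^\top$. **Assumptions.** * (A1) There is a constant $K_Z>0$, not depending on $n$, with $\mathbb P(\|Z(t)\|_\infty\le K_Z)=1$ for all $t\in\mathcal T$; and there is a deterministic $L>0$ such that, almost surely, $\|Z(s)-Z(t)\|_\infty\le L|s-t|$ for all $s,t\in\mathcal T$. * (A2)(a) $T$ has a bounded density with respect to Lebesgue measure. * (A3)(b) $d_o=o\bigl(n^{1/2}/\log^{1/2}(np)\bigr)$. * (A4)(a) With $$\kappa=\inf_{v\ne0:\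 \|v_{\mathcal N}\|_1\le2\|v_{\mathcal S}\|_1}\frac{d_o^{1/2}\{-v^\top\ddot\ell(\beta^o)v\}^{1/2}}{\|v_{\mathcal S}\|_1}\qquad(\inf\emptyset:=\infty),$$ $1/\kappa=O_p(1)$. * (A4)(b) $\max_j\Sigma_{jj}=O(1)$. * (A4)(c) $\Sigma$ is invertible and, with $r_j=|\{i:(\Sigma^{-1})_{ij}\ne0\}|$, there is $\delta_0>0$ such that $$\|\Sigma^{-1}\|_{\mathrm{op},1}^2\max\Bigl\{\frac{d_o\log(np)}{n^{1/2}},\,n^{-(1/3-\delta_0)}\Bigr\}\max_jr_j=o\Bigl(\frac1{\log^{1/2}(np)}\Bigr).$$ **Proposition.** For every $K_Z>0$ there is a constant $A_0>0$, depending only on $K_Z$, with the following property. Assume (A1), (A2)(a), (A3)(b) and (A4). Let $\lambda>0$ satisfy $\lambda\asymp n^{-1/2}\log^{1/2}(np)$ with a sufficiently large constant, in the sense that $\lambda\ge A_0n^{-1/2}\log^{1/2}(np)$ for all large $n$, and let $\lambda_n>0$ satisfy $$\lambda_n\asymp\|\Sigma^{-1}\|_{\mathrm{op},1}\max\Bigl\{\frac{d_o\log(np)}{n^{1/2}},\,n^{-(1/3-\delta_0)}\Bigr\}.$$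 Then for all $c=c_n\in\mathbb R^p$ with $\|c\|_1=1$, $$c^\top\bigl(\hat\Theta M(\tilde\beta)+I\bigr)(\hat\beta-\beta^o)=o_p(n^{-1/2})\qquad(n\to\infty).$$ -/

import Mathlib

open MeasureTheory ProbabilityTheory Filter Topology Asymptotics
open scoped ENNReal NNReal Matrix

noncomputable section

/-- The `ℓ₁` norm of a vector. The `ℓ_∞` norm is the norm `‖v‖` of `Fin p → ℝ`. -/
def l1norm {p : ℕ} (v : Fin p → ℝ) : ℝ := ∑ j, |v j|

/-- The operator `ℓ₁` norm of a matrix: the largest `ℓ₁` norm of a column. -/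
def opNormOne {p : ℕ} (A : Matrix (Fin p) (Fin p) ℝ) : ℝ := ⨆ j, ∑ i, |A i j|

/-- The largest number of non-zero entries in a column. -/
def maxColSupport {p : ℕ} (A : Matrix (Fin p) (Fin p) ℝ) : ℕ :=
  Finset.univ.sup fun j => (Finset.univ.filter fun i => A i j ≠ 0).card

/-- The partial derivative of `f` in the `j`-th coordinate. -/
def partialDeriv {p : ℕ} (j : Fin p) (f : (Fin p → ℝ) → ℝ) (β : Fin p → ℝ) : ℝ :=
  fderiv ℝ f β (Pi.single j 1)

/-- The ingredients of a Cox model with `p` covariates: a generic individual, described on a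
sample space `E` by a failure time, a censoring time and a covariate process, together with the
baseline hazard and the true regression vector. The laws are in `CoxModel.IsCox`. -/
structure CoxModel (p : ℕ) (E : Type*) where
  failureTime : E → ℝ
  censoringTime : E → ℝ
  covariate : ℝ → E → Fin p → ℝ
  baseline : ℝ → ℝ
  coef : Fin p → ℝ

namespace CoxModel

/-- The observed time `T = min (T̃, U)`. -/
def obsTime {p : ℕ} {E : Type*} (m : CoxModel p E) (e : E) : ℝ :=
  min (m.failureTime e) (m.censoringTime e)

/-- The indicator `δ` that the failure is observed. The counting process `N(t) = 1{T ≤ t, δ = 1}`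
has a single jump, of size `δ`, at `T`, so the integral of `f` against `dN` is `δ * f T`. -/
def failInd {p : ℕ} {E : Type*} (m : CoxModel p E) (e : E) : ℝ :=
  if m.failureTime e ≤ m.censoringTime e then 1 else 0

/-- The at-risk indicator `Y(t) = 1{T ≥ t}`. -/
def atRisk {p : ℕ} {E : Type*} (m : CoxModel p E) (t : ℝ) (e : E) : ℝ :=
  if t ≤ m.obsTime e then 1 else 0

/-- The weight `w̃(t, β) = Y(t) exp (βᵀ Z(t))`. -/
def weight {p : ℕ} {E : Type*} (m : CoxModel p E) (t : ℝ) (β : Fin p → ℝ) (e : E) : ℝ :=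
  m.atRisk t e * Real.exp (β ⬝ᵥ m.covariate t e)

/-- The set of relevant covariates. -/
def support {p : ℕ} {E : Type*} (m : CoxModel p E) : Finset (Fin p) :=
  Finset.univ.filter fun j => m.coef j ≠ 0

/-- The sparsity `d_o`. -/
def sparsity {p : ℕ} {E : Type*} (m : CoxModel p E) : ℕ := m.support.card

/-! ### Population quantities -/

/-- The upper limit `t₊ = inf {t ≥ 0 : F_T(t) = 1}` of the support of `T` (`⊤` if there is no
such `t`). -/
def tPlus {p : ℕ} {E : Type*} [MeasurableSpace E] (m : CoxModel p E) (P : Measure E) : EReal :=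
  sInf ((fun t : ℝ => (t : EReal)) '' {t : ℝ | 0 ≤ t ∧ P {e | m.obsTime e ≤ t} = 1})

/-- The time index set: `[0, t₊]` if `t₊` is finite and `[0, ∞)` otherwise. -/
def timeSet {p : ℕ} {E : Type*} [MeasurableSpace E] (m : CoxModel p E) (P : Measure E) : Set ℝ :=
  {t : ℝ | 0 ≤ t ∧ (t : EReal) ≤ m.tPlus P}

/-- The σ-algebra generated by the covariate process. -/
@[reducible] def covariateSigma {p : ℕ} {E : Type*} [MeasurableSpace E] (m : CoxModel p E) (P : Measure E) :
    MeasurableSpace E :=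
  ⨆ t ∈ m.timeSet P, MeasurableSpace.comap (m.covariate t) inferInstance

/-- The cumulative conditional hazard `∫₀ᵗ λ₀(s) exp (β^oᵀ Z(s)) ds`, possibly infinite. -/
def cumHazard {p : ℕ} {E : Type*} (m : CoxModel p E) (t : ℝ) (e : E) : ℝ≥0∞ :=
  ∫⁻ s in Set.Ioc 0 t, ENNReal.ofReal (m.baseline s * Real.exp (m.coef ⬝ᵥ m.covariate s e))

/-- The conditional survival function with hazard `λ₀(t) exp (β^oᵀ Z(t))`. -/
def condSurvival {p : ℕ} {E : Type*} (m : CoxModel p E) (t : ℝ) (e : E) : ℝ :=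
  if m.cumHazard t e = ⊤ then 0 else Real.exp (-(m.cumHazard t e).toReal)

/-- The Cox proportional hazards model with right censoring: given the covariate process, the
failure time and the censoring time are conditionally independent, and the failure time has
hazard `λ₀(t) exp (β^oᵀ Z(t))` at every time of the index set. -/
structure IsCox {p : ℕ} {E : Type*} [MeasurableSpace E] (m : CoxModel p E) (P : Measure E) :
    Prop where
  failureTime_measurable : Measurable m.failureTime
  censoringTime_measurable : Measurable m.censoringTime
  failureTime_nonneg : ∀ᵐ e ∂P, 0 ≤ m.failureTime e
  censoringTime_nonneg : ∀ᵐ e ∂P, 0 ≤ m.censoringTime e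
  covariate_measurable : ∀ t ∈ m.timeSet P, Measurable (m.covariate t)
  baseline_measurable : Measurable m.baseline
  baseline_nonneg : ∀ t, 0 ≤ m.baseline t
  condIndep : ∀ A B : Set ℝ, MeasurableSet A → MeasurableSet B →
    P[(m.failureTime ⁻¹' A ∩ m.censoringTime ⁻¹' B).indicator (fun _ => (1 : ℝ)) |
        m.covariateSigma P]
      =ᵐ[P]
    P[(m.failureTime ⁻¹' A).indicator (fun _ => (1 : ℝ)) | m.covariateSigma P] *
      P[(m.censoringTime ⁻¹' B).indicator (fun _ => (1 : ℝ)) | m.covariateSigma P]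
  hazard : ∀ t ∈ m.timeSet P,
    P[{e | t < m.failureTime e}.indicator (fun _ => (1 : ℝ)) | m.covariateSigma P]
      =ᵐ[P] m.condSurvival t

/-- The covariate process is bounded by `K`. -/
def BoundedCovariates {p : ℕ} {E : Type*} [MeasurableSpace E] (m : CoxModel p E) (P : Measure E)
    (K : ℝ) : Prop :=
  ∀ t ∈ m.timeSet P, ∀ᵐ e ∂P, ‖m.covariate t e‖ ≤ K

/-- The covariate process is uniformly Lipschitz, with a deterministic constant. -/
def LipschitzCovariates {p : ℕ} {E : Type*} [MeasurableSpace E] (m : CoxModel p E)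
    (P : Measure E) : Prop :=
  ∃ L : ℝ, 0 < L ∧ ∀ᵐ e ∂P, ∀ s ∈ m.timeSet P, ∀ t ∈ m.timeSet P,
    ‖m.covariate s e - m.covariate t e‖ ≤ L * |s - t|

/-- The observed time has a bounded density with respect to Lebesgue measure. -/
def BoundedDensity {p : ℕ} {E : Type*} [MeasurableSpace E] (m : CoxModel p E)
    (P : Measure E) : Prop :=
  ∃ (f : ℝ → ℝ) (C : ℝ), Measurable f ∧ (∀ t, 0 ≤ f t ∧ f t ≤ C) ∧
    P.map m.obsTime = volume.withDensity fun t => ENNReal.ofReal (f t)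

/-- `μ(t, β) = E{Z(t) Y(t) exp (βᵀ Z(t))} / E{Y(t) exp (βᵀ Z(t))}`. -/
def mu {p : ℕ} {E : Type*} [MeasurableSpace E] (m : CoxModel p E) (P : Measure E) (t : ℝ)
    (β : Fin p → ℝ) : Fin p → ℝ :=
  fun k => (∫ e, m.covariate t e k * m.weight t β e ∂P) / ∫ e, m.weight t β e ∂P

/-- `Σ = E ∫ {Z(s) - μ(s, β^o)}{Z(s) - μ(s, β^o)}ᵀ dN(s)`. -/
def Sigma {p : ℕ} {E : Type*} [MeasurableSpace E] (m : CoxModel p E) (P : Measure E) :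
    Matrix (Fin p) (Fin p) ℝ :=
  Matrix.of fun k l => ∫ e, m.failInd e *
    ((m.covariate (m.obsTime e) e k - m.mu P (m.obsTime e) m.coef k) *
      (m.covariate (m.obsTime e) e l - m.mu P (m.obsTime e) m.coef l)) ∂P

/-! ### Sample quantities, as functions of the data `x : Fin n → E` of `n` individuals -/

/-- The log-partial likelihood divided by `n`. -/
def logLik {p n : ℕ} {E : Type*} (m : CoxModel p E) (x : Fin n → E) (β : Fin p → ℝ) : ℝ :=
  (1 / (n : ℝ)) * ∑ i, m.failInd (x i) * (β ⬝ᵥ m.covariate (m.obsTime (x i)) (x i)) -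
    (1 / (n : ℝ)) * ∑ i, m.failInd (x i) * Real.log (∑ j, m.weight (m.obsTime (x i)) β (x j))

/-- The `j`-th component of the score vector. -/
def score {p n : ℕ} {E : Type*} (m : CoxModel p E) (x : Fin n → E) (β : Fin p → ℝ)
    (j : Fin p) : ℝ :=
  partialDeriv j (m.logLik x) β

/-- The Hessian matrix of the log-partial likelihood. -/
def hessian {p n : ℕ} {E : Type*} (m : CoxModel p E) (x : Fin n → E) (β : Fin p → ℝ) :
    Matrix (Fin p) (Fin p) ℝ :=
  Matrix.of fun j l => partialDeriv l (fun b => m.score x b j) β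

/-- The weighted average `Z̄(s, β)` of the covariate processes (with `0 / 0 = 0`). -/
def Zbar {p n : ℕ} {E : Type*} (m : CoxModel p E) (x : Fin n → E) (s : ℝ) (β : Fin p → ℝ) :
    Fin p → ℝ :=
  ∑ i, (m.weight s β (x i) / ∑ j, m.weight s β (x j)) • m.covariate s (x i)

/-- The estimator `V̂(β)` of `Σ`. -/
def Vhat {p n : ℕ} {E : Type*} (m : CoxModel p E) (x : Fin n → E) (β : Fin p → ℝ) :
    Matrix (Fin p) (Fin p) ℝ :=
  (1 / (n : ℝ)) • ∑ i, m.failInd (x i) •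
    Matrix.vecMulVec (m.covariate (m.obsTime (x i)) (x i) - m.Zbar x (m.obsTime (x i)) β)
      (m.covariate (m.obsTime (x i)) (x i) - m.Zbar x (m.obsTime (x i)) β)

/-- `b` minimises the Lasso-penalised negative log-partial likelihood. -/
def IsLasso {p n : ℕ} {E : Type*} (m : CoxModel p E) (x : Fin n → E) (lam : ℝ)
    (b : Fin p → ℝ) : Prop :=
  ∀ β : Fin p → ℝ, -m.logLik x b + lam * l1norm b ≤ -m.logLik x β + lam * l1norm β

/-- The compatibility factor `κ` of the negative Hessian at `β^o`; it is `⊤` if the cone is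
empty, that is, if there is no relevant covariate. -/
def kappa {p n : ℕ} {E : Type*} (m : CoxModel p E) (x : Fin n → E) : ℝ≥0∞ :=
  ⨅ v ∈ {v : Fin p → ℝ | v ≠ 0 ∧ ∑ j ∈ m.supportᶜ, |v j| ≤ 2 * ∑ j ∈ m.support, |v j|},
    ENNReal.ofReal (Real.sqrt m.sparsity * Real.sqrt (v ⬝ᵥ (-m.hessian x m.coef) *ᵥ v) /
      ∑ j ∈ m.support, |v j|)

/-- `M(β̃)`: the matrix whose `j`-th row is the `j`-th row of the Hessian at `β̃_j`. -/
def rowHessian {p n : ℕ} {E : Type*} (m : CoxModel p E) (x : Fin n → E)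
    (bt : Fin p → Fin p → ℝ) : Matrix (Fin p) (Fin p) ℝ :=
  Matrix.of fun j l => m.hessian x (bt j) j l

/-- For every `j`, the point `β̃_j` lies on the segment between `b` and `β^o` and is an
intermediate point in the Taylor expansion of the `j`-th component of the score. -/
def IsTaylorPoints {p n : ℕ} {E : Type*} (m : CoxModel p E) (x : Fin n → E) (b : Fin p → ℝ)
    (bt : Fin p → Fin p → ℝ) : Prop :=
  ∀ j, bt j ∈ segment ℝ b m.coef ∧
    m.score x b j = m.score x m.coef j + ∑ l, m.hessian x (bt j) j l * (b l - m.coef l)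

end CoxModel

/-- The feasible set of the `j`-th row of the CLIME estimator. -/
def climeFeasible {p : ℕ} (V : Matrix (Fin p) (Fin p) ℝ) (lam : ℝ) (j : Fin p) :
    Set (Fin p → ℝ) :=
  {b | ‖V *ᵥ b - Pi.single j 1‖ ≤ lam}

/-- `Θ` is a CLIME estimator built from `V`: its `j`-th row has least `ℓ₁` norm in the feasible
set. A row whose feasible set is empty is not restricted. -/
def IsClime {p : ℕ} (V : Matrix (Fin p) (Fin p) ℝ) (lam : ℝ)
    (Θ : Matrix (Fin p) (Fin p) ℝ) : Prop :=
  ∀ j, (climeFeasible V lam j).Nonempty →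
    Θ j ∈ climeFeasible V lam j ∧ ∀ b ∈ climeFeasible V lam j, l1norm (Θ j) ≤ l1norm b

/-- The `ξ i` are independent copies of a generic element with law `P`. -/
structure IsIIDSample {n : ℕ} {Ω E : Type*} [MeasurableSpace Ω] [MeasurableSpace E]
    (Q : Measure Ω) (P : Measure E) (ξ : Fin n → Ω → E) : Prop where
  law : ∀ i, MeasurePreserving (ξ i) Q P
  indep : iIndepFun ξ Q

/-- `X n = O_p(1)`, for variables with values in `[0, ∞]`. -/
def IsBigOpOne {Ω : ℕ → Type*} [∀ n, MeasurableSpace (Ω n)] (Q : ∀ n, Measure (Ω n))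
    (X : ∀ n, Ω n → ℝ≥0∞) : Prop :=
  ∀ ε : ℝ≥0∞, 0 < ε → ∃ C : ℝ≥0, ∀ᶠ n in atTop, Q n {ω | (C : ℝ≥0∞) < X n ω} ≤ ε

/-- `X n = o_p(a n)`, for a sequence of non-negative numbers `a n`. -/
def IsLittleOp {Ω : ℕ → Type*} [∀ n, MeasurableSpace (Ω n)] (Q : ∀ n, Measure (Ω n))
    (X : ∀ n, Ω n → ℝ) (a : ℕ → ℝ) : Prop :=
  ∀ ε : ℝ, 0 < ε → Tendsto (fun n => Q n {ω | ε * a n < |X n ω|}) atTop (𝓝 0)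

/-- `n^{-1/2} log^{1/2} (np)`. -/
def lassoRate (p : ℕ → ℕ) (n : ℕ) : ℝ :=
  Real.sqrt (Real.log ((n : ℝ) * p n)) / Real.sqrt n

/-- `max {d log (np) / n^{1/2}, n^{-(1/3 - δ₀)}}`. -/
def climeRate (p d : ℕ → ℕ) (δ₀ : ℝ) (n : ℕ) : ℝ :=
  max ((d n : ℝ) * Real.log ((n : ℝ) * p n) / Real.sqrt n) ((n : ℝ) ^ (-(1 / 3 - δ₀)))

end

/-! Write D for `betaHat - coef`, S for `Sigma`, o for the operator norm of S⁻¹, s for its largest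
column support, d for the sparsity, q = √log(np), r = q/√n and γ for `climeRate`. With y = M D, each
row of the error splits as (ΘM + I)D = (Θ - S⁻¹) y + S⁻¹ (y + S D). The Taylor points make y the
difference of the scores at `betaHat` and at `coef`. Stationarity of the Lasso bounds the first
score by λ (`IsLasso.abs_score_le`) and concentration bounds the second by λ/3, so y has sup norm at
most 2λ. The rows of S⁻¹ are CLIME-feasible once `Vhat` at `betaHat` is entrywise close to S, and
ℓ₁-minimality with sparsity then gives an ℓ₁ error of order s o λ_n for each row of Θ
(`clime_row_bound`). In the second term, y + S D is the change of the Hessian between `coef` and the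
Taylor points, applied to D, plus the sampling error of the Hessian at `coef`, applied to D. The
former is at most 7K times the quadratic form Q = Dᵀ(-ℓ̈(β°))D
(`SampleBounded.abs_hessian_row_sub_le`). Since `SampleBounded.lasso_bound` gives ‖D‖₁ = O(dλ) and Q
= O(dλ²), the whole error is of order o²γs r + o d r². The sparsity assumption on S⁻¹ makes both
terms o(n^{-1/2}).

The deterministic part rests on one remark: the score and the Hessian are averages over the failures
of means and covariances under the risk-set weights, and moving β tilts these weights exponentially.
Everything needed about the likelihood is therefore an inequality on tilted weighted averages.

The probabilistic part shows that the score at `coef`, `Vhat - Sigma` and `hessian + Sigma` are all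
O(r) entrywise, outside an event of probability at most 10/n. For the score, an exponential
supermartingale bound is proved by induction on the number of individuals, removing the one observed
first (`HasIntensity.lintegral_scoreExp_le`). For averages over risk sets, conditioning on the time
of one individual leaves independent centred terms, and Hoeffding's argument gives an error of order
√L times (size of the risk set)^{-1/2} at confidence parameter L. The sum of these reciprocal roots
over all individuals is at most 2√n whatever the order of the times (`sum_one_div_sqrt_card_le`), so
small late risk sets do no harm. Both arguments need only the identity between the marked observed
time and its intensity, which `hasIntensity_of_survival` derives from the conditional survival
function once the covariates are replaced by a bounded, jointly measurable version. -/

noncomputable section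

/-! ### Weighted averages over a finite index set -/

/-- The average of `f` with respect to the weights `w`. -/
def wavg {ι : Type*} [Fintype ι] (w f : ι → ℝ) : ℝ := (∑ i, w i * f i) / ∑ i, w i

/-- The covariance of `f` and `g` with respect to the weights `w`. -/
def wcov {ι : Type*} [Fintype ι] (w f g : ι → ℝ) : ℝ :=
  wavg w (fun i => f i * g i) - wavg w f * wavg w g

section WeightedAverage

variable {ι : Type*} [Fintype ι] {w : ι → ℝ}

theorem wavg_add (f g : ι → ℝ) : wavg w (fun i => f i + g i) = wavg w f + wavg w g := by
  simp only [wavg, mul_add, Finset.sum_add_distrib, add_div]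

theorem wavg_sub (f g : ι → ℝ) : wavg w (fun i => f i - g i) = wavg w f - wavg w g := by
  simp only [wavg, mul_sub, Finset.sum_sub_distrib, sub_div]

theorem wavg_const_mul (c : ℝ) (f : ι → ℝ) : wavg w (fun i => c * f i) = c * wavg w f := by
  simp only [wavg, mul_left_comm _ c, ← Finset.mul_sum, mul_div_assoc]

theorem wavg_mul_const (c : ℝ) (f : ι → ℝ) : wavg w (fun i => f i * c) = wavg w f * c := by
  simp only [mul_comm _ c, wavg_const_mul]

theorem wavg_sum {κ : Type*} (s : Finset κ) (f : κ → ι → ℝ) :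
    wavg w (fun i => ∑ k ∈ s, f k i) = ∑ k ∈ s, wavg w (f k) := by
  simp only [wavg, Finset.mul_sum]
  rw [Finset.sum_comm, Finset.sum_div]

theorem wavg_const (hs : 0 < ∑ i, w i) (c : ℝ) : wavg w (fun _ => c) = c := by
  simp only [wavg, ← Finset.sum_mul]
  field_simp

theorem wavg_mono (hw : ∀ i, 0 ≤ w i) {f g : ι → ℝ} (h : ∀ i, f i ≤ g i) :
    wavg w f ≤ wavg w g := by
  unfold wavg
  have h0 : 0 ≤ ∑ i, w i := Finset.sum_nonneg fun i _ => hw i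
  gcongr with i _
  · exact hw i
  · exact h i

theorem wavg_nonneg (hw : ∀ i, 0 ≤ w i) {f : ι → ℝ} (h : ∀ i, 0 ≤ f i) : 0 ≤ wavg w f :=
  div_nonneg (Finset.sum_nonneg fun i _ => mul_nonneg (hw i) (h i))
    (Finset.sum_nonneg fun i _ => hw i)

theorem abs_wavg_le_wavg_abs (hw : ∀ i, 0 ≤ w i) (f : ι → ℝ) :
    |wavg w f| ≤ wavg w fun i => |f i| := by
  have h0 : 0 ≤ ∑ i, w i := Finset.sum_nonneg fun i _ => hw i
  unfold wavg
  rw [abs_div, abs_of_nonneg h0]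
  gcongr
  refine (Finset.abs_sum_le_sum_abs _ _).trans (Finset.sum_le_sum fun i _ => ?_)
  rw [abs_mul, abs_of_nonneg (hw i)]

theorem abs_wavg_le (hw : ∀ i, 0 ≤ w i) (hs : 0 < ∑ i, w i) {f : ι → ℝ} {c : ℝ}
    (h : ∀ i, |f i| ≤ c) : |wavg w f| ≤ c :=
  (abs_wavg_le_wavg_abs hw f).trans ((wavg_mono hw h).trans_eq (wavg_const hs c))

theorem wavg_sub_const (hs : 0 < ∑ i, w i) (f : ι → ℝ) (c : ℝ) :
    wavg w (fun i => f i - c) = wavg w f - c := by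
  rw [wavg_sub f fun _ => c, wavg_const hs]

theorem wcov_sub_const_right (hs : 0 < ∑ i, w i) (f g : ι → ℝ) (c : ℝ) :
    wcov w f (fun i => g i - c) = wcov w f g := by
  unfold wcov
  have : (fun i => f i * (g i - c)) = fun i => f i * g i - f i * c := by
    funext i; ring
  rw [this, wavg_sub, wavg_mul_const, wavg_sub_const hs]
  ring

theorem wcov_self_eq (hs : 0 < ∑ i, w i) (f : ι → ℝ) :
    wcov w f f = wavg w fun i => (f i - wavg w f) ^ 2 := by
  have : (fun i => (f i - wavg w f) ^ 2)
      = fun i => (f i * f i - 2 * wavg w f * f i) + wavg w f * wavg w f := by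
    funext i; ring
  rw [this, wavg_add, wavg_sub, wavg_const_mul, wavg_const hs]
  unfold wcov
  ring

theorem wcov_self_nonneg (hw : ∀ i, 0 ≤ w i) (hs : 0 < ∑ i, w i) (f : ι → ℝ) :
    0 ≤ wcov w f f := by
  rw [wcov_self_eq hs]
  exact wavg_nonneg hw fun i => sq_nonneg _

theorem sum_tilt_pos (hw : ∀ i, 0 ≤ w i) (hs : 0 < ∑ i, w i) (a : ι → ℝ) :
    0 < ∑ i, w i * Real.exp (a i) := by
  obtain ⟨i, -, hi⟩ := Finset.exists_lt_of_sum_lt (s := Finset.univ) (f := fun _ : ι => (0 : ℝ))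
    (g := w) (by simpa using hs)
  exact Finset.sum_pos' (fun j _ => mul_nonneg (hw j) (Real.exp_pos _).le)
    ⟨i, Finset.mem_univ _, mul_pos hi (Real.exp_pos _)⟩

theorem wavg_tilt (hs : 0 < ∑ i, w i) (a f : ι → ℝ) :
    wavg (fun i => w i * Real.exp (a i)) f =
      wavg w (fun i => Real.exp (a i) * f i) / wavg w fun i => Real.exp (a i) := by
  unfold wavg
  rw [div_div_div_cancel_right₀ hs.ne']
  simp only [mul_assoc]

/-- Tilting by `a` or by `a - c` gives the same averages. -/
theorem wavg_tilt_sub_const (a f : ι → ℝ) (c : ℝ) :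
    wavg (fun i => w i * Real.exp (a i - c)) f = wavg (fun i => w i * Real.exp (a i)) f := by
  unfold wavg
  have h1 : ∀ g : ι → ℝ, ∑ i, w i * Real.exp (a i - c) * g i
      = Real.exp (-c) * ∑ i, w i * Real.exp (a i) * g i := by
    intro g
    rw [Finset.mul_sum]
    refine Finset.sum_congr rfl fun i _ => ?_
    rw [sub_eq_add_neg, Real.exp_add]; ring
  have h2 := h1 fun _ => 1
  simp only [mul_one] at h2
  rw [h1, h2, mul_div_mul_left _ _ (Real.exp_pos _).ne']

/-- Jensen's inequality for the logarithm of an exponential sum. -/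
theorem wavg_le_log_tilt (hw : ∀ i, 0 ≤ w i) (hs : 0 < ∑ i, w i) (a : ι → ℝ) :
    wavg w a ≤ Real.log (∑ i, w i * Real.exp (a i)) - Real.log (∑ i, w i) := by
  rw [← Real.log_div (sum_tilt_pos hw hs a).ne' hs.ne',
    Real.le_log_iff_exp_le (div_pos (sum_tilt_pos hw hs a) hs)]
  have h := wavg_mono hw (f := fun i => Real.exp (wavg w a) * ((a i - wavg w a) + 1))
    (g := fun i => Real.exp (a i)) fun i => by
      have := Real.add_one_le_exp (a i - wavg w a)
      calc _ ≤ Real.exp (wavg w a) * Real.exp (a i - wavg w a) := by gcongr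
        _ = _ := by rw [← Real.exp_add]; congr 1; ring
  rw [wavg_const_mul, wavg_add, wavg_sub_const hs, wavg_const hs, sub_self,
    zero_add, mul_one] at h
  exact h

theorem exp_quadratic_lower {x : ℝ} (hx : |x| ≤ 1) : 1 + x + x ^ 2 / 4 ≤ Real.exp x := by
  have h := Real.exp_bound hx (n := 3) (by norm_num)
  rw [abs_le] at h
  simp only [Finset.sum_range_succ, Finset.sum_range_zero] at h
  norm_num [Nat.factorial] at h
  have h3 : |x| ^ 3 ≤ x ^ 2 := by
    rw [← sq_abs x]; nlinarith [abs_nonneg x, sq_nonneg |x|]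
  nlinarith [h.1, sq_nonneg x]

theorem exp_quadratic_upper {x : ℝ} (hx : |x| ≤ 1) : Real.exp x ≤ 1 + x + x ^ 2 := by
  have h := Real.abs_exp_sub_one_sub_id_le hx
  linarith [(abs_le.1 h).2]

/-- A quadratic improvement of Jensen's inequality for small deviations. -/
theorem wavg_add_wcov_le_log_tilt (hw : ∀ i, 0 ≤ w i) (hs : 0 < ∑ i, w i) (a : ι → ℝ)
    (ha : ∀ i, |a i - wavg w a| ≤ 1) :
    wavg w a + wcov w a a / 5 ≤
      Real.log (∑ i, w i * Real.exp (a i)) - Real.log (∑ i, w i) := by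
  have hv := wcov_self_nonneg hw hs a
  have hv1 : wcov w a a ≤ 1 := by
    rw [wcov_self_eq hs]
    refine (wavg_mono hw (g := fun _ => 1) fun i => ?_).trans_eq (wavg_const hs 1)
    rw [← sq_abs]; nlinarith [abs_nonneg (a i - wavg w a), ha i]
  rw [← Real.log_div (sum_tilt_pos hw hs a).ne' hs.ne']
  have h := wavg_mono hw
    (f := fun i => Real.exp (wavg w a) * (((a i - wavg w a) + 1) + 4⁻¹ * (a i - wavg w a) ^ 2))
    (g := fun i => Real.exp (a i)) fun i => by
      have := exp_quadratic_lower (ha i)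
      calc _ ≤ Real.exp (wavg w a) * Real.exp (a i - wavg w a) := by
            gcongr; linarith
        _ = _ := by rw [← Real.exp_add]; congr 1; ring
  rw [wavg_const_mul, wavg_add, wavg_add, wavg_const_mul, wavg_sub_const hs, wavg_const hs,
    ← wcov_self_eq hs] at h
  have h2 : Real.log (Real.exp (wavg w a) * (1 + wcov w a a / 4)) ≤
      Real.log ((∑ i, w i * Real.exp (a i)) / ∑ i, w i) := by
    apply Real.log_le_log (by positivity)
    refine le_trans (le_of_eq ?_) h
    ring
  rw [Real.log_mul (Real.exp_pos _).ne' (by positivity), Real.log_exp] at h2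
  -- With v the variance, log(1 + v/4) is at least (v/4)/(1 + v/4), and v ≤ 1 makes this at least
  -- v/5.
  have h3 := Real.one_sub_inv_le_log_of_pos (x := 1 + wcov w a a / 4) (by positivity)
  have h4 : wcov w a a / 5 ≤ 1 - (1 + wcov w a a / 4)⁻¹ := by
    rw [le_sub_iff_add_le, ← le_sub_iff_add_le', inv_le_comm₀ (by positivity) (by linarith),
      inv_eq_one_div, div_le_iff₀ (by linarith)]
    nlinarith
  linarith

theorem wavg_exp_ge_one (hw : ∀ i, 0 ≤ w i) (hs : 0 < ∑ i, w i) {x : ι → ℝ}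
    (h0 : wavg w x = 0) : 1 ≤ wavg w fun i => Real.exp (x i) := by
  have h := wavg_mono hw (f := fun i => x i + 1) fun i => Real.add_one_le_exp (x i)
  rwa [wavg_add, h0, wavg_const hs, zero_add] at h

theorem wavg_exp_le (hw : ∀ i, 0 ≤ w i) (hs : 0 < ∑ i, w i) {x : ι → ℝ}
    (h0 : wavg w x = 0) (hx : ∀ i, |x i| ≤ 1) :
    (wavg w fun i => Real.exp (x i)) ≤ 1 + wavg w fun i => x i ^ 2 := by
  have h := wavg_mono hw (f := fun i => Real.exp (x i)) (g := fun i => (x i + 1) + x i ^ 2)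
    fun i => by
    have := exp_quadratic_upper (hx i); linarith
  rw [wavg_add, wavg_add, h0, wavg_const hs] at h
  linarith

/-- Stability of a covariance under tilting. -/
theorem abs_wcov_tilt_sub_le_of_centered (hw : ∀ i, 0 ≤ w i) (hs : 0 < ∑ i, w i)
    {x z : ι → ℝ} {u K : ℝ} (h0 : wavg w x = 0) (hx : ∀ i, |x i| ≤ 1) (hz : ∀ i, |z i| ≤ K)
    (hK : 0 ≤ K) (hu0 : 0 ≤ u) (hu1 : u ≤ 1) :
    |wcov (fun i => w i * Real.exp (u * x i)) z x - wcov w z x| ≤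
      7 * K * wavg w fun i => x i ^ 2 := by
  set v := wavg w fun i => x i ^ 2 with hv
  have hv0 : 0 ≤ v := wavg_nonneg hw fun i => sq_nonneg _
  have hux0 : wavg w (fun i => u * x i) = 0 := by rw [wavg_const_mul, h0, mul_zero]
  have hux : ∀ i, |u * x i| ≤ 1 := fun i => by
    rw [abs_mul, abs_of_nonneg hu0]; nlinarith [hx i, abs_nonneg (x i)]
  have hE : ∀ i, |Real.exp (u * x i) - 1| ≤ 2 * |x i| := fun i => by
    refine (Real.abs_exp_sub_one_le (hux i)).trans ?_
    rw [abs_mul, abs_of_nonneg hu0]; nlinarith [abs_nonneg (x i)]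
  set m := wavg w fun i => Real.exp (u * x i) with hm
  have hm1 : 1 ≤ m := wavg_exp_ge_one hw hs hux0
  have hm2 : m ≤ 1 + v := by
    refine (wavg_exp_le hw hs hux0 hux).trans (add_le_add_right (wavg_mono hw fun i => ?_) _)
    rw [mul_pow]
    have : u ^ 2 ≤ 1 := by nlinarith
    nlinarith [sq_nonneg (x i)]
  set A := wavg w fun i => Real.exp (u * x i) * (z i * x i) with hA
  set Bz := wavg w fun i => Real.exp (u * x i) * z i with hBz
  set Bx := wavg w fun i => Real.exp (u * x i) * x i with hBx
  have e1 : wcov (fun i => w i * Real.exp (u * x i)) z x = A / m - Bz / m * (Bx / m) := by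
    unfold wcov
    rw [wavg_tilt hs, wavg_tilt hs, wavg_tilt hs]
  have e2 : wcov w z x = wavg w fun i => z i * x i := by
    unfold wcov; rw [h0, mul_zero, sub_zero]
  -- Every error is of second order in x: removing the tilt from the mean of z x costs 2Kv, the
  -- normalisation by m in [1, 1 + v] costs 3Kv, and the product of means costs 2Kv because x has
  -- mean zero before tilting. The total is 7Kv.
  have hA1 : |A - wcov w z x| ≤ 2 * K * v := by
    rw [e2, hA, ← wavg_sub]
    refine (abs_wavg_le_wavg_abs hw _).trans ?_
    rw [hv, ← wavg_const_mul]
    refine wavg_mono hw fun i => ?_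
    have : Real.exp (u * x i) * (z i * x i) - z i * x i
        = z i * x i * (Real.exp (u * x i) - 1) := by ring
    rw [this, abs_mul, abs_mul, ← sq_abs (x i)]
    calc |z i| * |x i| * |Real.exp (u * x i) - 1| ≤ K * |x i| * (2 * |x i|) := by
          gcongr
          · exact hz i
          · exact hE i
      _ = _ := by ring
  have hA2 : |A| ≤ 3 * K := by
    refine abs_wavg_le hw hs fun i => ?_
    rw [abs_mul, abs_mul, abs_of_pos (Real.exp_pos _)]
    have h3 : Real.exp (u * x i) ≤ 3 := by
      have := (abs_le.1 (hE i)).2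
      have := hx i
      linarith
    calc _ ≤ 3 * (K * 1) := by
          gcongr
          · exact hz i
          · exact hx i
      _ = _ := by ring
  have hB1 : |Bz / m| ≤ K := by
    rw [hBz, hm, ← wavg_tilt hs]
    exact abs_wavg_le (fun i => mul_nonneg (hw i) (Real.exp_pos _).le) (sum_tilt_pos hw hs _) hz
  have hB2 : |Bx| ≤ 2 * v := by
    have : Bx = wavg w fun i => Real.exp (u * x i) * x i - x i := by
      rw [wavg_sub, h0, sub_zero]
    rw [this, hv, ← wavg_const_mul]
    refine (abs_wavg_le_wavg_abs hw _).trans (wavg_mono hw fun i => ?_)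
    rw [← sub_one_mul, abs_mul, ← sq_abs (x i)]
    nlinarith [hE i, abs_nonneg (x i)]
  have hB3 : |Bx / m| ≤ 2 * v := by
    rw [abs_div, abs_of_pos (by linarith : 0 < m), div_le_iff₀ (by linarith)]
    nlinarith
  have hA3 : |A / m - A| ≤ 3 * K * v := by
    have : A / m - A = A * ((1 - m) / m) := by field_simp
    rw [this, abs_mul]
    have h4 : |(1 - m) / m| ≤ v := by
      rw [abs_div, abs_of_pos (by linarith : 0 < m), abs_of_nonpos (by linarith),
        div_le_iff₀ (by linarith)]
      nlinarith
    gcongr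
  have hBB : |Bz / m * (Bx / m)| ≤ K * (2 * v) := by
    rw [abs_mul]; gcongr
  rw [e1]
  rw [abs_le] at *
  constructor <;> linarith [hA1.1, hA1.2, hA3.1, hA3.2, hBB.1, hBB.2]

/-- Neither a covariance nor a normalised tilt changes when a constant is subtracted from `a`, so
the centred case suffices. -/
theorem abs_wcov_tilt_sub_le (hw : ∀ i, 0 ≤ w i) (hs : 0 < ∑ i, w i)
    {a z : ι → ℝ} {u K : ℝ} (ha : ∀ i, |a i - wavg w a| ≤ 1) (hz : ∀ i, |z i| ≤ K)
    (hK : 0 ≤ K) (hu0 : 0 ≤ u) (hu1 : u ≤ 1) :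
    |wcov (fun i => w i * Real.exp (u * a i)) z a - wcov w z a| ≤ 7 * K * wcov w a a := by
  have h := abs_wcov_tilt_sub_le_of_centered hw hs (x := fun i => a i - wavg w a)
    (by rw [wavg_sub_const hs, sub_self]) ha hz hK hu0 hu1
  have e : (fun i => w i * Real.exp (u * (a i - wavg w a)))
      = fun i => w i * Real.exp (u * a i - u * wavg w a) := by
    simp only [mul_sub]
  rw [← wcov_self_eq hs, wcov_sub_const_right hs] at h
  rw [e, wcov_sub_const_right
    (sum_tilt_pos hw hs fun i => u * a i - u * wavg w a)] at h
  simpa only [wcov, wavg_tilt_sub_const] using h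

/-- Stability of an average under tilting. -/
theorem abs_wavg_tilt_sub_le (hw : ∀ i, 0 ≤ w i) (hs : 0 < ∑ i, w i)
    {a z : ι → ℝ} {α K : ℝ} (ha : ∀ i, |a i - wavg w a| ≤ α) (hα : α ≤ 1)
    (hz : ∀ i, |z i| ≤ K) (hK : 0 ≤ K) :
    |wavg (fun i => w i * Real.exp (a i)) z - wavg w z| ≤ 4 * K * α := by
  rw [← wavg_tilt_sub_const a z (wavg w a)]
  set x : ι → ℝ := fun i => a i - wavg w a with hxdef
  have hE : ∀ i, |Real.exp (x i) - 1| ≤ 2 * α := fun i =>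
    (Real.abs_exp_sub_one_le ((ha i).trans hα)).trans (by linarith [ha i])
  have hx0 : wavg w x = 0 := by rw [hxdef, wavg_sub_const hs, sub_self]
  have hm1 := wavg_exp_ge_one hw hs hx0
  set m := wavg w fun i => Real.exp (x i) with hm
  have hz' := abs_wavg_le hw hs hz
  have hme : |m - 1| ≤ 2 * α := by
    rw [hm, ← wavg_sub_const hs]
    exact abs_wavg_le hw hs hE
  have hN : |wavg w (fun i => Real.exp (x i) * z i) - wavg w z| ≤ 2 * α * K := by
    rw [← wavg_sub]
    refine abs_wavg_le hw hs fun i => ?_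
    rw [← sub_one_mul, abs_mul]
    have := hE i
    have := (abs_nonneg _).trans this
    gcongr
    exact hz i
  rw [wavg_tilt hs]
  -- Numerator and normalisation each move by at most 2αK; dividing by m ≥ 1 does not enlarge their
  -- sum.
  have e : wavg w (fun i => Real.exp (x i) * z i) / m - wavg w z
      = ((wavg w (fun i => Real.exp (x i) * z i) - wavg w z) - (m - 1) * wavg w z) / m := by
    have : m ≠ 0 := by linarith
    field_simp
    ring
  rw [e, abs_div, abs_of_pos (by linarith : 0 < m), div_le_iff₀ (by linarith)]
  have hmz : |(m - 1) * wavg w z| ≤ 2 * α * K := by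
    rw [abs_mul]; have := (abs_nonneg _).trans hme; gcongr
  have hα0 : 0 ≤ 2 * α := (abs_nonneg _).trans hme
  calc _ ≤ 2 * α * K + 2 * α * K := (abs_sub _ _).trans (add_le_add hN hmz)
    _ = 4 * K * α * 1 := by ring
    _ ≤ 4 * K * α * m := by
      gcongr
      nlinarith

end WeightedAverage

end

noncomputable section

/-! ### Derivatives of the log-partial likelihood -/

theorem wcov_sum_right {ι κ : Type*} [Fintype ι] (w f : ι → ℝ) (s : Finset κ) (c : κ → ℝ)
    (g : κ → ι → ℝ) :
    wcov w f (fun i => ∑ k ∈ s, c k * g k i) = ∑ k ∈ s, c k * wcov w f (g k) := by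
  unfold wcov
  have h : (fun i => f i * ∑ k ∈ s, c k * g k i) = fun i => ∑ k ∈ s, c k * (f i * g k i) := by
    funext i; rw [Finset.mul_sum]; exact Finset.sum_congr rfl fun k _ => by ring
  rw [h, wavg_sum, wavg_sum, Finset.mul_sum, ← Finset.sum_sub_distrib]
  refine Finset.sum_congr rfl fun k _ => ?_
  rw [wavg_const_mul, wavg_const_mul]; ring

theorem wcov_comm {ι : Type*} [Fintype ι] (w f g : ι → ℝ) : wcov w f g = wcov w g f := by
  unfold wcov
  simp only [mul_comm]

/-- The linear form with coefficients `c`. -/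
def linForm {p : ℕ} (c : Fin p → ℝ) : (Fin p → ℝ) →L[ℝ] ℝ :=
  ∑ k, c k • (ContinuousLinearMap.proj k : (Fin p → ℝ) →L[ℝ] ℝ)

theorem linForm_single {p : ℕ} (c : Fin p → ℝ) (l : Fin p) :
    linForm c (Pi.single l 1) = c l := by
  simp [linForm, Pi.single_apply]

theorem hasFDerivAt_linForm {p : ℕ} (c β : Fin p → ℝ) :
    HasFDerivAt (fun b : Fin p → ℝ => ∑ k, b k * c k) (linForm c) β := by
  refine HasFDerivAt.fun_sum fun k _ => ?_
  exact (ContinuousLinearMap.proj (R := ℝ) (φ := fun _ : Fin p => ℝ) k).hasFDerivAt.mul_const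
    (c k)

namespace CoxModel

variable {p n : ℕ} {E : Type*} (m : CoxModel p E)

/-- The weights of the individuals of the sample at the time observed for the `i`-th one. -/
def riskWeight (x : Fin n → E) (β : Fin p → ℝ) (i j : Fin n) : ℝ :=
  m.weight (m.obsTime (x i)) β (x j)

/-- The covariates of the individuals of the sample at the time observed for the `i`-th one. -/
def riskCov (x : Fin n → E) (i : Fin n) (k : Fin p) (j : Fin n) : ℝ :=
  m.covariate (m.obsTime (x i)) (x j) k

theorem failInd_nonneg (e : E) : 0 ≤ m.failInd e := by
  unfold failInd; split_ifs <;> norm_num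

theorem failInd_le_one (e : E) : m.failInd e ≤ 1 := by
  unfold failInd; split_ifs <;> norm_num

theorem atRisk_nonneg (t : ℝ) (e : E) : 0 ≤ m.atRisk t e := by
  unfold atRisk; split_ifs <;> norm_num

theorem weight_nonneg (t : ℝ) (β : Fin p → ℝ) (e : E) : 0 ≤ m.weight t β e :=
  mul_nonneg (m.atRisk_nonneg t e) (Real.exp_pos _).le

theorem riskWeight_nonneg (x : Fin n → E) (β : Fin p → ℝ) (i j : Fin n) :
    0 ≤ m.riskWeight x β i j := m.weight_nonneg _ _ _

theorem riskWeight_self_pos (x : Fin n → E) (β : Fin p → ℝ) (i : Fin n) :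
    0 < m.riskWeight x β i i := by
  simp only [riskWeight, weight, atRisk, le_refl, if_true, one_mul]
  exact Real.exp_pos _

theorem sum_riskWeight_pos (x : Fin n → E) (β : Fin p → ℝ) (i : Fin n) :
    0 < ∑ j, m.riskWeight x β i j :=
  Finset.sum_pos' (fun j _ => m.riskWeight_nonneg x β i j)
    ⟨i, Finset.mem_univ _, m.riskWeight_self_pos x β i⟩

/-- The bridge between the likelihood and weighted averages: a shift of β is an exponential tilt by
the linear predictor. -/
theorem riskWeight_add (x : Fin n → E) (β D : Fin p → ℝ) (i : Fin n) :
    m.riskWeight x (β + D) i =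
      fun j => m.riskWeight x β i j * Real.exp (∑ k, D k * m.riskCov x i k j) := by
  funext j
  simp only [riskWeight, weight, riskCov, add_dotProduct, Real.exp_add, mul_assoc]
  rfl

theorem logLik_eq (x : Fin n → E) (β : Fin p → ℝ) :
    m.logLik x β = (1 / (n : ℝ)) * ∑ i, m.failInd (x i) *
      ((∑ k, β k * m.riskCov x i k i) - Real.log (∑ j, m.riskWeight x β i j)) := by
  simp only [logLik, mul_sub, Finset.sum_sub_distrib]
  rfl

theorem Zbar_apply (x : Fin n → E) (s : ℝ) (β : Fin p → ℝ) (k : Fin p) :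
    m.Zbar x s β k =
      wavg (fun j => m.weight s β (x j)) fun j => m.covariate s (x j) k := by
  simp only [Zbar, Finset.sum_apply, Pi.smul_apply, smul_eq_mul, wavg, Finset.sum_div]
  exact Finset.sum_congr rfl fun i _ => by ring

theorem hasFDerivAt_riskWeight (x : Fin n → E) (β : Fin p → ℝ) (i j : Fin n) :
    HasFDerivAt (fun b => m.riskWeight x b i j)
      (m.riskWeight x β i j •
        linForm fun k => m.riskCov x i k j) β := by
  have h1 := hasFDerivAt_linForm (fun k => m.riskCov x i k j) β
  have h2 := (h1.exp).const_mul (m.atRisk (m.obsTime (x i)) (x j))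
  rw [smul_smul] at h2
  exact h2

theorem hasFDerivAt_logLik (x : Fin n → E) (β : Fin p → ℝ) :
    HasFDerivAt (m.logLik x)
      ((1 / (n : ℝ)) • ∑ i, m.failInd (x i) •
        ((linForm fun k => m.riskCov x i k i) -
          (∑ j, m.riskWeight x β i j)⁻¹ • ∑ j, m.riskWeight x β i j •
        linForm fun k => m.riskCov x i k j)) β := by
  have e : m.logLik x = fun b => (1 / (n : ℝ)) * ∑ i, m.failInd (x i) *
      ((∑ k, b k * m.riskCov x i k i) - Real.log (∑ j, m.riskWeight x b i j)) :=
    funext (m.logLik_eq x)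
  rw [e]
  refine (HasFDerivAt.fun_sum fun i _ => ?_).const_mul _
  refine (HasFDerivAt.sub ?_ ?_).const_mul _
  · exact hasFDerivAt_linForm (fun k => m.riskCov x i k i) β
  · exact (HasFDerivAt.fun_sum fun j _ => m.hasFDerivAt_riskWeight x β i j).log
      (m.sum_riskWeight_pos x β i).ne'

theorem score_eq (x : Fin n → E) (β : Fin p → ℝ) (j : Fin p) :
    m.score x β j = (1 / (n : ℝ)) * ∑ i, m.failInd (x i) *
      (m.riskCov x i j i - wavg (m.riskWeight x β i) (m.riskCov x i j)) := by
  rw [score, partialDeriv, (m.hasFDerivAt_logLik x β).fderiv]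
  simp only [_root_.smul_apply, _root_.sub_apply,
    _root_.sum_apply, linForm_single, smul_eq_mul]
  congr 1
  refine Finset.sum_congr rfl fun i _ => ?_
  rw [wavg, inv_mul_eq_div]

/-- In an exponential family the derivative of a mean is a covariance. Only the values of the
differential on the basis vectors matter later. -/
theorem hasFDerivAt_wavg_riskWeight (x : Fin n → E) (β : Fin p → ℝ) (i : Fin n) (f : Fin n → ℝ) :
    ∃ L : (Fin p → ℝ) →L[ℝ] ℝ, HasFDerivAt (fun b => wavg (m.riskWeight x b i) f) L β ∧
      ∀ l, L (Pi.single l 1) = wcov (m.riskWeight x β i) f (m.riskCov x i l) := by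
  have hD := (m.sum_riskWeight_pos x β i).ne'
  have h1 : HasFDerivAt (fun b => ∑ j, m.riskWeight x b i j * f j) _ β :=
    HasFDerivAt.fun_sum fun j _ => (m.hasFDerivAt_riskWeight x β i j).mul_const (f j)
  have h2 : HasFDerivAt (fun b => ∑ j, m.riskWeight x b i j) _ β :=
    HasFDerivAt.fun_sum fun j _ => m.hasFDerivAt_riskWeight x β i j
  have h3 := h1.mul ((hasDerivAt_inv hD).comp_hasFDerivAt β h2)
  refine ⟨_, h3, fun l => ?_⟩
  simp only [_root_.smul_apply, _root_.add_apply, Function.comp_apply,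
    _root_.sum_apply, linForm_single, smul_eq_mul, wcov, wavg]
  field_simp
  simp only [mul_comm (f _)]
  ring

theorem hessian_eq (x : Fin n → E) (β : Fin p → ℝ) (j l : Fin p) :
    m.hessian x β j l = -((1 / (n : ℝ)) * ∑ i, m.failInd (x i) *
      wcov (m.riskWeight x β i) (m.riskCov x i j) (m.riskCov x i l)) := by
  rw [hessian, Matrix.of_apply, partialDeriv]
  have e : (fun b => m.score x b j) = fun b => (1 / (n : ℝ)) * ∑ i, m.failInd (x i) *
      (m.riskCov x i j i - wavg (m.riskWeight x b i) (m.riskCov x i j)) :=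
    funext fun b => m.score_eq x b j
  choose L hL hL' using fun i => m.hasFDerivAt_wavg_riskWeight x β i (m.riskCov x i j)
  have h : HasFDerivAt (fun b => m.score x b j)
      ((1 / (n : ℝ)) • ∑ i, m.failInd (x i) • (-(L i))) β := by
    rw [e]
    refine (HasFDerivAt.fun_sum fun i _ => ?_).const_mul _
    exact ((hL i).const_sub _).const_mul _
  rw [h.fderiv]
  simp only [_root_.smul_apply, _root_.neg_apply,
    _root_.sum_apply, hL', smul_eq_mul, mul_neg, Finset.sum_neg_distrib]

theorem hessian_row_mul (x : Fin n → E) (β D : Fin p → ℝ) (j : Fin p) :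
    ∑ l, m.hessian x β j l * D l = -((1 / (n : ℝ)) * ∑ i, m.failInd (x i) *
      wcov (m.riskWeight x β i) (m.riskCov x i j) fun q => ∑ l, D l * m.riskCov x i l q) := by
  simp only [hessian_eq, wcov_sum_right, neg_mul, Finset.sum_neg_distrib, Finset.mul_sum,
    Finset.sum_mul]
  rw [Finset.sum_comm]
  refine congrArg _ (Finset.sum_congr rfl fun i _ => Finset.sum_congr rfl fun l _ => by ring)

theorem neg_hessian_quadratic (x : Fin n → E) (β D : Fin p → ℝ) :
    D ⬝ᵥ (-m.hessian x β) *ᵥ D = (1 / (n : ℝ)) * ∑ i, m.failInd (x i) *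
      wcov (m.riskWeight x β i) (fun q => ∑ l, D l * m.riskCov x i l q)
        fun q => ∑ l, D l * m.riskCov x i l q := by
  have e : ∀ j, (m.hessian x β *ᵥ D) j = _ := fun j => m.hessian_row_mul x β D j
  simp only [Matrix.neg_mulVec, dotProduct, Pi.neg_apply, e, neg_neg]
  simp only [Finset.mul_sum]
  rw [Finset.sum_comm]
  refine Finset.sum_congr rfl fun i _ => ?_
  rw [wcov_comm]
  simp only [wcov_sum_right (f := fun q => ∑ l, D l * m.riskCov x i l q), Finset.mul_sum]
  refine Finset.sum_congr rfl fun l _ => ?_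
  rw [wcov_comm (f := m.riskCov x i l)]
  ring

end CoxModel

end

noncomputable section

/-! ### Deterministic analysis of the Lasso -/

theorem l1norm_nonneg {p : ℕ} (v : Fin p → ℝ) : 0 ≤ l1norm v :=
  Finset.sum_nonneg fun _ _ => abs_nonneg _

theorem abs_sum_mul_le_l1norm {p : ℕ} (v z : Fin p → ℝ) {c : ℝ} (hz : ∀ k, |z k| ≤ c) :
    |∑ k, v k * z k| ≤ c * l1norm v := by
  refine (Finset.abs_sum_le_sum_abs _ _).trans ?_
  rw [l1norm, Finset.mul_sum]
  refine Finset.sum_le_sum fun k _ => ?_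
  rw [abs_mul, mul_comm]
  gcongr
  exact hz k

theorem abs_le_l1norm {p : ℕ} (v : Fin p → ℝ) (j : Fin p) : |v j| ≤ l1norm v :=
  Finset.single_le_sum (f := fun j => |v j|) (fun _ _ => abs_nonneg _) (Finset.mem_univ j)

theorem l1norm_smul {p : ℕ} (t : ℝ) (v : Fin p → ℝ) : l1norm (t • v) = |t| * l1norm v := by
  simp only [l1norm, Pi.smul_apply, smul_eq_mul, abs_mul, Finset.mul_sum]

namespace CoxModel

variable {p n : ℕ} {E : Type*} (m : CoxModel p E)

/-- An average over the observed failures. -/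
def failAvg (x : Fin n → E) (f : Fin n → ℝ) : ℝ := (1 / (n : ℝ)) * ∑ i, m.failInd (x i) * f i

theorem failAvg_sub (x : Fin n → E) (f g : Fin n → ℝ) :
    m.failAvg x (fun i => f i - g i) = m.failAvg x f - m.failAvg x g := by
  simp only [failAvg, mul_sub, Finset.sum_sub_distrib]

theorem failAvg_const_mul (x : Fin n → E) (c : ℝ) (f : Fin n → ℝ) :
    m.failAvg x (fun i => c * f i) = c * m.failAvg x f := by
  simp only [failAvg, mul_left_comm _ c, ← Finset.mul_sum]

theorem failAvg_sum_mul (x : Fin n → E) (D : Fin p → ℝ) (f : Fin p → Fin n → ℝ) :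
    m.failAvg x (fun i => ∑ k, D k * f k i) = ∑ k, D k * m.failAvg x (f k) := by
  simp only [failAvg, Finset.mul_sum]
  rw [Finset.sum_comm]
  exact Finset.sum_congr rfl fun k _ => Finset.sum_congr rfl fun i _ => by ring

theorem failAvg_mono (x : Fin n → E) {f g : Fin n → ℝ} (h : ∀ i, f i ≤ g i) :
    m.failAvg x f ≤ m.failAvg x g := by
  unfold failAvg
  gcongr with i _
  · exact m.failInd_nonneg _
  · exact h i

theorem abs_failAvg_le_failAvg (x : Fin n → E) (f : Fin n → ℝ) :
    |m.failAvg x f| ≤ m.failAvg x fun i => |f i| := by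
  unfold failAvg
  rw [abs_mul, abs_of_nonneg (by positivity : 0 ≤ 1 / (n : ℝ))]
  gcongr
  refine (Finset.abs_sum_le_sum_abs _ _).trans (Finset.sum_le_sum fun i _ => ?_)
  rw [abs_mul, abs_of_nonneg (m.failInd_nonneg _)]

theorem failAvg_le_avg (x : Fin n → E) {f : Fin n → ℝ} (hf : ∀ i, 0 ≤ f i) :
    m.failAvg x f ≤ (1 / (n : ℝ)) * ∑ i, f i := by
  unfold failAvg
  gcongr with i _
  exact mul_le_of_le_one_left (hf i) (m.failInd_le_one _)

theorem abs_failAvg_le (x : Fin n → E) {f : Fin n → ℝ} {c : ℝ} (hc : 0 ≤ c)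
    (h : ∀ i, |f i| ≤ c) : |m.failAvg x f| ≤ c := by
  refine (m.abs_failAvg_le_failAvg x f).trans ((m.failAvg_le_avg x fun i => abs_nonneg _).trans ?_)
  calc (1 / (n : ℝ)) * ∑ i, |f i| ≤ (1 / (n : ℝ)) * ∑ _i : Fin n, c := by
        gcongr with i _; exact h i
    _ = ((n : ℝ) / n) * c := by simp; ring
    _ ≤ 1 * c := by gcongr; exact div_self_le_one _
    _ = c := one_mul c

/-- The linear predictor `Dᵀ Z_j` at the time observed for the `i`-th individual. -/
def riskLin (x : Fin n → E) (D : Fin p → ℝ) (i j : Fin n) : ℝ := ∑ k, D k * m.riskCov x i k j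

/-- All covariates at all observed times are bounded by `K`. -/
def SampleBounded (x : Fin n → E) (K : ℝ) : Prop :=
  ∀ i j, ‖m.covariate (m.obsTime (x i)) (x j)‖ ≤ K

variable {m} {x : Fin n → E} {K : ℝ}

theorem SampleBounded.abs_riskCov_le (h : m.SampleBounded x K) (i : Fin n) (k : Fin p)
    (j : Fin n) : |m.riskCov x i k j| ≤ K :=
  (norm_le_pi_norm (m.covariate (m.obsTime (x i)) (x j)) k).trans (h i j)

theorem SampleBounded.abs_wavg_riskCov_le (h : m.SampleBounded x K) (β : Fin p → ℝ) (i : Fin n)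
    (k : Fin p) : |wavg (m.riskWeight x β i) (m.riskCov x i k)| ≤ K :=
  abs_wavg_le (m.riskWeight_nonneg x β i) (m.sum_riskWeight_pos x β i) (h.abs_riskCov_le i k)

theorem SampleBounded.abs_riskLin_sub_le (h : m.SampleBounded x K) (β D : Fin p → ℝ)
    (i j : Fin n) :
    |m.riskLin x D i j - wavg (m.riskWeight x β i) (m.riskLin x D i)| ≤ 2 * K * l1norm D := by
  have h1 : ∀ j, |m.riskLin x D i j| ≤ K * l1norm D := fun j =>
    abs_sum_mul_le_l1norm _ _ fun k => h.abs_riskCov_le i k j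
  have h2 := abs_wavg_le (m.riskWeight_nonneg x β i) (m.sum_riskWeight_pos x β i) h1
  refine (abs_sub _ _).trans ?_
  linarith [h1 j]

theorem wavg_riskLin (β D : Fin p → ℝ) (i : Fin n) :
    wavg (m.riskWeight x β i) (m.riskLin x D i) =
      ∑ k, D k * wavg (m.riskWeight x β i) (m.riskCov x i k) := by
  unfold riskLin
  rw [wavg_sum]
  simp only [wavg_const_mul]

theorem sum_mul_score (β D : Fin p → ℝ) :
    ∑ j, D j * m.score x β j = m.failAvg x fun i =>
      m.riskLin x D i i - wavg (m.riskWeight x β i) (m.riskLin x D i) := by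
  simp only [score_eq, wavg_riskLin, riskLin, ← Finset.sum_sub_distrib, ← mul_sub]
  rw [failAvg_sum_mul]
  rfl

/-- The remainder of the linear expansion is exactly an average of logarithmic moment generating
functions, centred at their first-order term. Concavity and curvature thus reduce to inequalities
for one risk set at a time. -/
theorem logLik_add (β D : Fin p → ℝ) :
    m.logLik x (β + D) = m.logLik x β + ∑ j, D j * m.score x β j -
      m.failAvg x fun i => Real.log (∑ j, m.riskWeight x β i j * Real.exp (m.riskLin x D i j)) -
        Real.log (∑ j, m.riskWeight x β i j) -
        wavg (m.riskWeight x β i) (m.riskLin x D i) := by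
  rw [sum_mul_score, logLik_eq, logLik_eq]
  simp only [riskWeight_add, failAvg, ← mul_add, ← mul_sub, ← Finset.sum_add_distrib,
    ← Finset.sum_sub_distrib, Pi.add_apply, add_mul]
  simp only [riskLin]
  congr 1
  refine Finset.sum_congr rfl fun i _ => ?_
  rw [Finset.sum_add_distrib]
  ring

theorem logLik_add_le (β D : Fin p → ℝ) :
    m.logLik x (β + D) ≤ m.logLik x β + ∑ j, D j * m.score x β j := by
  rw [logLik_add]
  have h : m.failAvg x (fun _ => 0) ≤ m.failAvg x fun i =>
      Real.log (∑ j, m.riskWeight x β i j * Real.exp (m.riskLin x D i j)) -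
        Real.log (∑ j, m.riskWeight x β i j) - wavg (m.riskWeight x β i) (m.riskLin x D i) :=
    m.failAvg_mono x fun i => sub_nonneg.2
      (wavg_le_log_tilt (m.riskWeight_nonneg x β i) (m.sum_riskWeight_pos x β i) _)
  have h0 : m.failAvg x (fun _ => 0) = 0 := by simp [failAvg]
  linarith

theorem neg_hessian_quadratic_eq (β D : Fin p → ℝ) :
    D ⬝ᵥ (-m.hessian x β) *ᵥ D = m.failAvg x fun i =>
      wcov (m.riskWeight x β i) (m.riskLin x D i) (m.riskLin x D i) :=
  m.neg_hessian_quadratic x β D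

theorem SampleBounded.logLik_add_le_sub (h : m.SampleBounded x K) (β D : Fin p → ℝ)
    (hD : 2 * K * l1norm D ≤ 1) :
    m.logLik x (β + D) ≤ m.logLik x β + ∑ j, D j * m.score x β j -
      (D ⬝ᵥ (-m.hessian x β) *ᵥ D) / 5 := by
  rw [logLik_add, neg_hessian_quadratic_eq]
  have h1 := m.failAvg_mono x
    (f := fun i => 5⁻¹ * wcov (m.riskWeight x β i) (m.riskLin x D i) (m.riskLin x D i))
    (g := fun i =>
      Real.log (∑ j, m.riskWeight x β i j * Real.exp (m.riskLin x D i j)) -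
        Real.log (∑ j, m.riskWeight x β i j) - wavg (m.riskWeight x β i) (m.riskLin x D i))
    fun i => by
      have := wavg_add_wcov_le_log_tilt (m.riskWeight_nonneg x β i) (m.sum_riskWeight_pos x β i)
        (m.riskLin x D i) fun j => (h.abs_riskLin_sub_le β D i j).trans hD
      linarith
  rw [failAvg_const_mul] at h1
  linarith

theorem neg_hessian_quadratic_nonneg (β D : Fin p → ℝ) :
    0 ≤ D ⬝ᵥ (-m.hessian x β) *ᵥ D := by
  rw [neg_hessian_quadratic_eq]
  have h := m.failAvg_mono x (f := fun _ => 0) fun i => wcov_self_nonneg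
    (m.riskWeight_nonneg x β i) (m.sum_riskWeight_pos x β i) (m.riskLin x D i)
  simpa [failAvg] using h

theorem logLik_concave (β D : Fin p → ℝ) {t : ℝ} (h0 : 0 ≤ t) (h1 : t ≤ 1) :
    (1 - t) * m.logLik x β + t * m.logLik x (β + D) ≤ m.logLik x (β + t • D) := by
  -- The supporting hyperplane at β + tD is evaluated at both ends of the segment; weighting by 1 -
  -- t and t cancels the linear terms.
  have e0 := logLik_add_le (m := m) (x := x) (β + t • D) ((-t) • D)
  have e1 := logLik_add_le (m := m) (x := x) (β + t • D) ((1 - t) • D)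
  rw [show β + t • D + (-t) • D = β by simp] at e0
  rw [show β + t • D + (1 - t) • D = β + D by
    rw [add_assoc, ← add_smul]; simp] at e1
  simp only [Pi.smul_apply, smul_eq_mul, mul_assoc, ← Finset.mul_sum] at e0 e1
  nlinarith [mul_le_mul_of_nonneg_left e0 (sub_nonneg.2 h1), mul_le_mul_of_nonneg_left e1 h0]

theorem l1norm_coef_add_ge (D : Fin p → ℝ) {t : ℝ} (ht : 0 ≤ t) :
    l1norm m.coef - t * ∑ j ∈ m.support, |D j| + t * ∑ j ∈ m.supportᶜ, |D j| ≤
      l1norm (m.coef + t • D) := by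
  unfold l1norm
  rw [← Finset.sum_add_sum_compl m.support fun j => |(m.coef + t • D) j|,
    ← Finset.sum_add_sum_compl m.support fun j => |m.coef j|]
  have e : ∑ j ∈ m.supportᶜ, |m.coef j| = 0 := Finset.sum_eq_zero fun j hj => by
    simpa [support] using hj
  have h1 : ∑ j ∈ m.support, |m.coef j| - t * ∑ j ∈ m.support, |D j| ≤
      ∑ j ∈ m.support, |(m.coef + t • D) j| := by
    rw [Finset.mul_sum, ← Finset.sum_sub_distrib]
    refine Finset.sum_le_sum fun j _ => ?_
    have := abs_sub_abs_le_abs_sub (m.coef j) (-(t * D j))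
    rw [abs_neg, abs_mul, abs_of_nonneg ht, sub_neg_eq_add] at this
    simpa using this
  have h2 : t * ∑ j ∈ m.supportᶜ, |D j| = ∑ j ∈ m.supportᶜ, |(m.coef + t • D) j| := by
    rw [Finset.mul_sum]
    refine Finset.sum_congr rfl fun j hj => ?_
    have : m.coef j = 0 := by simpa [support] using hj
    simp [this, abs_mul, abs_of_nonneg ht]
  rw [e, h2]
  linarith

/-- The quadratic improvement of Jensen's inequality holds only for short steps, so D is shortened
to tD and concavity carries the Lasso inequality from D to tD. The noise contributes λ/3 on all
coordinates and the penalty λ on the support, -λ off it: hence 4/3 and -2/3. -/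
theorem SampleBounded.lasso_basic (h : m.SampleBounded x K) {lam : ℝ} (hlam : 0 ≤ lam)
    {D : Fin p → ℝ} (hb : m.IsLasso x lam (m.coef + D))
    (hz : ∀ j, |m.score x m.coef j| ≤ lam / 3) {t : ℝ} (h0 : 0 ≤ t) (h1 : t ≤ 1)
    (ht : 2 * K * (t * l1norm D) ≤ 1) :
    t ^ 2 * (D ⬝ᵥ (-m.hessian x m.coef) *ᵥ D) / 5 ≤
      t * (4 / 3 * lam * ∑ j ∈ m.support, |D j| - 2 / 3 * lam * ∑ j ∈ m.supportᶜ, |D j|) := by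
  have c1 := logLik_concave (m := m) (x := x) m.coef D h0 h1
  have c2 := hb m.coef
  have c3 := h.logLik_add_le_sub m.coef (t • D) (by rwa [l1norm_smul, abs_of_nonneg h0])
  have c5 := l1norm_coef_add_ge (m := m) D h0
  have c6 := l1norm_coef_add_ge (m := m) D zero_le_one
  rw [one_smul, one_mul, one_mul] at c6
  have c4 := abs_sum_mul_le_l1norm (t • D) (m.score x m.coef) hz
  rw [l1norm_smul, abs_of_nonneg h0] at c4
  have e : (t • D) ⬝ᵥ (-m.hessian x m.coef) *ᵥ (t • D)
      = t ^ 2 * (D ⬝ᵥ (-m.hessian x m.coef) *ᵥ D) := by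
    rw [Matrix.mulVec_smul, dotProduct_smul, smul_dotProduct]; simp only [smul_eq_mul]; ring
  rw [e] at c3
  have e2 : l1norm D = ∑ j ∈ m.support, |D j| + ∑ j ∈ m.supportᶜ, |D j| :=
    (Finset.sum_add_sum_compl _ _).symm
  rw [e2] at c4
  have c7 := mul_le_mul_of_nonneg_left c2 h0
  have c8 := mul_le_mul_of_nonneg_left c6 (mul_nonneg h0 hlam)
  have c4' := (abs_le.1 c4).2
  nlinarith

theorem SampleBounded.lasso_bound (h : m.SampleBounded x K) (hK : 0 < K) {lam C : ℝ}
    (hlam : 0 < lam) {D : Fin p → ℝ} (hb : m.IsLasso x lam (m.coef + D))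
    (hz : ∀ j, |m.score x m.coef j| ≤ lam / 3)
    (hκ : ∀ v : Fin p → ℝ, v ≠ 0 → ∑ j ∈ m.supportᶜ, |v j| ≤ 2 * ∑ j ∈ m.support, |v j| →
      (∑ j ∈ m.support, |v j|) ^ 2 ≤ C * m.sparsity * (v ⬝ᵥ (-m.hessian x m.coef) *ᵥ v))
    (hC : 0 ≤ C) (hsmall : 2 * K * (20 * (C * m.sparsity * lam)) < 1) :
    l1norm D ≤ 20 * (C * m.sparsity * lam) ∧
      D ⬝ᵥ (-m.hessian x m.coef) *ᵥ D ≤ 45 * (C * m.sparsity * lam ^ 2) := by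
  have hη : 0 ≤ C * m.sparsity * lam := by positivity
  by_cases hD : D = 0
  · subst hD
    simp only [l1norm, Pi.zero_apply, abs_zero, Finset.sum_const_zero, zero_dotProduct]
    exact ⟨by positivity, by positivity⟩
  have hDpos : 0 < l1norm D := by
    obtain ⟨j, hj⟩ := Function.ne_iff.1 hD
    exact (abs_pos.2 hj).trans_le (abs_le_l1norm D j)
  set A := ∑ j ∈ m.support, |D j| with hA
  set N := ∑ j ∈ m.supportᶜ, |D j| with hN
  set Q := D ⬝ᵥ (-m.hessian x m.coef) *ᵥ D with hQ
  have hA0 : 0 ≤ A := Finset.sum_nonneg fun _ _ => abs_nonneg _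
  have hN0 : 0 ≤ N := Finset.sum_nonneg fun _ _ => abs_nonneg _
  have e2 : l1norm D = A + N := (Finset.sum_add_sum_compl _ _).symm
  have hQ0 : 0 ≤ Q := neg_hessian_quadratic_nonneg _ _
  -- This step along D stays within the range of the quadratic bound. If t were below 1, then
  -- 2Kt‖D‖₁ would equal 1, against the a priori bound on t‖D‖₁ and `hsmall`; so the localisation
  -- was not active.
  set t : ℝ := min 1 (1 / (2 * K * l1norm D)) with ht
  have ht0 : 0 < t := lt_min one_pos (by positivity)
  have ht1 : t ≤ 1 := min_le_left _ _
  have ht2 : 2 * K * (t * l1norm D) ≤ 1 := by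
    have : t ≤ 1 / (2 * K * l1norm D) := min_le_right _ _
    rw [le_div_iff₀ (by positivity)] at this
    linarith
  have hb' := h.lasso_basic hlam.le hb hz ht0.le ht1 ht2
  rw [← hA, ← hN, ← hQ] at hb'
  have hb1 : t * Q / 5 ≤ 4 / 3 * lam * A - 2 / 3 * lam * N := by
    refine le_of_mul_le_mul_left ?_ ht0
    calc t * (t * Q / 5) = t ^ 2 * Q / 5 := by ring
      _ ≤ _ := hb'
  have hcone : N ≤ 2 * A := by
    have h1 : 0 ≤ t * Q / 5 := by positivity
    refine le_of_mul_le_mul_left ?_ hlam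
    linarith
  have hκD := hκ D hD hcone
  rw [← hA, ← hQ] at hκD
  have hApos : 0 < A := by linarith
  have hCd : 0 ≤ C * m.sparsity := by positivity
  have htA : t * A ≤ 20 / 3 * (C * m.sparsity * lam) := by
    refine le_of_mul_le_mul_right ?_ hApos
    have h1 : t * Q ≤ 20 / 3 * lam * A := by nlinarith
    have h2 := mul_le_mul_of_nonneg_left h1 hCd
    nlinarith [mul_le_mul_of_nonneg_left hκD ht0.le]
  -- In the cone ‖D‖₁ ≤ 3A, so 20 is three times 20/3.
  have htD : t * l1norm D ≤ 20 * (C * m.sparsity * lam) := by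
    rw [e2]; nlinarith
  have htt : t = 1 := by
    by_contra hne
    have : t = 1 / (2 * K * l1norm D) := by
      rcases min_choice 1 (1 / (2 * K * l1norm D)) with h1 | h1
      · exact absurd h1 hne
      · exact h1
    have h3 : 2 * K * (t * l1norm D) = 1 := by
      rw [this]; field_simp
    nlinarith
  rw [htt, one_mul] at htD htA hb1
  refine ⟨htD, ?_⟩
  have : Q ≤ 20 / 3 * lam * A := by nlinarith
  calc Q ≤ 20 / 3 * lam * (20 / 3 * (C * m.sparsity * lam)) := this.trans (by gcongr)
    _ = (400 / 9) * (C * m.sparsity * lam ^ 2) := by ring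
    _ ≤ _ := by gcongr; norm_num

/-- Moving one coordinate by s changes the penalty by at most λ|s|, which bounds the difference
quotients of the likelihood: those from the left give the lower bound, those from the right the
upper one. -/
theorem IsLasso.abs_score_le {lam : ℝ} {b : Fin p → ℝ} (hlam : 0 ≤ lam)
    (hb : m.IsLasso x lam b) (j : Fin p) : |m.score x b j| ≤ lam := by
  set e : Fin p → ℝ := Pi.single j 1 with he
  have hd : HasDerivAt (fun s : ℝ => m.logLik x (b + s • e)) (m.score x b j) 0 := by
    have h1 : HasDerivAt (fun s : ℝ => b + s • e) e 0 := by
      simpa using ((hasDerivAt_id (0 : ℝ)).smul_const e).const_add b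
    have h2 := (m.hasFDerivAt_logLik x b)
    have h3 : HasFDerivAt (m.logLik x) (fderiv ℝ (m.logLik x) b) (b + (0 : ℝ) • e) := by
      rw [zero_smul, add_zero]; exact h2.differentiableAt.hasFDerivAt
    exact h3.comp_hasDerivAt (0 : ℝ) h1
  have hle : ∀ s : ℝ, m.logLik x (b + s • e) - m.logLik x b ≤ lam * |s| := by
    intro s
    have h1 := hb (b + s • e)
    have h2 : l1norm (b + s • e) ≤ l1norm b + |s| := by
      have : l1norm e = 1 := by
        simp only [l1norm, he, Pi.single_apply, apply_ite abs, abs_one, abs_zero]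
        simp
      rw [← mul_one |s|, ← this, ← l1norm_smul]
      unfold l1norm
      rw [← Finset.sum_add_distrib]
      exact Finset.sum_le_sum fun k _ => abs_add_le _ _
    nlinarith
  have hs := hasDerivAt_iff_tendsto_slope_zero.1 hd
  simp only [zero_add, zero_smul, add_zero, smul_eq_mul] at hs
  rw [abs_le]
  constructor
  · refine ge_of_tendsto (hs.mono_left (nhdsWithin_mono 0 (s := Set.Iio 0) fun s hs => hs.ne)) ?_
    filter_upwards [self_mem_nhdsWithin] with s hs
    have hs : s < 0 := hs
    have := hle s
    rw [abs_of_neg hs] at this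
    rw [inv_mul_eq_div, le_div_iff_of_neg hs]
    linarith
  · refine le_of_tendsto (hs.mono_left (nhdsWithin_mono 0 (s := Set.Ioi 0) fun s hs => hs.ne')) ?_
    filter_upwards [self_mem_nhdsWithin] with s hs
    have hs : 0 < s := hs
    have := hle s
    rw [abs_of_pos hs] at this
    rw [inv_mul_eq_div, div_le_iff₀ hs]
    linarith

theorem Vhat_apply (β : Fin p → ℝ) (k l : Fin p) :
    m.Vhat x β k l = m.failAvg x fun i =>
      (m.riskCov x i k i - wavg (m.riskWeight x β i) (m.riskCov x i k)) *
        (m.riskCov x i l i - wavg (m.riskWeight x β i) (m.riskCov x i l)) := by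
  simp only [Vhat, failAvg, Matrix.smul_apply, Matrix.sum_apply, smul_eq_mul,
    Matrix.vecMulVec_apply, Pi.sub_apply, Zbar_apply]
  rfl

theorem abs_mul_sub_mul_le {a b a' b' c ε : ℝ} (hb : |b| ≤ c) (ha' : |a'| ≤ c)
    (h1 : |a - a'| ≤ ε) (h2 : |b - b'| ≤ ε) : |a * b - a' * b'| ≤ 2 * c * ε := by
  have e : a * b - a' * b' = (a - a') * b + a' * (b - b') := by ring
  have hc := (abs_nonneg _).trans hb
  have hε := (abs_nonneg _).trans h1
  rw [e]
  refine (abs_add_le _ _).trans ?_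
  rw [abs_mul, abs_mul]
  calc _ ≤ ε * c + c * ε := by gcongr
    _ = _ := by ring

/-- Tilting moves each risk-set mean by at most 8K²‖D‖₁, and residuals are at most 2K; a product of
two residuals moves by 2 · 2K · 8K²‖D‖₁. -/
theorem SampleBounded.abs_Vhat_sub_le (h : m.SampleBounded x K) (hK : 0 ≤ K) (β D : Fin p → ℝ)
    (hD : 2 * K * l1norm D ≤ 1) (k l : Fin p) :
    |m.Vhat x (β + D) k l - m.Vhat x β k l| ≤ 32 * K ^ 3 * l1norm D := by
  rw [Vhat_apply, Vhat_apply, ← failAvg_sub]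
  have hl := l1norm_nonneg D
  refine m.abs_failAvg_le x (by positivity) fun i => ?_
  have h1 : ∀ k, |wavg (m.riskWeight x (β + D) i) (m.riskCov x i k) -
      wavg (m.riskWeight x β i) (m.riskCov x i k)| ≤ 4 * K * (2 * K * l1norm D) := fun k => by
    rw [riskWeight_add]
    exact abs_wavg_tilt_sub_le (m.riskWeight_nonneg x β i) (m.sum_riskWeight_pos x β i)
      (fun j => h.abs_riskLin_sub_le β D i j) hD (h.abs_riskCov_le i k) hK
  have h2 : ∀ b k, |m.riskCov x i k i - wavg (m.riskWeight x b i) (m.riskCov x i k)| ≤ 2 * K :=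
    fun b k => (abs_sub _ _).trans
      (by linarith [h.abs_riskCov_le i k i, h.abs_wavg_riskCov_le b i k])
  have h3 : ∀ k, |(m.riskCov x i k i - wavg (m.riskWeight x (β + D) i) (m.riskCov x i k)) -
      (m.riskCov x i k i - wavg (m.riskWeight x β i) (m.riskCov x i k))| ≤
        4 * K * (2 * K * l1norm D) := fun k => by
    rw [sub_sub_sub_cancel_left, abs_sub_comm]; exact h1 k
  refine (abs_mul_sub_mul_le (h2 _ l) (h2 _ k) (h3 k) (h3 l)).trans (le_of_eq ?_)
  ring

/-- Up to sign, a Hessian row applied to D averages covariances with DᵀZ, and moving along D tilts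
by that same variable. The change is therefore controlled by the variance of DᵀZ, that is by the
quadratic form, which the Lasso bounds at order dλ², whereas ‖D‖₁² is only of order d²λ². -/
theorem SampleBounded.abs_hessian_row_sub_le (h : m.SampleBounded x K) (hK : 0 ≤ K)
    (β D : Fin p → ℝ) (hD : 2 * K * l1norm D ≤ 1) {u : ℝ} (hu0 : 0 ≤ u) (hu1 : u ≤ 1)
    (j : Fin p) :
    |∑ l, m.hessian x (β + u • D) j l * D l - ∑ l, m.hessian x β j l * D l| ≤
      7 * K * (D ⬝ᵥ (-m.hessian x β) *ᵥ D) := by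
  rw [hessian_row_mul, hessian_row_mul, neg_sub_neg, abs_sub_comm, neg_hessian_quadratic_eq]
  change |m.failAvg x _ - m.failAvg x _| ≤ _
  rw [← failAvg_sub, ← failAvg_const_mul]
  refine (m.abs_failAvg_le_failAvg x _).trans (m.failAvg_mono x fun i => ?_)
  have e : (fun j => m.riskWeight x β i j * Real.exp (∑ k, (u • D) k * m.riskCov x i k j))
      = fun j => m.riskWeight x β i j * Real.exp (u * m.riskLin x D i j) := by
    funext j
    simp only [riskLin, Pi.smul_apply, smul_eq_mul, Finset.mul_sum, mul_assoc]
  rw [riskWeight_add, e]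
  exact abs_wcov_tilt_sub_le (m.riskWeight_nonneg x β i) (m.sum_riskWeight_pos x β i)
    (fun j => (h.abs_riskLin_sub_le β D i j).trans hD) (h.abs_riskCov_le i j) hK hu0 hu1

end CoxModel

end

noncomputable section

/-! ### The CLIME estimator and the deterministic error bound -/

theorem sum_abs_col_le_opNormOne {p : ℕ} (A : Matrix (Fin p) (Fin p) ℝ) (j : Fin p) :
    ∑ i, |A i j| ≤ opNormOne A :=
  le_ciSup (f := fun j => ∑ i, |A i j|) (Set.finite_range _).bddAbove j

theorem opNormOne_nonneg {p : ℕ} (A : Matrix (Fin p) (Fin p) ℝ) : 0 ≤ opNormOne A :=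
  Real.iSup_nonneg fun _ => Finset.sum_nonneg fun _ _ => abs_nonneg _

theorem l1norm_row_le_opNormOne {p : ℕ} {A : Matrix (Fin p) (Fin p) ℝ} (hA : A.IsSymm)
    (j : Fin p) : l1norm (A j) ≤ opNormOne A := by
  refine le_trans (le_of_eq ?_) (sum_abs_col_le_opNormOne A j)
  exact Finset.sum_congr rfl fun i _ => by rw [hA.apply]

theorem l1norm_sub_le {p : ℕ} (u v : Fin p → ℝ) : l1norm (u - v) ≤ l1norm u + l1norm v := by
  unfold l1norm
  rw [← Finset.sum_add_distrib]
  exact Finset.sum_le_sum fun k _ => abs_sub _ _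

theorem abs_mulVec_le {p : ℕ} {A : Matrix (Fin p) (Fin p) ℝ} {ε : ℝ} (h : ∀ k l, |A k l| ≤ ε)
    (v : Fin p → ℝ) (k : Fin p) : |(A *ᵥ v) k| ≤ ε * l1norm v := by
  have := abs_sum_mul_le_l1norm v (A k) (h k)
  simpa only [Matrix.mulVec, dotProduct, mul_comm] using this

theorem abs_dotProduct_le {p : ℕ} (v z : Fin p → ℝ) {c : ℝ} (hz : ∀ k, |z k| ≤ c) :
    |v ⬝ᵥ z| ≤ c * l1norm v := abs_sum_mul_le_l1norm v z hz

/-- As b has no larger ℓ₁ norm than θ, its mass off the support of θ is at most its deviation on the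
support, and the support has few coordinates. -/
theorem l1norm_le_of_sparse_minimum {p : ℕ} {θ b : Fin p → ℝ} (hb : l1norm b ≤ l1norm θ) {M : ℝ}
    (hM : ∀ k, |b k - θ k| ≤ M) :
    l1norm (b - θ) ≤ 2 * ((Finset.univ.filter fun k => θ k ≠ 0).card * M) := by
  set T := Finset.univ.filter fun k => θ k ≠ 0 with hT
  have e0 : ∀ k ∈ Tᶜ, θ k = 0 := fun k hk => by simpa [hT] using hk
  have e1 : ∑ k ∈ Tᶜ, |b k - θ k| = ∑ k ∈ Tᶜ, |b k| :=
    Finset.sum_congr rfl fun k hk => by rw [e0 k hk, sub_zero]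
  have e2 : ∑ k ∈ Tᶜ, |θ k| = 0 := Finset.sum_eq_zero fun k hk => by rw [e0 k hk, abs_zero]
  have e3 : ∑ k ∈ T, |θ k| ≤ ∑ k ∈ T, |b k| + ∑ k ∈ T, |b k - θ k| := by
    rw [← Finset.sum_add_distrib]
    refine Finset.sum_le_sum fun k _ => ?_
    have := abs_sub (b k) (b k - θ k)
    rwa [sub_sub_cancel] at this
  have e4 : ∑ k ∈ T, |b k - θ k| ≤ T.card * M := by
    rw [← nsmul_eq_mul]
    exact Finset.sum_le_card_nsmul _ _ _ fun k _ => hM k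
  have s1 : l1norm (b - θ) = ∑ k ∈ T, |b k - θ k| + ∑ k ∈ Tᶜ, |b k - θ k| :=
    (Finset.sum_add_sum_compl _ _).symm
  have s2 : l1norm b = ∑ k ∈ T, |b k| + ∑ k ∈ Tᶜ, |b k| := (Finset.sum_add_sum_compl _ _).symm
  have s3 : l1norm θ = ∑ k ∈ T, |θ k| + ∑ k ∈ Tᶜ, |θ k| := (Finset.sum_add_sum_compl _ _).symm
  linarith

/-- The row of S⁻¹ is itself feasible, so the minimiser has no larger ℓ₁ norm. Feasibility of both
rows makes S times their difference small in sup norm; applying S⁻¹ bounds the difference in sup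
norm, and sparsity turns this into an ℓ₁ bound. No invertibility of V is needed. -/
theorem clime_row_bound {p : ℕ} {S V Th : Matrix (Fin p) (Fin p) ℝ} (hS : S.IsSymm)
    (hdet : IsUnit S.det) {ε lam : ℝ} (hV : ∀ k l, |V k l - S k l| ≤ ε)
    (hlam : ε * opNormOne S⁻¹ ≤ lam) (hε : 0 ≤ ε) (hTh : IsClime V lam Th) (j : Fin p) :
    l1norm (Th j - S⁻¹ j) ≤ 8 * (maxColSupport S⁻¹ * opNormOne S⁻¹ * lam) := by
  have hsymm : (S⁻¹).IsSymm := by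
    rw [Matrix.IsSymm, Matrix.transpose_nonsing_inv, hS.eq]
  have hN := opNormOne_nonneg S⁻¹
  have hlam0 : 0 ≤ lam := (mul_nonneg hε hN).trans hlam
  have hrow := l1norm_row_le_opNormOne hsymm
  have hSθ : S *ᵥ (S⁻¹ j) = Pi.single j 1 := by
    have h1 : S⁻¹ j = S⁻¹ *ᵥ Pi.single j 1 := by
      funext k; rw [Matrix.mulVec_single_one]; exact (hsymm.apply j k).symm
    rw [h1, Matrix.mulVec_mulVec, Matrix.mul_nonsing_inv _ hdet, Matrix.one_mulVec]
  have hVS : ∀ v k, |((V - S) *ᵥ v) k| ≤ ε * l1norm v := fun v k => abs_mulVec_le hV v k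
  have hfeas : S⁻¹ j ∈ climeFeasible V lam j := by
    rw [climeFeasible, Set.mem_ofPred_eq, pi_norm_le_iff_of_nonneg hlam0]
    intro k
    rw [← hSθ, ← Matrix.sub_mulVec, Real.norm_eq_abs]
    exact (hVS _ k).trans ((mul_le_mul_of_nonneg_left (hrow j) hε).trans hlam)
  obtain ⟨hmem, hmin⟩ := hTh j ⟨_, hfeas⟩
  have hle := hmin _ hfeas
  have f1 : ∀ b ∈ climeFeasible V lam j, ∀ k, |(V *ᵥ b - (Pi.single j 1 : Fin p → ℝ)) k| ≤ lam :=
    fun b hb k => (norm_le_pi_norm (V *ᵥ b - (Pi.single j 1 : Fin p → ℝ)) k).trans hb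
  -- One λ from each feasibility constraint, and ε · 2 · ‖S⁻¹‖ ≤ 2λ from replacing V by S.
  have hSh : ∀ k, |(S *ᵥ (Th j - S⁻¹ j)) k| ≤ 4 * lam := by
    intro k
    have e : (S *ᵥ (Th j - S⁻¹ j)) k = (V *ᵥ Th j - (Pi.single j 1 : Fin p → ℝ)) k -
        (V *ᵥ S⁻¹ j - (Pi.single j 1 : Fin p → ℝ)) k - ((V - S) *ᵥ (Th j - S⁻¹ j)) k := by
      simp only [Matrix.mulVec_sub, Matrix.sub_mulVec, Pi.sub_apply]
      ring
    have h3 := hVS (Th j - S⁻¹ j) k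
    have h4 : ε * l1norm (Th j - S⁻¹ j) ≤ 2 * lam := by
      have : l1norm (Th j - S⁻¹ j) ≤ 2 * opNormOne S⁻¹ :=
        (l1norm_sub_le _ _).trans (by linarith [hrow j])
      nlinarith
    have h1 := f1 _ hmem k
    have h2 := f1 _ hfeas k
    rw [e]
    rw [abs_le] at *
    constructor <;> linarith [h1.1, h1.2, h2.1, h2.2, h3.1, h3.2]
  have hh : ∀ k, |Th j k - S⁻¹ j k| ≤ 4 * lam * opNormOne S⁻¹ := by
    intro k
    have e : Th j - S⁻¹ j = S⁻¹ *ᵥ (S *ᵥ (Th j - S⁻¹ j)) := by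
      rw [Matrix.mulVec_mulVec, Matrix.nonsing_inv_mul _ hdet, Matrix.one_mulVec]
    have := abs_dotProduct_le (S⁻¹ k) (S *ᵥ (Th j - S⁻¹ j)) hSh
    rw [show Th j k - S⁻¹ j k = (Th j - S⁻¹ j) k from rfl, e]
    exact this.trans (mul_le_mul_of_nonneg_left (hrow k) (by positivity))
  refine (l1norm_le_of_sparse_minimum hle hh).trans ?_
  have hcard : (Finset.univ.filter fun k => S⁻¹ j k ≠ 0).card ≤ maxColSupport S⁻¹ := by
    have h1 := Finset.le_sup (f := fun j => (Finset.univ.filter fun i => S⁻¹ i j ≠ 0).card)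
      (Finset.mem_univ j)
    refine le_trans (le_of_eq ?_) h1
    congr 1
    ext k
    simp only [Finset.mem_filter, hsymm.apply j k]
  have hcard' : ((Finset.univ.filter fun k => S⁻¹ j k ≠ 0).card : ℝ) ≤ maxColSupport S⁻¹ := by
    exact_mod_cast hcard
  calc _ ≤ 2 * ((maxColSupport S⁻¹ : ℝ) * (4 * lam * opNormOne S⁻¹)) := by gcongr
    _ = _ := by ring

namespace CoxModel

variable {p n : ℕ} {E : Type*} {m : CoxModel p E} {x : Fin n → E} {K : ℝ}

theorem rowHessian_mulVec_apply {b : Fin p → ℝ} {bt : Fin p → Fin p → ℝ}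
    (hbt : m.IsTaylorPoints x b bt) (j : Fin p) :
    (m.rowHessian x bt *ᵥ (b - m.coef)) j = m.score x b j - m.score x m.coef j := by
  rw [(hbt j).2, add_sub_cancel_left]
  rfl

theorem debias_error_bound (h : m.SampleBounded x K) (hK : 0 ≤ K) {lam lamN ε : ℝ}
    (hlam : 0 ≤ lam) {b : Fin p → ℝ} (hb : m.IsLasso x lam b)
    (hz : ∀ j, |m.score x m.coef j| ≤ lam / 3)
    {S Th : Matrix (Fin p) (Fin p) ℝ} (hS : S.IsSymm) (hdet : IsUnit S.det)
    (hTh : IsClime (m.Vhat x b) lamN Th) {bt : Fin p → Fin p → ℝ}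
    (hbt : m.IsTaylorPoints x b bt) (hD : 2 * K * l1norm (b - m.coef) ≤ 1) (hε : 0 ≤ ε)
    (hV : ∀ k l, |m.Vhat x m.coef k l - S k l| ≤ ε)
    (hH : ∀ k l, |m.hessian x m.coef k l + S k l| ≤ ε)
    (hlamN : (ε + 32 * K ^ 3 * l1norm (b - m.coef)) * opNormOne S⁻¹ ≤ lamN)
    {c : Fin p → ℝ} (hc : l1norm c = 1) :
    |c ⬝ᵥ ((Th * m.rowHessian x bt + 1) *ᵥ (b - m.coef))| ≤
      16 * (maxColSupport S⁻¹ * opNormOne S⁻¹ * lamN * lam) +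
        opNormOne S⁻¹ * (ε * l1norm (b - m.coef) +
          7 * K * ((b - m.coef) ⬝ᵥ (-m.hessian x m.coef) *ᵥ (b - m.coef))) := by
  set D := b - m.coef with hDdef
  have hbD : m.coef + D = b := by rw [hDdef]; abel
  have hl := l1norm_nonneg D
  set y := m.rowHessian x bt *ᵥ D with hy
  set Q := D ⬝ᵥ (-m.hessian x m.coef) *ᵥ D with hQ
  have hsymm : (S⁻¹).IsSymm := by
    rw [Matrix.IsSymm, Matrix.transpose_nonsing_inv, hS.eq]
  have hy1 : ∀ k, |y k| ≤ 2 * lam := fun k => by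
    rw [hy, hDdef, rowHessian_mulVec_apply hbt]
    refine (abs_sub _ _).trans ?_
    have h1 := hb.abs_score_le hlam k
    linarith [hz k]
  have hy2 : ∀ k, |(y + S *ᵥ D) k| ≤ ε * l1norm D + 7 * K * Q := fun k => by
    have e : (y + S *ᵥ D) k = (y k - ∑ l, m.hessian x m.coef k l * D l) +
        ((m.hessian x m.coef + S) *ᵥ D) k := by
      simp only [Matrix.add_mulVec, Pi.add_apply]
      simp only [Matrix.mulVec, dotProduct]
      ring
    rw [e]
    refine (abs_add_le _ _).trans ?_
    have h1 := abs_mulVec_le (A := m.hessian x m.coef + S) hH D k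
    have h2 : |y k - ∑ l, m.hessian x m.coef k l * D l| ≤ 7 * K * Q := by
      -- Each row has its own u, which is harmless since the Hessian comparison is made one row at a
      -- time and is uniform in u.
      obtain ⟨u, v, hu, hv, huv, hk⟩ := (hbt k).1
      have e2 : bt k = m.coef + u • D := by
        rw [← hk, hDdef, show v = 1 - u by linarith]
        module
      have e3 : y k = ∑ l, m.hessian x (m.coef + u • D) k l * D l := by
        rw [← e2]; rfl
      rw [e3]
      exact h.abs_hessian_row_sub_le hK m.coef D hD hu (by linarith) k
    linarith
  have hV' : ∀ k l, |m.Vhat x b k l - S k l| ≤ ε + 32 * K ^ 3 * l1norm D := fun k l => by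
    have h1 := h.abs_Vhat_sub_le hK m.coef D hD k l
    rw [hbD] at h1
    have e : m.Vhat x b k l - S k l = (m.Vhat x m.coef k l - S k l) +
        (m.Vhat x b k l - m.Vhat x m.coef k l) := by ring
    rw [e]
    exact (abs_add_le _ _).trans (add_le_add (hV k l) h1)
  have hclime := clime_row_bound hS hdet hV' hlamN (by positivity) hTh
  have hcomp : ∀ j, |((Th * m.rowHessian x bt + 1) *ᵥ D) j| ≤
      16 * (maxColSupport S⁻¹ * opNormOne S⁻¹ * lamN * lam) +
        opNormOne S⁻¹ * (ε * l1norm D + 7 * K * Q) := fun j => by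
    -- The central decomposition: adding and subtracting S⁻¹ y pairs the CLIME error with a small
    -- score difference, and S⁻¹ with the error in y ≈ -S D.
    have e : ((Th * m.rowHessian x bt + 1) *ᵥ D) j =
        (Th j - S⁻¹ j) ⬝ᵥ y + (S⁻¹ j) ⬝ᵥ (y + S *ᵥ D) := by
      have e1 : D j = (S⁻¹ j) ⬝ᵥ (S *ᵥ D) := by
        have : D = S⁻¹ *ᵥ (S *ᵥ D) := by
          rw [Matrix.mulVec_mulVec, Matrix.nonsing_inv_mul _ hdet, Matrix.one_mulVec]
        exact congrFun this j
      rw [Matrix.add_mulVec, Matrix.one_mulVec, ← Matrix.mulVec_mulVec, Pi.add_apply, ← hy,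
        sub_dotProduct, dotProduct_add, ← e1]
      simp only [Matrix.mulVec]
      ring
    rw [e]
    refine (abs_add_le _ _).trans (add_le_add ?_ ?_)
    · refine (abs_dotProduct_le _ _ hy1).trans ?_
      calc 2 * lam * l1norm (Th j - S⁻¹ j) ≤
          2 * lam * (8 * (maxColSupport S⁻¹ * opNormOne S⁻¹ * lamN)) := by
            gcongr; exact hclime j
        _ = _ := by ring
    · refine (abs_dotProduct_le _ _ hy2).trans ?_
      rw [mul_comm]
      have : 0 ≤ ε * l1norm D + 7 * K * Q := (abs_nonneg _).trans (hy2 j)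
      gcongr
      exact l1norm_row_le_opNormOne hsymm j
  have := abs_dotProduct_le c _ hcomp
  rwa [hc, mul_one] at this

end CoxModel

end

noncomputable section

/-! ### Exponential moments -/

/-- A linear majorant of the centred exponential on `[-b, b]`. -/
theorem exists_exp_le_one_add_mul {b : ℝ} (hb : 0 < b) (θ : ℝ) :
    ∃ κ : ℝ, ∀ y : ℝ, |y| ≤ b → Real.exp (θ * y - θ ^ 2 * b ^ 2 / 2) ≤ 1 + κ * y := by
  -- On [-b, b] the convex function exp(θy) lies below its chord, which is cosh(θb) + (y/b)
  -- sinh(θb), and cosh(θb) ≤ exp(θ²b²/2). The witness is the normalised slope of that chord.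
  refine ⟨Real.exp (-(θ ^ 2 * b ^ 2 / 2)) * Real.sinh (θ * b) / b, fun y hy => ?_⟩
  obtain ⟨h1, h2⟩ := abs_le.1 hy
  have p1 : 0 ≤ (b + y) / (2 * b) := div_nonneg (by linarith) (by linarith)
  have p2 : 0 ≤ (b - y) / (2 * b) := div_nonneg (by linarith) (by linarith)
  have p3 : (b + y) / (2 * b) + (b - y) / (2 * b) = 1 := by field_simp; ring
  have hc := convexOn_exp.2 (Set.mem_univ (θ * b)) (Set.mem_univ (-(θ * b))) p1 p2 p3
  simp only [smul_eq_mul] at hc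
  have e1 : (b + y) / (2 * b) * (θ * b) + (b - y) / (2 * b) * -(θ * b) = θ * y := by
    field_simp; ring
  have e2 : (b + y) / (2 * b) * Real.exp (θ * b) + (b - y) / (2 * b) * Real.exp (-(θ * b))
      = Real.cosh (θ * b) + y / b * Real.sinh (θ * b) := by
    rw [Real.cosh_eq, Real.sinh_eq]; field_simp; ring
  rw [e1, e2] at hc
  have hcosh := Real.cosh_le_exp_half_sq (θ * b)
  rw [sub_eq_add_neg, Real.exp_add, mul_comm]
  have hE := Real.exp_pos (-(θ ^ 2 * b ^ 2 / 2))
  calc Real.exp (-(θ ^ 2 * b ^ 2 / 2)) * Real.exp (θ * y)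
      ≤ Real.exp (-(θ ^ 2 * b ^ 2 / 2)) *
        (Real.exp ((θ * b) ^ 2 / 2) + y / b * Real.sinh (θ * b)) := by
        gcongr; linarith
    _ = 1 + Real.exp (-(θ ^ 2 * b ^ 2 / 2)) * Real.sinh (θ * b) / b * y := by
        rw [mul_add, ← Real.exp_add, mul_pow, neg_add_cancel, Real.exp_zero]; ring

/-- The indicator of a proposition, in `[0, ∞]`. -/
def ind (q : Prop) : ℝ≥0∞ := open Classical in if q then 1 else 0

theorem ind_true {q : Prop} (h : q) : ind q = 1 := by simp [ind, h]

theorem ind_false {q : Prop} (h : ¬q) : ind q = 0 := by simp [ind, h]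

theorem ind_le_one (q : Prop) : ind q ≤ 1 := by unfold ind; split_ifs <;> simp

theorem ind_mono {q r : Prop} (h : q → r) : ind q ≤ ind r := by
  by_cases hq : q
  · rw [ind_true hq, ind_true (h hq)]
  · rw [ind_false hq]; exact zero_le

theorem ind_and (q r : Prop) : ind (q ∧ r) = ind q * ind r := by
  by_cases hq : q <;> by_cases hr : r <;> simp [ind, hq, hr]

theorem measurable_ind {α : Type*} [MeasurableSpace α] {q : α → Prop}
    (h : MeasurableSet {a | q a}) : Measurable fun a => ind (q a) := by
  classical
  exact Measurable.ite h measurable_const measurable_const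

theorem measurable_ind_not {α : Type*} [MeasurableSpace α] {q : α → Prop}
    (h : MeasurableSet {a | q a}) : Measurable fun a => ind (¬q a) :=
  measurable_ind h.compl

theorem lintegral_pi_insertNth {X : Type*} [MeasurableSpace X] (ρ : Measure X)
    [IsProbabilityMeasure ρ] {n : ℕ} (i : Fin (n + 1)) {H : (Fin (n + 1) → X) → ℝ≥0∞}
    (hH : Measurable H) :
    ∫⁻ x, H x ∂(Measure.pi fun _ => ρ) =
      ∫⁻ a, ∫⁻ y, H (i.insertNth a y) ∂(Measure.pi fun _ => ρ) ∂ρ := by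
  have h := (measurePreserving_piFinSuccAbove (fun _ : Fin (n + 1) => ρ) i).symm
  rw [← h.lintegral_comp hH, lintegral_prod]
  · rfl
  · exact (hH.comp (MeasurableEquiv.measurable _)).aemeasurable

theorem measurable_insertNth {X Y : Type*} [MeasurableSpace X] [MeasurableSpace Y] {n : ℕ}
    (i : Fin (n + 1)) {f : Y → X} {g : Y → Fin n → X} (hf : Measurable f) (hg : Measurable g) :
    Measurable fun a => (i.insertNth (f a) (g a) : Fin (n + 1) → X) :=
  (MeasurableEquiv.piFinSuccAbove (fun _ : Fin (n + 1) => X) i).symm.measurable.comp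
    (hf.prodMk hg)

theorem comp_insertNth {X Y : Type*} {n : ℕ} (π : X → Y) (i : Fin (n + 1)) (a : X)
    (y : Fin n → X) :
    (fun j => π ((i.insertNth a y : Fin (n + 1) → X) j)) =
      (i.insertNth (π a) (fun j => π (y j)) : Fin (n + 1) → Y) := by
  funext j
  refine Fin.succAboveCases i ?_ (fun k => ?_) j <;> simp

theorem forall_insertNth {X : Type*} {n : ℕ} (q : X → Prop) (i : Fin (n + 1)) (a : X)
    (y : Fin n → X) :
    (∀ j, q ((i.insertNth a y : Fin (n + 1) → X) j)) ↔ q a ∧ ∀ j, q (y j) := by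
  rw [Fin.forall_iff_succAbove i]; simp

/-- A continuously distributed variable has no ties in an independent sample. -/
theorem ae_pi_no_ties {X : Type*} [MeasurableSpace X] (ρ : Measure X)
    [IsProbabilityMeasure ρ] {T : X → ℝ} (hT : Measurable T) (hna : ∀ t, ρ {a | T a = t} = 0)
    (n : ℕ) : ∀ᵐ x ∂(Measure.pi fun _ : Fin n => ρ), ∀ i j, i ≠ j → T (x i) ≠ T (x j) := by
  rw [ae_all_iff]; intro i
  rw [ae_all_iff]; intro j
  by_cases hij : i = j
  · filter_upwards with x h; exact absurd hij h
  obtain _ | n := n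
  · exact i.elim0
  have hms : MeasurableSet {x : Fin (n + 1) → X | T (x i) = T (x j)} :=
    measurableSet_eq_fun (by fun_prop) (by fun_prop)
  suffices h : (Measure.pi fun _ : Fin (n + 1) => ρ) {x | T (x i) = T (x j)} = 0 by
    filter_upwards [compl_mem_ae_iff.2 h] with x hx _ h'
    exact hx h'
  have hm := measurable_ind hms
  have e : ∫⁻ x : Fin (n + 1) → X, ind (T (x i) = T (x j)) ∂(Measure.pi fun _ => ρ)
      = (Measure.pi fun _ : Fin (n + 1) => ρ) {x | T (x i) = T (x j)} := by
    rw [← lintegral_indicator_one hms]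
    refine lintegral_congr fun x => ?_
    by_cases h : T (x i) = T (x j)
    · rw [ind_true h, Set.indicator_of_mem (by exact h)]; rfl
    · rw [ind_false h, Set.indicator_of_notMem (by exact h)]
  rw [← e, lintegral_pi_insertNth ρ i hm]
  obtain ⟨k, rfl⟩ := Fin.exists_succAbove_eq (Ne.symm hij)
  simp only [Fin.insertNth_apply_same, Fin.insertNth_apply_succAbove]
  rw [lintegral_lintegral_swap]
  · refine (lintegral_congr fun y => ?_).trans lintegral_zero
    rw [lintegral_eq_zero_iff]
    · filter_upwards [compl_mem_ae_iff.2 (hna (T (y k)))] with a ha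
      exact ind_false ha
    · exact measurable_ind (measurableSet_eq_fun hT measurable_const)
  · refine (measurable_ind ?_).aemeasurable
    exact measurableSet_eq_fun (by fun_prop) (by fun_prop)

end

noncomputable section

/-! ### The exponential supermartingale of the score -/

/-- A time `T`, marked by the event `D`, whose marked part has intensity `1{s ≤ T} w s (π ·)` with
respect to `ν` when the information of `π` is available from the start. -/
structure HasIntensity {X F : Type*} [MeasurableSpace X] [MeasurableSpace F] (ρ : Measure X)
    (T : X → ℝ) (D : Set X) (π : X → F) (w : ℝ → F → ℝ) (ν : Measure ℝ) : Prop where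
  measurable_time : Measurable T
  measurableSet_mark : MeasurableSet D
  measurable_proj : Measurable π
  measurable_weight : Measurable fun q : ℝ × F => w q.1 q.2
  weight_pos : ∀ s u, 0 < w s u
  measure_time_eq : ∀ t, ρ {a | T a = t} = 0
  compensator : ∀ f : ℝ → F → ℝ≥0∞, (Measurable fun q : ℝ × F => f q.1 q.2) →
    ∫⁻ a, ind (a ∈ D) * f (T a) (π a) ∂ρ =
      ∫⁻ s, ∫⁻ a, ind (s ≤ T a) * (ENNReal.ofReal (w s (π a)) * f s (π a)) ∂ρ ∂ν

/-- The average of `z` over the individuals at risk at time `s`. -/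
def riskAvg {X F : Type*} (T : X → ℝ) (π : X → F) (w z : ℝ → F → ℝ) {n : ℕ} (s : ℝ)
    (x : Fin n → X) : ℝ :=
  wavg (fun j => (ind (s ≤ T (x j))).toReal * w s (π (x j))) fun j => z s (π (x j))

/-- The exponential factor of the `i`-th individual when everyone is at risk. -/
def tilt {F : Type*} (w z : ℝ → F → ℝ) (θ b : ℝ) {n : ℕ} (i : Fin n) (s : ℝ) (u : Fin n → F) :
    ℝ≥0∞ :=
  ENNReal.ofReal (Real.exp (θ * (z s (u i) - wavg (fun j => w s (u j)) fun j => z s (u j)) -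
    θ ^ 2 * b ^ 2 / 2))

/-- The product of the exponential factors of the marked individuals. -/
def scoreExp {X F : Type*} (T : X → ℝ) (D : Set X) (π : X → F) (w z : ℝ → F → ℝ) (θ b : ℝ)
    {n : ℕ} (x : Fin n → X) : ℝ≥0∞ :=
  ∏ i, (ind (x i ∈ D) * ENNReal.ofReal (Real.exp (θ * (z (T (x i)) (π (x i)) -
    riskAvg T π w z (T (x i)) x) - θ ^ 2 * b ^ 2 / 2)) + ind (x i ∉ D))

/-- The exponential factor is dominated by 1 + κ(z - z̄) with one κ for all individuals, as |z - z̄|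
≤ 2K. The linear terms cancel in the weighted sum since z̄ is the mean for the same weights. This is
the supermartingale property at a single instant. -/
theorem sum_mul_tilt_le {F : Type*} {w z : ℝ → F → ℝ} {K : ℝ} (hK : 0 < K)
    (hw : ∀ s u, 0 < w s u) (hz : ∀ s u, |z s u| ≤ K)
    (θ : ℝ) {n : ℕ} (s : ℝ) (u : Fin (n + 1) → F) :
    ∑ i, ENNReal.ofReal (w s (u i)) * tilt w z θ (2 * K) i s u ≤
      ∑ i, ENNReal.ofReal (w s (u i)) := by
  obtain ⟨κ, hκ⟩ := exists_exp_le_one_add_mul (b := 2 * K) (by positivity) θ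
  have hs : 0 < ∑ j, w s (u j) := Finset.sum_pos (fun j _ => hw s (u j)) Finset.univ_nonempty
  have hzb := abs_wavg_le (fun j => (hw s (u j)).le) hs fun j => hz s (u j)
  simp only [tilt]
  simp_rw [← ENNReal.ofReal_mul (hw s (u _)).le]
  rw [← ENNReal.ofReal_sum_of_nonneg fun i _ => mul_nonneg (hw _ _).le (Real.exp_pos _).le,
    ← ENNReal.ofReal_sum_of_nonneg fun i _ => (hw _ _).le]
  refine ENNReal.ofReal_le_ofReal ?_
  set zb := wavg (fun j => w s (u j)) fun j => z s (u j) with hzbdef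
  have h0 : ∑ i, w s (u i) * (z s (u i) - zb) = 0 := by
    simp only [mul_sub, Finset.sum_sub_distrib, ← Finset.sum_mul]
    rw [hzbdef, wavg, mul_div_cancel₀ _ hs.ne', sub_self]
  calc _ ≤ ∑ i, w s (u i) * (1 + κ * (z s (u i) - zb)) := by
        refine Finset.sum_le_sum fun i _ => mul_le_mul_of_nonneg_left (hκ _ ?_) (hw _ _).le
        exact (abs_sub _ _).trans (by linarith [hz s (u i)])
    _ = ∑ i, w s (u i) + κ * ∑ i, w s (u i) * (z s (u i) - zb) := by
        rw [Finset.mul_sum, ← Finset.sum_add_distrib]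
        exact Finset.sum_congr rfl fun i _ => by ring
    _ = _ := by rw [h0, mul_zero, add_zero]

/-- At the time of the first individual everyone is at risk, so its factor involves covariates only;
at later times it has left every risk set, so the other factors do not see it. -/
theorem scoreExp_insertNth {X F : Type*} {T : X → ℝ} {D : Set X} {π : X → F}
    {w z : ℝ → F → ℝ} (θ b : ℝ) {n : ℕ} (i : Fin (n + 1)) (a : X) (y : Fin n → X)
    (hay : ∀ j, T a < T (y j)) :
    scoreExp T D π w z θ b (i.insertNth a y : Fin (n + 1) → X) =
      (ind (a ∈ D) * tilt w z θ b i (T a) (i.insertNth (π a) fun j => π (y j)) + ind (a ∉ D)) *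
        scoreExp T D π w z θ b y := by
  unfold scoreExp
  rw [Fin.prod_univ_succAbove _ i]
  simp only [Fin.insertNth_apply_same, Fin.insertNth_apply_succAbove]
  congr 1
  · congr 2
    unfold tilt riskAvg
    rw [← comp_insertNth]
    congr 6
    · simp
    · funext j
      have : ∀ j, T a ≤ T ((i.insertNth a y : Fin (n + 1) → X) j) :=
        (forall_insertNth (fun b => T a ≤ T b) i a y).2 ⟨le_rfl, fun j => (hay j).le⟩
      rw [ind_true (this j)]
      simp
  · refine Finset.prod_congr rfl fun j _ => ?_
    congr 6
    unfold riskAvg wavg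
    rw [Fin.sum_univ_succAbove _ i, Fin.sum_univ_succAbove _ i]
    simp only [Fin.insertNth_apply_same, Fin.insertNth_apply_succAbove]
    rw [ind_false (not_le.2 (hay j))]
    simp

section

variable {X F : Type*} [MeasurableSpace X] [MeasurableSpace F] {ρ : Measure X}
    {T : X → ℝ} {D : Set X} {π : X → F} {w z : ℝ → F → ℝ} {ν : Measure ℝ}

theorem measurable_tilt (hw : Measurable fun q : ℝ × F => w q.1 q.2)
    (hz : Measurable fun q : ℝ × F => z q.1 q.2) (θ b : ℝ) {n : ℕ} (i : Fin n) :
    Measurable fun q : ℝ × (Fin n → F) => tilt w z θ b i q.1 q.2 := by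
  have hw' : ∀ j, Measurable fun q : ℝ × (Fin n → F) => w q.1 (q.2 j) := fun j =>
    hw.comp (measurable_fst.prodMk ((measurable_pi_apply j).comp measurable_snd))
  have hz' : ∀ j, Measurable fun q : ℝ × (Fin n → F) => z q.1 (q.2 j) := fun j =>
    hz.comp (measurable_fst.prodMk ((measurable_pi_apply j).comp measurable_snd))
  unfold tilt wavg
  fun_prop

theorem HasIntensity.measurable_riskAvg (h : HasIntensity ρ T D π w ν)
    (hz : Measurable fun q : ℝ × F => z q.1 q.2) {n : ℕ} {Y : Type*} [MeasurableSpace Y]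
    {s : Y → ℝ} {x : Y → Fin n → X} (hs : Measurable s) (hx : Measurable x) :
    Measurable fun y => riskAvg T π w z (s y) (x y) := by
  have hT := h.measurable_time
  have hxj : ∀ j, Measurable fun y => x y j := fun j => (measurable_pi_apply j).comp hx
  have hπ : ∀ j, Measurable fun y => (s y, π (x y j)) := fun j =>
    hs.prodMk (h.measurable_proj.comp (hxj j))
  have hw' : ∀ j, Measurable fun y => w (s y) (π (x y j)) := fun j =>
    h.measurable_weight.comp (hπ j)
  have hz' : ∀ j, Measurable fun y => z (s y) (π (x y j)) := fun j => hz.comp (hπ j)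
  have hi : ∀ j, Measurable fun y => (ind (s y ≤ T (x y j))).toReal := fun j =>
    (measurable_ind (measurableSet_le hs (hT.comp (hxj j)))).ennreal_toReal
  exact (Finset.measurable_fun_sum _ fun j _ => ((hi j).fun_mul (hw' j)).fun_mul (hz' j)).fun_div
    (Finset.measurable_fun_sum _ fun j _ => (hi j).fun_mul (hw' j))

theorem HasIntensity.measurable_scoreExp (h : HasIntensity ρ T D π w ν)
    (hz : Measurable fun q : ℝ × F => z q.1 q.2) (θ b : ℝ) {n : ℕ} :
    Measurable fun x : Fin n → X => scoreExp T D π w z θ b x := by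
  have hT := h.measurable_time
  have hTi : ∀ i, Measurable fun x : Fin n → X => T (x i) := fun i => by fun_prop
  have h1 : ∀ i, Measurable fun x : Fin n → X => riskAvg T π w z (T (x i)) x := fun i =>
    h.measurable_riskAvg hz (hTi i) measurable_id
  have h2 : ∀ i, Measurable fun x : Fin n → X => z (T (x i)) (π (x i)) := fun i =>
    hz.comp ((hTi i).prodMk (h.measurable_proj.comp (measurable_pi_apply i)))
  have h3 : ∀ i, Measurable fun x : Fin n → X => ind (x i ∈ D) := fun i =>
    measurable_ind (measurable_pi_apply i h.measurableSet_mark)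
  have h4 : ∀ i, Measurable fun x : Fin n → X => ind (x i ∉ D) := fun i =>
    measurable_ind_not (measurable_pi_apply i h.measurableSet_mark)
  refine Finset.measurable_prod _ fun i _ => ((h3 i).fun_mul ?_).fun_add (h4 i)
  have h5 : Measurable fun x : Fin n → X =>
      z (T (x i)) (π (x i)) - riskAvg T π w z (T (x i)) x := (h2 i).fun_sub (h1 i)
  exact (Real.measurable_exp.comp ((h5.const_mul θ).sub_const _)).ennreal_ofReal

/-- The compensator identity in the coordinate of the individual observed first. -/
theorem HasIntensity.lintegral_first [SFinite ν] [IsProbabilityMeasure ρ]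
    (h : HasIntensity ρ T D π w ν) {n : ℕ}
    (i : Fin (n + 1)) (t : ℝ) {ψ : ℝ → (Fin (n + 1) → F) → ℝ≥0∞}
    (hψ : Measurable fun q : ℝ × (Fin (n + 1) → F) => ψ q.1 q.2) :
    ∫⁻ x : Fin (n + 1) → X, ind (x i ∈ D) * (ind (t < T (x i)) * ind (∀ j, T (x i) ≤ T (x j)) *
        ψ (T (x i)) fun j => π (x j)) ∂(Measure.pi fun _ => ρ) =
      ∫⁻ s, ∫⁻ x : Fin (n + 1) → X, ind (t < s) * ind (∀ j, s ≤ T (x j)) *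
        (ENNReal.ofReal (w s (π (x i))) * ψ s fun j => π (x j)) ∂(Measure.pi fun _ => ρ) ∂ν := by
  have hT := h.measurable_time
  have hπ := h.measurable_proj
  have hw := h.measurable_weight
  have hD := h.measurableSet_mark
  have hπn : Measurable fun x : Fin (n + 1) → X => fun j => π (x j) := by fun_prop
  have m1 : Measurable fun x : Fin (n + 1) → X => ind (x i ∈ D) * (ind (t < T (x i)) *
      ind (∀ j, T (x i) ≤ T (x j)) * ψ (T (x i)) fun j => π (x j)) := by
    refine (measurable_ind (measurable_pi_apply i hD)).fun_mul (((measurable_ind ?_).fun_mul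
      (measurable_ind ?_)).fun_mul ?_)
    · exact measurableSet_lt measurable_const (by fun_prop)
    · rw [Set.ofPred_forall]
      exact MeasurableSet.iInter fun j => measurableSet_le (by fun_prop) (by fun_prop)
    · exact hψ.comp ((by fun_prop : Measurable fun x : Fin (n + 1) → X => T (x i)).prodMk hπn)
  have m2 : Measurable fun q : ℝ × (Fin (n + 1) → X) => ind (t < q.1) *
      ind (∀ j, q.1 ≤ T (q.2 j)) *
        (ENNReal.ofReal (w q.1 (π (q.2 i))) * ψ q.1 fun j => π (q.2 j)) := by
    refine ((measurable_ind ?_).fun_mul (measurable_ind ?_)).fun_mul (Measurable.fun_mul ?_ ?_)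
    · exact measurableSet_lt measurable_const (by fun_prop)
    · rw [Set.ofPred_forall]
      exact MeasurableSet.iInter fun j => measurableSet_le (by fun_prop) (by fun_prop)
    · exact (hw.comp (measurable_fst.prodMk (by fun_prop))).ennreal_ofReal
    · exact hψ.comp (measurable_fst.prodMk (hπn.comp measurable_snd))
  have mins : Measurable fun q : X × (Fin n → X) =>
      (i.insertNth q.1 q.2 : Fin (n + 1) → X) :=
    measurable_insertNth i measurable_fst measurable_snd
  rw [lintegral_pi_insertNth ρ i m1, lintegral_lintegral_swap (by exact (m1.comp mins).aemeasurable)]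
  have key : ∀ y : Fin n → X,
      ∫⁻ a, ind ((i.insertNth a y : Fin (n + 1) → X) i ∈ D) *
        (ind (t < T ((i.insertNth a y : Fin (n + 1) → X) i)) *
        ind (∀ j, T ((i.insertNth a y : Fin (n + 1) → X) i) ≤
          T ((i.insertNth a y : Fin (n + 1) → X) j)) *
        ψ (T ((i.insertNth a y : Fin (n + 1) → X) i))
          fun j => π ((i.insertNth a y : Fin (n + 1) → X) j)) ∂ρ =
      ∫⁻ s, ∫⁻ a, ind (t < s) * ind (∀ j, s ≤ T ((i.insertNth a y : Fin (n + 1) → X) j)) *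
        (ENNReal.ofReal (w s (π ((i.insertNth a y : Fin (n + 1) → X) i))) *
          ψ s fun j => π ((i.insertNth a y : Fin (n + 1) → X) j)) ∂ρ ∂ν := by
    intro y
    have hf : Measurable fun q : ℝ × F => ind (t < q.1) * ind (∀ j, q.1 ≤ T (y j)) *
        ψ q.1 (i.insertNth q.2 fun j => π (y j)) := by
      refine ((measurable_ind ?_).fun_mul (measurable_ind ?_)).fun_mul ?_
      · exact measurableSet_lt measurable_const (by fun_prop)
      · rw [Set.ofPred_forall]
        exact MeasurableSet.iInter fun j => measurableSet_le (by fun_prop) (by fun_prop)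
      · exact hψ.comp (measurable_fst.prodMk
          (measurable_insertNth i (g := fun _ j => π (y j)) measurable_snd measurable_const))
    -- With the other individuals frozen, the event that they all outlast s and the factor ψ depend
    -- only on s and on the covariate data of individual i, as the compensator identity requires.
    have hc := h.compensator (fun s u => ind (t < s) * ind (∀ j, s ≤ T (y j)) *
        ψ s (i.insertNth u fun j => π (y j))) hf
    simp only [comp_insertNth, Fin.insertNth_apply_same]
    refine Eq.trans (lintegral_congr fun a => ?_)
      (hc.trans (lintegral_congr fun s => lintegral_congr fun a => ?_))
    · congr 3
      rw [forall_insertNth (fun b => T a ≤ T b)]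
      simp
    · rw [forall_insertNth (fun b => s ≤ T b), ind_and]
      ring
  rw [lintegral_congr key]
  have m3 : Measurable fun q : (ℝ × (Fin n → X)) × X => ind (t < q.1.1) *
      ind (∀ j, q.1.1 ≤ T ((i.insertNth q.2 q.1.2 : Fin (n + 1) → X) j)) *
        (ENNReal.ofReal (w q.1.1 (π ((i.insertNth q.2 q.1.2 : Fin (n + 1) → X) i))) *
          ψ q.1.1 fun j => π ((i.insertNth q.2 q.1.2 : Fin (n + 1) → X) j)) :=
    m2.comp ((measurable_fst.comp measurable_fst).prodMk
      (measurable_insertNth i measurable_snd (measurable_snd.comp measurable_fst)))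
  rw [lintegral_lintegral_swap]
  · refine lintegral_congr fun s => ?_
    have m4 : Measurable fun x : Fin (n + 1) → X => ind (t < s) * ind (∀ j, s ≤ T (x j)) *
        (ENNReal.ofReal (w s (π (x i))) * ψ s fun j => π (x j)) :=
      m2.comp (measurable_const.prodMk measurable_id)
    rw [lintegral_pi_insertNth ρ i m4]
    exact (lintegral_lintegral_swap (by exact (m4.comp mins).aemeasurable)).symm
  · refine Measurable.aemeasurable ?_
    exact (m3.comp ((measurable_snd.comp measurable_fst |>.prodMk
      (measurable_fst.comp measurable_fst)).prodMk measurable_snd :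
        Measurable fun q : ((Fin n → X) × ℝ) × X => ((q.1.2, q.1.1), q.2))).lintegral_prod_right'

/-- Induction on the number of individuals. Almost surely exactly one is strictly first; given that
one, the others satisfy the induction hypothesis after its time. The factor `g` of the covariate
data and the cut-off `t` make the statement stable under this conditioning. What is left is the
factor of the first individual, whose compensator is handled by `sum_mul_tilt_le` after summing over
the candidates for first place. -/
theorem HasIntensity.lintegral_scoreExp_le [SFinite ν] [IsProbabilityMeasure ρ]
    (h : HasIntensity ρ T D π w ν) (hz : Measurable fun q : ℝ × F => z q.1 q.2) {K : ℝ}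
    (hK : 0 < K) (hzK : ∀ s u, |z s u| ≤ K) (θ : ℝ) (n : ℕ) :
    ∀ (g : (Fin n → F) → ℝ≥0∞), Measurable g → ∀ t : ℝ,
      ∫⁻ x : Fin n → X, g (fun j => π (x j)) * ind (∀ j, t < T (x j)) *
          scoreExp T D π w z θ (2 * K) x ∂(Measure.pi fun _ => ρ) ≤
        ∫⁻ x : Fin n → X, g (fun j => π (x j)) * ind (∀ j, t < T (x j))
          ∂(Measure.pi fun _ => ρ) := by
  induction n with
  | zero =>
    intro g _ t
    refine lintegral_mono fun x => ?_
    simp [scoreExp]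
  | succ n ih =>
    intro g hg t
    have hT := h.measurable_time
    have hπ := h.measurable_proj
    have hD := h.measurableSet_mark
    have hties := ae_pi_no_ties ρ hT h.measure_time_eq (n + 1)
    have hπn : Measurable fun x : Fin (n + 1) → X => fun j => π (x j) := by fun_prop
    have mSE := h.measurable_scoreExp hz θ (2 * K) (n := n + 1)
    have mt : ∀ i : Fin (n + 1), Measurable fun x : Fin (n + 1) → X => ind (t < T (x i)) :=
      fun i => measurable_ind (measurableSet_lt measurable_const (by fun_prop))
    have mlt : ∀ i : Fin (n + 1), Measurable fun x : Fin (n + 1) → X =>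
        ind (∀ j, T (x i) < T (x (i.succAbove j))) := fun i => measurable_ind (by
      rw [Set.ofPred_forall]
      exact MeasurableSet.iInter fun j => measurableSet_lt (by fun_prop) (by fun_prop))
    have mle : ∀ i : Fin (n + 1), Measurable fun x : Fin (n + 1) → X =>
        ind (∀ j, T (x i) ≤ T (x j)) := fun i => measurable_ind (by
      rw [Set.ofPred_forall]
      exact MeasurableSet.iInter fun j => measurableSet_le (by fun_prop) (by fun_prop))
    have mtilt : ∀ i : Fin (n + 1), Measurable fun q : ℝ × (Fin (n + 1) → F) =>
        tilt w z θ (2 * K) i q.1 q.2 := fun i => measurable_tilt h.measurable_weight hz _ _ i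
    have mD : ∀ i : Fin (n + 1), Measurable fun x : Fin (n + 1) → X => ind (x i ∈ D) :=
      fun i => measurable_ind (measurable_pi_apply i hD)
    have mDc : ∀ i : Fin (n + 1), Measurable fun x : Fin (n + 1) → X => ind (x i ∉ D) :=
      fun i => measurable_ind_not (measurable_pi_apply i hD)
    have mg : Measurable fun x : Fin (n + 1) → X => g fun j => π (x j) := hg.comp hπn
    have mTt : ∀ i : Fin (n + 1), Measurable fun x : Fin (n + 1) → X =>
        tilt w z θ (2 * K) i (T (x i)) fun j => π (x j) := fun i =>
      (mtilt i).comp ((by fun_prop : Measurable fun x : Fin (n + 1) → X => T (x i)).prodMk hπn)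
    calc
      _ ≤ ∫⁻ x : Fin (n + 1) → X, ∑ i, ind (t < T (x i)) *
            (g (fun j => π (x j)) * ind (∀ j, T (x i) < T (x (i.succAbove j))) *
              scoreExp T D π w z θ (2 * K) x) ∂(Measure.pi fun _ => ρ) := by
          refine lintegral_mono_ae ?_
          filter_upwards [hties] with x hx
          by_cases hall : ∀ j, t < T (x j)
          · obtain ⟨i, hi⟩ := Finite.exists_min fun j => T (x j)
            refine le_trans ?_ (Finset.single_le_sum (fun i _ => zero_le) (Finset.mem_univ i))
            rw [ind_true hall, ind_true (hall i), ind_true fun j => lt_of_le_of_ne (hi _)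
              (hx _ _ (i.succAbove_ne j).symm)]
            simp
          · rw [ind_false hall]; simp
      _ = ∑ i, ∫⁻ x : Fin (n + 1) → X, ind (t < T (x i)) *
            (g (fun j => π (x j)) * ind (∀ j, T (x i) < T (x (i.succAbove j))) *
              scoreExp T D π w z θ (2 * K) x) ∂(Measure.pi fun _ => ρ) :=
          lintegral_finsetSum _ fun i _ => (mt i).fun_mul ((mg.fun_mul (mlt i)).fun_mul mSE)
      _ ≤ ∑ i, ∫⁻ x : Fin (n + 1) → X, ind (t < T (x i)) *
            (ind (∀ j, T (x i) ≤ T (x j)) * g (fun j => π (x j)) *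
              (ind (x i ∈ D) * tilt w z θ (2 * K) i (T (x i)) (fun j => π (x j)) +
                ind (x i ∉ D))) ∂(Measure.pi fun _ => ρ) := by
          refine Finset.sum_le_sum fun i _ => ?_
          rw [lintegral_pi_insertNth ρ i ((mt i).fun_mul ((mg.fun_mul (mlt i)).fun_mul mSE)),
            lintegral_pi_insertNth ρ i ((mt i).fun_mul (((mle i).fun_mul mg).fun_mul
              (((mD i).fun_mul (mTt i)).fun_add (mDc i))))]
          refine lintegral_mono fun a => ?_
          simp only [comp_insertNth, Fin.insertNth_apply_same, Fin.insertNth_apply_succAbove]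
          have hins : Measurable fun u : Fin n → F =>
              (i.insertNth (π a) u : Fin (n + 1) → F) :=
            measurable_insertNth i measurable_const measurable_id
          -- The factor of the first individual depends on the others only through covariate data,
          -- so it is absorbed in `g`; the cut-off becomes its time.
          have ih' := ih (fun u => ind (t < T a) * (g (i.insertNth (π a) u) *
            (ind (a ∈ D) * tilt w z θ (2 * K) i (T a) (i.insertNth (π a) u) + ind (a ∉ D))))
            (measurable_const.fun_mul ((hg.comp hins).fun_mul ((measurable_const.fun_mul
              ((mtilt i).comp (measurable_const.prodMk hins))).fun_add measurable_const))) (T a)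
          refine le_trans (le_of_eq (lintegral_congr fun y => ?_))
            (ih'.trans (lintegral_mono fun y => ?_))
          · by_cases hay : ∀ j, T a < T (y j)
            · rw [scoreExp_insertNth θ (2 * K) i a y hay, ind_true hay]
              ring
            · rw [ind_false hay]; simp
          · by_cases hay : ∀ j, T a < T (y j)
            · rw [ind_true hay, ind_true ((forall_insertNth (fun b => T a ≤ T b) i a y).2
                ⟨le_rfl, fun j => (hay j).le⟩)]
              simp
            · rw [ind_false hay]; simp
      _ = ∑ i, (∫⁻ x : Fin (n + 1) → X, ind (x i ∈ D) * (ind (t < T (x i)) *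
            ind (∀ j, T (x i) ≤ T (x j)) * (g (fun j => π (x j)) *
              tilt w z θ (2 * K) i (T (x i)) fun j => π (x j))) ∂(Measure.pi fun _ => ρ) +
            ∫⁻ x : Fin (n + 1) → X, ind (x i ∉ D) * (ind (t < T (x i)) *
              ind (∀ j, T (x i) ≤ T (x j)) * g (fun j => π (x j))) ∂(Measure.pi fun _ => ρ)) := by
          refine Finset.sum_congr rfl fun i _ => ?_
          rw [← lintegral_add_left ((mD i).fun_mul
            (((mt i).fun_mul (mle i)).fun_mul (mg.fun_mul (mTt i))))]
          exact lintegral_congr fun x => by ring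
      _ ≤ ∑ i, (∫⁻ x : Fin (n + 1) → X, ind (x i ∈ D) * (ind (t < T (x i)) *
            ind (∀ j, T (x i) ≤ T (x j)) * g (fun j => π (x j))) ∂(Measure.pi fun _ => ρ) +
            ∫⁻ x : Fin (n + 1) → X, ind (x i ∉ D) * (ind (t < T (x i)) *
              ind (∀ j, T (x i) ≤ T (x j)) * g (fun j => π (x j))) ∂(Measure.pi fun _ => ρ)) := by
          -- Only marked first individuals carry a tilt. Passing to the compensator puts all
          -- candidates i at the same instant s, with everyone at risk, so their tilts can be
          -- summed.
          rw [Finset.sum_add_distrib, Finset.sum_add_distrib]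
          refine add_le_add_left ?_ _
          have mgs : Measurable fun q : ℝ × (Fin (n + 1) → F) => g q.2 := hg.comp measurable_snd
          rw [Finset.sum_congr rfl fun i _ => h.lintegral_first i t
              (ψ := fun s u => g u * tilt w z θ (2 * K) i s u) (mgs.fun_mul (mtilt i)),
            Finset.sum_congr rfl fun i _ => h.lintegral_first i t (ψ := fun s u => g u) mgs]
          have mm : ∀ ψ : ℝ → (Fin (n + 1) → F) → ℝ≥0∞,
              (Measurable fun q : ℝ × (Fin (n + 1) → F) => ψ q.1 q.2) → ∀ i : Fin (n + 1),
              Measurable fun q : ℝ × (Fin (n + 1) → X) => ind (t < q.1) *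
                ind (∀ j, q.1 ≤ T (q.2 j)) *
                (ENNReal.ofReal (w q.1 (π (q.2 i))) * ψ q.1 fun j => π (q.2 j)) := by
            intro ψ hψ i
            refine ((measurable_ind ?_).fun_mul (measurable_ind ?_)).fun_mul (Measurable.fun_mul ?_ ?_)
            · exact measurableSet_lt measurable_const (by fun_prop)
            · rw [Set.ofPred_forall]
              exact MeasurableSet.iInter fun j => measurableSet_le (by fun_prop) (by fun_prop)
            · exact (h.measurable_weight.comp
                (measurable_fst.prodMk (by fun_prop))).ennreal_ofReal
            · exact hψ.comp (measurable_fst.prodMk (hπn.comp measurable_snd))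
          have m1 := fun i => mm (fun s u => g u * tilt w z θ (2 * K) i s u)
            (mgs.fun_mul (mtilt i)) i
          have m2 := fun i => mm (fun _ u => g u) mgs i
          rw [← lintegral_finsetSum _ fun i _ => (m1 i).lintegral_prod_right',
            ← lintegral_finsetSum _ fun i _ => (m2 i).lintegral_prod_right']
          refine lintegral_mono fun s => ?_
          have m1s := fun i => (m1 i).comp (measurable_const.prodMk measurable_id :
            Measurable fun x : Fin (n + 1) → X => (s, x))
          have m2s := fun i => (m2 i).comp (measurable_const.prodMk measurable_id :
            Measurable fun x : Fin (n + 1) → X => (s, x))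
          simp only [Function.comp_def] at m1s m2s
          rw [← lintegral_finsetSum _ fun i _ => m1s i, ← lintegral_finsetSum _ fun i _ => m2s i]
          refine lintegral_mono fun x => ?_
          rw [← Finset.mul_sum, ← Finset.mul_sum]
          refine mul_le_mul_right ?_ _
          have hst := sum_mul_tilt_le (w := w) (z := z) hK h.weight_pos hzK θ s
            fun j => π (x j)
          calc _ = g (fun j => π (x j)) * ∑ i, ENNReal.ofReal (w s (π (x i))) *
                  tilt w z θ (2 * K) i s (fun j => π (x j)) := by
                rw [Finset.mul_sum]; exact Finset.sum_congr rfl fun i _ => by ring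
            _ ≤ g (fun j => π (x j)) * ∑ i, ENNReal.ofReal (w s (π (x i))) :=
                mul_le_mul_right hst _
            _ = _ := by rw [Finset.mul_sum]; exact Finset.sum_congr rfl fun i _ => by ring
      _ = ∫⁻ x : Fin (n + 1) → X, ∑ i, ind (t < T (x i)) *
            ind (∀ j, T (x i) ≤ T (x j)) * g (fun j => π (x j)) ∂(Measure.pi fun _ => ρ) := by
          rw [lintegral_finsetSum _ fun i _ => ((mt i).fun_mul (mle i)).fun_mul mg]
          refine Finset.sum_congr rfl fun i _ => ?_
          rw [← lintegral_add_left ((mD i).fun_mul (((mt i).fun_mul (mle i)).fun_mul mg))]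
          refine lintegral_congr fun x => ?_
          by_cases hx : x i ∈ D <;> simp [ind, hx]
      _ ≤ _ := by
          refine lintegral_mono_ae ?_
          filter_upwards [hties] with x hx
          obtain ⟨i, hi⟩ := Finite.exists_min fun j => T (x j)
          rw [Finset.sum_eq_single i]
          · rw [ind_true hi, mul_one, mul_comm]
            refine mul_le_mul_right (ind_mono fun h j => h.trans_le (hi j)) _
          · intro k _ hki
            rw [ind_false fun hk : ∀ j, T (x k) ≤ T (x j) =>
              hx k i hki (le_antisymm (hk i) (hi k))]
            simp
          · simp

end

end

noncomputable section

/-! ### Concentration inequalities -/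

theorem one_div_sqrt_succ_add_le (k : ℕ) :
    1 / √((k + 1 : ℕ) : ℝ) + 2 * √(k : ℝ) ≤ 2 * √((k + 1 : ℕ) : ℝ) := by
  have h1 : 0 < √((k + 1 : ℕ) : ℝ) := Real.sqrt_pos.2 (by positivity)
  have h2 : √((k + 1 : ℕ) : ℝ) ^ 2 = k + 1 := by rw [Real.sq_sqrt (by positivity)]; push_cast; ring
  have h3 : √(k : ℝ) ^ 2 = k := Real.sq_sqrt (by positivity)
  rw [← le_sub_iff_add_le, div_le_iff₀ h1]
  nlinarith [sq_nonneg (√((k + 1 : ℕ) : ℝ) - √(k : ℝ))]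

/-- The reciprocal square roots of the sizes of the risk sets sum to at most `2 √n`. -/
theorem sum_one_div_sqrt_card_le {ι : Type*} [DecidableEq ι] (T : ι → ℝ) (A : Finset ι) :
    ∑ i ∈ A, 1 / √((A.filter fun j => T i ≤ T j).card : ℝ) ≤ 2 * √(A.card : ℝ) := by
  induction A using Finset.induction_on_min_value T with
  | empty => simp
  | insert a s ha hmin ih =>
    -- The new element has the smallest value: its risk set is everything, and adding it leaves the
    -- other risk sets no smaller.
    rw [Finset.sum_insert ha, Finset.card_insert_of_notMem ha]
    have e : (insert a s).filter (fun j => T a ≤ T j) = insert a s :=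
      Finset.filter_true_of_mem fun j hj => by
        rcases Finset.mem_insert.1 hj with rfl | hj
        · exact le_rfl
        · exact hmin j hj
    rw [e, Finset.card_insert_of_notMem ha]
    refine le_trans ?_ (one_div_sqrt_succ_add_le s.card)
    refine add_le_add_right (le_trans (Finset.sum_le_sum fun i hi => ?_) ih) _
    have h0 : 0 < (s.filter fun j => T i ≤ T j).card :=
      Finset.card_pos.2 ⟨i, Finset.mem_filter.2 ⟨hi, le_rfl⟩⟩
    have h1 : (s.filter fun j => T i ≤ T j).card ≤
        ((insert a s).filter fun j => T i ≤ T j).card :=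
      Finset.card_le_card (Finset.filter_subset_filter _ (Finset.subset_insert _ _))
    refine one_div_le_one_div_of_le (Real.sqrt_pos.2 (by exact_mod_cast h0)) ?_
    exact Real.sqrt_le_sqrt (by exact_mod_cast h1)

/-- The number of individuals at risk at the time observed for the `i`-th one. -/
def riskCount {X : Type*} (T : X → ℝ) {n : ℕ} (x : Fin n → X) (i : Fin n) : ℕ :=
  (Finset.univ.filter fun j => T (x i) ≤ T (x j)).card

theorem riskCount_eq_sum {X : Type*} (T : X → ℝ) {n : ℕ} (x : Fin n → X) (i : Fin n) :
    (riskCount T x i : ℝ) = ∑ j, (ind (T (x i) ≤ T (x j))).toReal := by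
  classical
  rw [riskCount, Finset.card_filter]
  push_cast
  refine Finset.sum_congr rfl fun j _ => ?_
  by_cases h : T (x i) ≤ T (x j) <;> simp [ind, h]

theorem riskCount_pos {X : Type*} (T : X → ℝ) {n : ℕ} (x : Fin n → X) (i : Fin n) :
    0 < riskCount T x i :=
  Finset.card_pos.2 ⟨i, Finset.mem_filter.2 ⟨Finset.mem_univ _, le_rfl⟩⟩

section

variable {X : Type*} [MeasurableSpace X] {ρ : Measure X} [IsProbabilityMeasure ρ]

/-- A self-normalised form of Hoeffding's lemma. -/
theorem lintegral_exp_hoeffding_le_one {b : ℝ} (hb : 0 < b) (θ : ℝ) {y f : X → ℝ}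
    (hy : Measurable y) (hf : Measurable f) (hy01 : ∀ a, y a = 0 ∨ y a = 1)
    (hfb : ∀ a, |f a| ≤ b) (h0 : ∫ a, y a * f a ∂ρ = 0) :
    ∫⁻ a, ENNReal.ofReal (Real.exp (y a * (θ * f a - θ ^ 2 * b ^ 2 / 2))) ∂ρ ≤ 1 := by
  obtain ⟨κ, hκ⟩ := exists_exp_le_one_add_mul hb θ
  have hle : ∀ a, Real.exp (y a * (θ * f a - θ ^ 2 * b ^ 2 / 2)) ≤ 1 + κ * (y a * f a) := by
    intro a
    rcases hy01 a with h | h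
    · simp [h]
    · rw [h, one_mul, one_mul]; exact hκ _ (hfb a)
  have hi : Integrable (fun a => y a * f a) ρ := by
    refine Integrable.of_bound (hy.mul hf).aestronglyMeasurable b (ae_of_all _ fun a => ?_)
    rw [Real.norm_eq_abs, abs_mul]
    rcases hy01 a with h | h
    · simp [h, hb.le]
    · rw [h, abs_one, one_mul]; exact hfb a
  have hi2 : Integrable (fun a => 1 + κ * (y a * f a)) ρ := (integrable_const 1).add (hi.const_mul κ)
  calc _ ≤ ∫⁻ a, ENNReal.ofReal (1 + κ * (y a * f a)) ∂ρ :=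
        lintegral_mono fun a => ENNReal.ofReal_le_ofReal (hle a)
    _ = ENNReal.ofReal (∫ a, (1 + κ * (y a * f a)) ∂ρ) :=
        (ofReal_integral_eq_lintegral_ofReal hi2
          (ae_of_all _ fun a => (Real.exp_pos _).le.trans (hle a))).symm
    _ = 1 := by
        rw [integral_add (integrable_const 1) (hi.const_mul κ), integral_const_mul, h0]
        simp

theorem lintegral_pi_prod_le_one {ψ : X → ℝ≥0∞} (hψ : Measurable ψ) (h1 : ∫⁻ a, ψ a ∂ρ ≤ 1)
    (n : ℕ) : ∫⁻ x : Fin n → X, ∏ j, ψ (x j) ∂(Measure.pi fun _ => ρ) ≤ 1 := by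
  induction n with
  | zero => simp
  | succ n ih =>
    have hm : Measurable fun x : Fin (n + 1) → X => ∏ j, ψ (x j) :=
      Finset.measurable_fun_prod _ fun j _ => hψ.comp (measurable_pi_apply j)
    rw [lintegral_pi_insertNth ρ 0 hm]
    simp only [Fin.prod_univ_succAbove _ (0 : Fin (n + 1)), Fin.insertNth_apply_same,
      Fin.insertNth_apply_succAbove]
    calc _ = ∫⁻ a, ψ a * ∫⁻ y : Fin n → X, ∏ j, ψ (y j) ∂(Measure.pi fun _ => ρ) ∂ρ :=
          lintegral_congr fun a => lintegral_const_mul _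
            (Finset.measurable_fun_prod _ fun j _ => hψ.comp (measurable_pi_apply j))
      _ ≤ ∫⁻ a, ψ a * 1 ∂ρ := lintegral_mono fun a => mul_le_mul_right ih _
      _ ≤ 1 := by simpa using h1

/-- Given individual i, its time is a constant and the others remain independent, so a bound uniform
in s survives evaluation at the random time. -/
theorem lintegral_pi_prod_succAbove_le_one {T : X → ℝ} (hT : Measurable T) {ψ : ℝ → X → ℝ≥0∞}
    (hψ : Measurable fun q : ℝ × X => ψ q.1 q.2) (h1 : ∀ s, ∫⁻ a, ψ s a ∂ρ ≤ 1) {n : ℕ}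
    (i : Fin (n + 1)) :
    ∫⁻ x : Fin (n + 1) → X, ∏ k, ψ (T (x i)) (x (i.succAbove k)) ∂(Measure.pi fun _ => ρ) ≤ 1 := by
  have hm : Measurable fun x : Fin (n + 1) → X => ∏ k, ψ (T (x i)) (x (i.succAbove k)) :=
    Finset.measurable_fun_prod _ fun k _ => hψ.comp
      ((hT.comp (measurable_pi_apply i)).prodMk (measurable_pi_apply _))
  rw [lintegral_pi_insertNth ρ i hm]
  simp only [Fin.insertNth_apply_same, Fin.insertNth_apply_succAbove]
  calc _ ≤ ∫⁻ _ : X, 1 ∂ρ := lintegral_mono fun a =>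
        lintegral_pi_prod_le_one (hψ.comp (measurable_const.prodMk measurable_id)) (h1 (T a)) n
    _ = 1 := by simp

end

/-- Markov's inequality for an exponential. -/
theorem measure_ge_le_exp_neg {Y : Type*} [MeasurableSpace Y] {μ : Measure Y} {S : Y → ℝ}
    (hS : Measurable S) (h1 : ∫⁻ y, ENNReal.ofReal (Real.exp (S y)) ∂μ ≤ 1) (L : ℝ) :
    μ {y | L ≤ S y} ≤ ENNReal.ofReal (Real.exp (-L)) := by
  have h := mul_meas_ge_le_lintegral (μ := μ) (hS.exp.ennreal_ofReal)
    (ENNReal.ofReal (Real.exp L))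
  have hsub : {y | L ≤ S y} ⊆
      {y | ENNReal.ofReal (Real.exp L) ≤ ENNReal.ofReal (Real.exp (S y))} := fun y hy =>
    ENNReal.ofReal_le_ofReal (Real.exp_le_exp.2 hy)
  have h2 : ENNReal.ofReal (Real.exp L) * μ {y | L ≤ S y} ≤ 1 :=
    (mul_le_mul_right (measure_mono hsub) _).trans (h.trans h1)
  have h3 : μ {y | L ≤ S y} ≤ 1 / ENNReal.ofReal (Real.exp L) := by
    rw [ENNReal.le_div_iff_mul_le (Or.inl (by simp [Real.exp_pos])) (Or.inl ENNReal.ofReal_ne_top),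
      mul_comm]
    exact h2
  rwa [one_div, ← ENNReal.ofReal_inv_of_pos (Real.exp_pos _), ← Real.exp_neg] at h3

/-- The choice of `θ` that balances the two terms of the exponential bounds. -/
theorem exponent_ge {b L N A M : ℝ} (hb : 0 < b) (hL : 0 < L) (hN : 0 < N) (hMN : M ≤ N)
    (hA : b * √(2 * L) * √N < A) :
    L ≤ √(2 * L) / (b * √N) * A - (√(2 * L) / (b * √N)) ^ 2 * b ^ 2 / 2 * M := by
  have hsL : 0 < √(2 * L) := Real.sqrt_pos.2 (by positivity)
  have hsN : 0 < √N := Real.sqrt_pos.2 hN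
  have h1 : √(2 * L) ^ 2 = 2 * L := Real.sq_sqrt (by positivity)
  have h2 : √N ^ 2 = N := Real.sq_sqrt hN.le
  have e1 : 2 * L ≤ √(2 * L) / (b * √N) * A := by
    rw [div_mul_eq_mul_div, le_div_iff₀ (by positivity)]
    have e : √(2 * L) * (b * √(2 * L) * √N) = √(2 * L) ^ 2 * (b * √N) := by ring
    have h3 := mul_lt_mul_of_pos_left hA hsL
    rw [e, h1] at h3
    exact h3.le
  have e2 : (√(2 * L) / (b * √N)) ^ 2 * b ^ 2 / 2 * M ≤ L := by
    have : (√(2 * L) / (b * √N)) ^ 2 * b ^ 2 / 2 = L / N := by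
      rw [div_pow, mul_pow, h1, h2]; field_simp
    rw [this, div_mul_eq_mul_div, div_le_iff₀ hN]
    nlinarith
  linarith

section

variable {X : Type*} [MeasurableSpace X] {ρ : Measure X} [IsProbabilityMeasure ρ]

theorem measure_sum_gt_le {b L : ℝ} (hb : 0 < b) (hL : 0 < L) {f : X → ℝ} (hf : Measurable f)
    (hfb : ∀ a, |f a| ≤ b) (h0 : ∫ a, f a ∂ρ = 0) {n : ℕ} (hn : 0 < n) :
    (Measure.pi fun _ : Fin n => ρ) {x | b * √(2 * L) * √(n : ℝ) < ∑ j, f (x j)} ≤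
      ENNReal.ofReal (Real.exp (-L)) := by
  set θ := √(2 * L) / (b * √(n : ℝ)) with hθ
  have hmg := lintegral_exp_hoeffding_le_one (ρ := ρ) hb θ (y := fun _ => 1) measurable_const hf
    (fun _ => Or.inr rfl) hfb (by simpa using h0)
  have hpi := lintegral_pi_prod_le_one (ρ := ρ) (by fun_prop) hmg n
  have e : ∀ x : Fin n → X, ∏ j, ENNReal.ofReal (Real.exp (1 * (θ * f (x j) - θ ^ 2 * b ^ 2 / 2)))
      = ENNReal.ofReal (Real.exp (∑ j, (θ * f (x j) - θ ^ 2 * b ^ 2 / 2))) := by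
    intro x
    rw [Real.exp_sum, ENNReal.ofReal_prod_of_nonneg fun _ _ => (Real.exp_pos _).le]
    simp only [one_mul]
  simp only [e] at hpi
  refine (measure_mono fun x hx => ?_).trans (measure_ge_le_exp_neg (by fun_prop) hpi L)
  have hx : b * √(2 * L) * √(n : ℝ) < ∑ j, f (x j) := hx
  change L ≤ ∑ j, (θ * f (x j) - θ ^ 2 * b ^ 2 / 2)
  rw [Finset.sum_sub_distrib, ← Finset.mul_sum, Finset.sum_const, Finset.card_univ,
    Fintype.card_fin, nsmul_eq_mul, mul_comm (n : ℝ)]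
  exact exponent_ge hb hL (by exact_mod_cast hn) le_rfl hx

theorem measure_abs_sum_gt_le {b L : ℝ} (hb : 0 < b) (hL : 0 < L) {f : X → ℝ} (hf : Measurable f)
    (hfb : ∀ a, |f a| ≤ b) (h0 : ∫ a, f a ∂ρ = 0) {n : ℕ} (hn : 0 < n) :
    (Measure.pi fun _ : Fin n => ρ) {x | b * √(2 * L) * √(n : ℝ) < |∑ j, f (x j)|} ≤
      2 * ENNReal.ofReal (Real.exp (-L)) := by
  have h1 := measure_sum_gt_le (ρ := ρ) hb hL hf hfb h0 hn
  have h2 := measure_sum_gt_le (ρ := ρ) hb hL hf.neg (by simpa using hfb)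
    (by simpa [integral_neg] using h0) hn
  have h3 := (measure_union_le _ _).trans (add_le_add h1 h2)
  rw [← two_mul] at h3
  refine (measure_mono fun x hx => ?_).trans h3
  rcases lt_abs.1 (show b * √(2 * L) * √(n : ℝ) < |∑ j, f (x j)| from hx) with h | h
  · exact Or.inl h
  · refine Or.inr ?_
    change _ < ∑ j, -f (x j)
    rwa [Finset.sum_neg_distrib]

/-- The optimal θ depends on the size of the risk set, which is random. Each possible size is given
its own θ, and a union bound over the n + 1 sizes yields the prefactor. -/
theorem measure_riskSum_gt_le {T : X → ℝ} (hT : Measurable T) {b L : ℝ} (hb : 0 < b) (hL : 0 < L)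
    {f : ℝ → X → ℝ} (hf : Measurable fun q : ℝ × X => f q.1 q.2) (hfb : ∀ s a, |f s a| ≤ b)
    (h0 : ∀ s, ∫ a, (ind (s ≤ T a)).toReal * f s a ∂ρ = 0) {n : ℕ} (i : Fin (n + 1)) :
    (Measure.pi fun _ : Fin (n + 1) => ρ)
      {x | b * √(2 * L) * √(riskCount T x i : ℝ) <
        ∑ k, (ind (T (x i) ≤ T (x (i.succAbove k)))).toReal * f (T (x i)) (x (i.succAbove k))} ≤
      (n + 1 : ℕ) * ENNReal.ofReal (Real.exp (-L)) := by
  classical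
  have hy : Measurable fun q : ℝ × X => (ind (q.1 ≤ T q.2)).toReal :=
    (measurable_ind (measurableSet_le measurable_fst (hT.comp measurable_snd))).ennreal_toReal
  have hy01 : ∀ q : Prop, (ind q).toReal = 0 ∨ (ind q).toReal = 1 := fun q => by
    unfold ind; split_ifs <;> simp
  set θ : ℕ → ℝ := fun r => √(2 * L) / (b * √((r : ℕ) : ℝ)) with hθ
  set S : ℕ → (Fin (n + 1) → X) → ℝ := fun r x =>
    ∑ k, (ind (T (x i) ≤ T (x (i.succAbove k)))).toReal *
      (θ r * f (T (x i)) (x (i.succAbove k)) - θ r ^ 2 * b ^ 2 / 2) with hS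
  have hq : ∀ k, Measurable fun x : Fin (n + 1) → X => (T (x i), x (i.succAbove k)) := fun k =>
    (hT.comp (measurable_pi_apply i)).prodMk (measurable_pi_apply _)
  have hSm : ∀ r, Measurable (S r) := fun r => Finset.measurable_fun_sum _ fun k _ =>
    (hy.comp (hq k)).fun_mul (((hf.comp (hq k)).const_mul _).sub_const _)
  have hbad : ∀ r, (Measure.pi fun _ : Fin (n + 1) => ρ) {x | L ≤ S r x} ≤
      ENNReal.ofReal (Real.exp (-L)) := by
    intro r
    refine measure_ge_le_exp_neg (hSm r) ?_ L
    have h1 := lintegral_pi_prod_succAbove_le_one (ρ := ρ) hT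
      (ψ := fun s a => ENNReal.ofReal (Real.exp ((ind (s ≤ T a)).toReal *
        (θ r * f s a - θ r ^ 2 * b ^ 2 / 2))))
      (by exact (Real.measurable_exp.comp
        (hy.fun_mul ((hf.const_mul _).sub_const _))).ennreal_ofReal)
      (fun s => lintegral_exp_hoeffding_le_one hb (θ r)
        (hy.comp (measurable_const.prodMk measurable_id))
        (hf.comp (measurable_const.prodMk measurable_id)) (fun a => hy01 _) (hfb s) (h0 s)) i
    refine le_trans (le_of_eq (lintegral_congr fun x => ?_)) h1
    rw [hS, Real.exp_sum, ENNReal.ofReal_prod_of_nonneg fun _ _ => (Real.exp_pos _).le]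
  have hsub : {x | b * √(2 * L) * √(riskCount T x i : ℝ) <
        ∑ k, (ind (T (x i) ≤ T (x (i.succAbove k)))).toReal * f (T (x i)) (x (i.succAbove k))} ⊆
      ⋃ r ∈ Finset.Icc 1 (n + 1), {x | L ≤ S r x} := by
    intro x hx
    have hx : b * √(2 * L) * √(riskCount T x i : ℝ) <
        ∑ k, (ind (T (x i) ≤ T (x (i.succAbove k)))).toReal *
          f (T (x i)) (x (i.succAbove k)) := hx
    have hpos := riskCount_pos T x i
    have hle : riskCount T x i ≤ n + 1 := (Finset.card_le_univ _).trans (by simp)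
    simp only [Set.mem_iUnion]
    refine ⟨riskCount T x i, Finset.mem_Icc.2 ⟨hpos, hle⟩, ?_⟩
    have hM : ∑ k, (ind (T (x i) ≤ T (x (i.succAbove k)))).toReal ≤ (riskCount T x i : ℝ) := by
      rw [riskCount_eq_sum, Fin.sum_univ_succAbove _ i]
      exact le_add_of_nonneg_left ENNReal.toReal_nonneg
    have := exponent_ge hb hL (by exact_mod_cast hpos) hM hx
    change L ≤ S (riskCount T x i) x
    refine this.trans (le_of_eq ?_)
    rw [hS, hθ]
    simp only [mul_sub, Finset.sum_sub_distrib, Finset.mul_sum]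
    congr 1
    · exact Finset.sum_congr rfl fun k _ => by ring
    · exact Finset.sum_congr rfl fun k _ => by ring
  calc _ ≤ (Measure.pi fun _ : Fin (n + 1) => ρ) (⋃ r ∈ Finset.Icc 1 (n + 1), {x | L ≤ S r x}) :=
        measure_mono hsub
    _ ≤ ∑ r ∈ Finset.Icc 1 (n + 1), (Measure.pi fun _ : Fin (n + 1) => ρ) {x | L ≤ S r x} :=
        measure_biUnion_finset_le _ _
    _ ≤ ∑ _r ∈ Finset.Icc 1 (n + 1), ENNReal.ofReal (Real.exp (-L)) :=
        Finset.sum_le_sum fun r _ => hbad r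
    _ = _ := by rw [Finset.sum_const, Nat.card_Icc, nsmul_eq_mul]; simp

theorem measure_exists_riskSum_gt_le {T : X → ℝ} (hT : Measurable T) {b L : ℝ} (hb : 0 < b)
    (hL : 1 ≤ L) {f : ℝ → X → ℝ} (hf : Measurable fun q : ℝ × X => f q.1 q.2)
    (hfb : ∀ s a, |f s a| ≤ b)
    (h0 : ∀ s, ∫ a, (ind (s ≤ T a)).toReal * f s a ∂ρ = 0) (n : ℕ) :
    (Measure.pi fun _ : Fin n => ρ)
      {x | ∃ i, 3 * b * √L * √(riskCount T x i : ℝ) <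
        |∑ j, (ind (T (x i) ≤ T (x j))).toReal * f (T (x i)) (x j)|} ≤
      2 * (n : ℝ≥0∞) ^ 2 * ENNReal.ofReal (Real.exp (-L)) := by
  obtain _ | n := n
  · refine le_trans (le_of_eq ?_) zero_le
    convert measure_empty (μ := Measure.pi fun _ : Fin 0 => ρ)
    ext x
    simp only [Set.mem_ofPred_eq, Set.mem_empty_iff_false, iff_false, not_exists]
    exact fun i => i.elim0
  have hL0 : 0 < L := by linarith
  have h1 := fun i => measure_riskSum_gt_le (ρ := ρ) hT hb hL0 hf hfb h0 (n := n) i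
  have h2 := fun i => measure_riskSum_gt_le (ρ := ρ) hT hb hL0 (f := fun s a => -f s a) hf.neg
    (by simpa using hfb) (by simpa [integral_neg] using h0) (n := n) i
  have hsub : {x : Fin (n + 1) → X | ∃ i, 3 * b * √L * √(riskCount T x i : ℝ) <
        |∑ j, (ind (T (x i) ≤ T (x j))).toReal * f (T (x i)) (x j)|} ⊆
      ⋃ i ∈ (Finset.univ : Finset (Fin (n + 1))),
      ({x | b * √(2 * L) * √(riskCount T x i : ℝ) <
        ∑ k, (ind (T (x i) ≤ T (x (i.succAbove k)))).toReal * f (T (x i)) (x (i.succAbove k))} ∪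
      {x | b * √(2 * L) * √(riskCount T x i : ℝ) <
        ∑ k, (ind (T (x i) ≤ T (x (i.succAbove k)))).toReal *
          -f (T (x i)) (x (i.succAbove k))}) := by
    rintro x ⟨i, hi⟩
    simp only [Set.mem_iUnion]
    refine ⟨i, Finset.mem_univ _, ?_⟩
    set N := ∑ k, (ind (T (x i) ≤ T (x (i.succAbove k)))).toReal *
      f (T (x i)) (x (i.succAbove k)) with hN
    have hr1 : (1 : ℝ) ≤ √(riskCount T x i : ℝ) :=
      Real.one_le_sqrt.2 (by exact_mod_cast riskCount_pos T x i)
    have hL1 : 1 ≤ √L := Real.one_le_sqrt.2 hL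
    have hs2 : √(2 * L) ≤ 2 * √L := by
      rw [Real.sqrt_mul (by norm_num)]
      gcongr
      rw [Real.sqrt_le_left (by norm_num)]; norm_num
    -- The own term of individual i need not be centred, but it is at most b, hence at most
    -- b√L√(risk count). With √2 ≤ 2 this explains the constant 3.
    have hlt : b * √(2 * L) * √(riskCount T x i : ℝ) < |N| := by
      rw [Fin.sum_univ_succAbove _ i, ind_true le_rfl, ← hN] at hi
      have h3 := hi.trans_le (abs_add_le _ _)
      have h4 := hfb (T (x i)) (x i)
      simp only [ENNReal.toReal_one, one_mul] at h3
      have h5 : b * √(2 * L) * √(riskCount T x i : ℝ) ≤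
          b * (2 * √L) * √(riskCount T x i : ℝ) := by gcongr
      have h6 : b * 1 ≤ b * (√L * √(riskCount T x i : ℝ)) := by
        gcongr; nlinarith
      nlinarith
    rcases lt_abs.1 hlt with h | h
    · exact Or.inl h
    · refine Or.inr ?_
      change _ < ∑ k, _ * -f _ _
      simpa only [mul_neg, Finset.sum_neg_distrib] using h
  refine (measure_mono hsub).trans ((measure_biUnion_finset_le _ _).trans ?_)
  calc _ ≤ ∑ _i : Fin (n + 1), (((n + 1 : ℕ) : ℝ≥0∞) * ENNReal.ofReal (Real.exp (-L)) +
          ((n + 1 : ℕ) : ℝ≥0∞) * ENNReal.ofReal (Real.exp (-L))) :=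
        Finset.sum_le_sum fun i _ => (measure_union_le _ _).trans (add_le_add (h1 i) (h2 i))
    _ = _ := by
        rw [Finset.sum_const, Finset.card_univ, Fintype.card_fin, nsmul_eq_mul]; ring

end

/-- The tail bound of the score of a sample with an intensity. -/
theorem HasIntensity.measure_score_gt_le {X F : Type*} [MeasurableSpace X] [MeasurableSpace F]
    {ρ : Measure X} [IsProbabilityMeasure ρ] {T : X → ℝ} {D : Set X} {π : X → F}
    {w z : ℝ → F → ℝ} {ν : Measure ℝ} [SFinite ν] (h : HasIntensity ρ T D π w ν)
    (hT0 : ∀ᵐ a ∂ρ, 0 ≤ T a)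
    (hz : Measurable fun q : ℝ × F => z q.1 q.2) {K L : ℝ} (hK : 0 < K) (hL : 0 < L)
    (hzK : ∀ s u, |z s u| ≤ K) {n : ℕ} (hn : 0 < n) :
    (Measure.pi fun _ : Fin n => ρ) {x | 2 * K * √(2 * L) * √(n : ℝ) <
      ∑ i, (ind (x i ∈ D)).toReal * (z (T (x i)) (π (x i)) - riskAvg T π w z (T (x i)) x)} ≤
      ENNReal.ofReal (Real.exp (-L)) := by
  set θ := √(2 * L) / (2 * K * √(n : ℝ)) with hθ
  -- The cut-off -1 lies below almost every observed time, so its indicator disappears from the left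
  -- side.
  have h1 := h.lintegral_scoreExp_le hz hK hzK θ n (fun _ => 1) measurable_const (-1)
  have hT := h.measurable_time
  have hTi : ∀ i, Measurable fun x : Fin n → X => T (x i) := fun i => by fun_prop
  have hpos : ∀ᵐ x ∂(Measure.pi fun _ : Fin n => ρ), ∀ j, -1 < T (x j) := by
    rw [ae_all_iff]
    intro j
    have := (measurePreserving_eval (fun _ : Fin n => ρ) j).quasiMeasurePreserving.ae hT0
    filter_upwards [this] with x hx
    have hx : 0 ≤ T (x j) := hx
    linarith
  have h2 : ∫⁻ x : Fin n → X, scoreExp T D π w z θ (2 * K) x ∂(Measure.pi fun _ => ρ) ≤ 1 := by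
    calc _ = ∫⁻ x : Fin n → X, 1 * ind (∀ j, -1 < T (x j)) *
          scoreExp T D π w z θ (2 * K) x ∂(Measure.pi fun _ => ρ) := by
          refine lintegral_congr_ae ?_
          filter_upwards [hpos] with x hx
          rw [ind_true hx]; simp
      _ ≤ _ := h1
      _ ≤ ∫⁻ _x : Fin n → X, 1 ∂(Measure.pi fun _ => ρ) :=
          lintegral_mono fun x => by rw [one_mul]; exact ind_le_one _
      _ = 1 := by simp
  set S : (Fin n → X) → ℝ := fun x => ∑ i, (ind (x i ∈ D)).toReal *
    (θ * (z (T (x i)) (π (x i)) - riskAvg T π w z (T (x i)) x) - θ ^ 2 * (2 * K) ^ 2 / 2) with hS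
  have hSm : Measurable S := by
    refine Finset.measurable_fun_sum _ fun i _ => ?_
    have a1 : Measurable fun x : Fin n → X => riskAvg T π w z (T (x i)) x :=
      h.measurable_riskAvg hz (hTi i) measurable_id
    have a2 : Measurable fun x : Fin n → X => z (T (x i)) (π (x i)) :=
      hz.comp ((hTi i).prodMk (h.measurable_proj.comp (measurable_pi_apply i)))
    have a3 : Measurable fun x : Fin n → X => (ind (x i ∈ D)).toReal :=
      (measurable_ind (measurable_pi_apply i h.measurableSet_mark)).ennreal_toReal
    exact a3.fun_mul (((a2.fun_sub a1).const_mul _).sub_const _)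
  have e : ∀ x, scoreExp T D π w z θ (2 * K) x = ENNReal.ofReal (Real.exp (S x)) := by
    intro x
    rw [hS, Real.exp_sum, ENNReal.ofReal_prod_of_nonneg fun _ _ => (Real.exp_pos _).le]
    refine Finset.prod_congr rfl fun i _ => ?_
    by_cases hx : x i ∈ D
    · rw [ind_true hx, ind_false (not_not.2 hx)]; simp
    · rw [ind_false hx, ind_true hx]; simp
  simp only [e] at h2
  refine (measure_mono fun x hx => ?_).trans (measure_ge_le_exp_neg hSm h2 L)
  have hM : ∑ i, (ind (x i ∈ D)).toReal ≤ (n : ℝ) := by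
    calc _ ≤ ∑ _i : Fin n, (1 : ℝ) := Finset.sum_le_sum fun i _ => by
            unfold ind; split_ifs <;> simp
      _ = n := by simp
  have := exponent_ge (b := 2 * K) (by positivity) hL (by exact_mod_cast hn) hM hx
  change L ≤ S x
  refine this.trans (le_of_eq ?_)
  rw [hS, hθ]
  simp only [mul_sub, Finset.sum_sub_distrib, Finset.mul_sum]
  congr 1
  · congr 1 <;> exact Finset.sum_congr rfl fun k _ => by ring
  · exact Finset.sum_congr rfl fun k _ => by ring

end

noncomputable section

/-! ### Survival functions and the compensator of the observed failure -/

/-- A function dominated by an absolutely continuous one is absolutely continuous. -/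
theorem AbsolutelyContinuousOnInterval.of_dist_le {f H : ℝ → ℝ} {a b : ℝ}
    (hH : AbsolutelyContinuousOnInterval H a b)
    (hle : ∀ s ∈ Set.uIcc a b, ∀ t ∈ Set.uIcc a b, dist (f s) (f t) ≤ dist (H s) (H t)) :
    AbsolutelyContinuousOnInterval f a b := by
  rw [absolutelyContinuousOnInterval_iff] at hH ⊢
  intro ε hε
  obtain ⟨δ, hδ, h⟩ := hH ε hε
  refine ⟨δ, hδ, fun D hD hDδ => lt_of_le_of_lt (Finset.sum_le_sum fun i hi => ?_) (h D hD hDδ)⟩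
  have := hD.1 i hi
  exact hle _ this.1 _ this.2

/-- The total mass of the density `h exp (-∫ h)` of a survival time. -/
theorem lintegral_hazard_mul_survival {g : ℝ → ℝ} (hg : Measurable g) (hg0 : ∀ s, 0 ≤ g s) {b : ℝ}
    (hb : 0 ≤ b) (hfin : ∫⁻ s in Set.Ioc 0 b, ENNReal.ofReal (g s) ≠ ⊤) :
    ∫⁻ s in Set.Ioc 0 b, ENNReal.ofReal (g s) *
        ENNReal.ofReal (Real.exp (-(∫⁻ r in Set.Ioc 0 s, ENNReal.ofReal (g r)).toReal)) =
      ENNReal.ofReal (1 - Real.exp (-(∫⁻ s in Set.Ioc 0 b, ENNReal.ofReal (g s)).toReal)) := by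
  have hint : IntegrableOn g (Set.Ioc 0 b) := by
    refine ⟨hg.aestronglyMeasurable, ?_⟩
    rw [hasFiniteIntegral_iff_ofReal (ae_of_all _ hg0)]
    exact lt_top_iff_ne_top.2 hfin
  have hii : IntervalIntegrable g volume 0 b :=
    (intervalIntegrable_iff_integrableOn_Ioc_of_le hb).2 hint
  set H : ℝ → ℝ := fun s => ∫ r in (0 : ℝ)..s, g r with hH
  have hHeq : ∀ s, 0 ≤ s → H s = (∫⁻ r in Set.Ioc 0 s, ENNReal.ofReal (g r)).toReal := by
    intro s hs
    rw [hH]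
    simp only
    rw [intervalIntegral.integral_of_le hs,
      integral_eq_lintegral_of_nonneg_ae (ae_of_all _ hg0) hg.aestronglyMeasurable]
  have hH0 : H 0 = 0 := by simp [hH]
  have hmono : ∀ s ∈ Set.uIcc 0 b, ∀ t ∈ Set.uIcc 0 b, s ≤ t → H s ≤ H t := by
    intro s hs t ht hst
    rw [Set.uIcc_of_le hb] at hs ht
    have h1 : IntervalIntegrable g volume 0 s := hii.mono_set (by
      rw [Set.uIcc_of_le hs.1, Set.uIcc_of_le hb]; exact Set.Icc_subset_Icc_right hs.2)
    have h2 : IntervalIntegrable g volume s t := hii.mono_set (by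
      rw [Set.uIcc_of_le hst, Set.uIcc_of_le hb]; exact Set.Icc_subset_Icc hs.1 ht.2)
    have := intervalIntegral.integral_add_adjacent_intervals h1 h2
    have h3 := intervalIntegral.integral_nonneg hst (f := g) (μ := volume) fun u _ => hg0 u
    simp only [hH]
    linarith
  have hHpos : ∀ s ∈ Set.uIcc 0 b, 0 ≤ H s := fun s hs => by
    have := hmono 0 Set.left_mem_uIcc s hs (by rw [Set.uIcc_of_le hb] at hs; exact hs.1)
    rwa [hH0] at this
  set f : ℝ → ℝ := fun s => Real.exp (-H s) with hf
  have hHac : AbsolutelyContinuousOnInterval H 0 b :=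
    hii.absolutelyContinuousOnInterval_intervalIntegral Set.left_mem_uIcc
  have key : ∀ x y : ℝ, 0 ≤ x → x ≤ y → |Real.exp (-x) - Real.exp (-y)| ≤ |x - y| := by
    intro x y hx hxy
    rw [abs_of_nonneg (sub_nonneg.2 (Real.exp_le_exp.2 (by linarith))),
      abs_of_nonpos (by linarith)]
    have h1 := Real.add_one_le_exp (x - y)
    have h2 : Real.exp (-y) = Real.exp (-x) * Real.exp (x - y) := by
      rw [← Real.exp_add]; congr 1; ring
    have h3 : Real.exp (-x) ≤ 1 := Real.exp_le_one_iff.2 (by linarith)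
    rw [h2]
    nlinarith [Real.exp_pos (-x)]
  -- The hazard is only integrable, so H is differentiable merely almost everywhere. As x ↦ exp(-x)
  -- is 1-Lipschitz on [0, ∞), absolute continuity passes from H to exp(-H), which justifies the
  -- fundamental theorem of calculus.
  have hfac : AbsolutelyContinuousOnInterval f 0 b := hHac.of_dist_le fun s hs t ht => by
    rw [Real.dist_eq, Real.dist_eq]
    rcases le_total s t with hst | hst
    · exact key _ _ (hHpos s hs) (hmono s hs t ht hst)
    · rw [abs_sub_comm, abs_sub_comm (H s)]
      exact key _ _ (hHpos t ht) (hmono t ht s hs hst)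
  have hFTC := hfac.integral_deriv_eq_sub
  have hderiv : ∀ᵐ x, x ∈ Set.uIcc 0 b → deriv f x = -(g x * Real.exp (-H x)) := by
    filter_upwards [hii.ae_hasDerivAt_integral] with x hx hxI
    have h1 : HasDerivAt H (g x) x := hx hxI 0 Set.left_mem_uIcc
    have h2 : HasDerivAt f (Real.exp (-H x) * -g x) x := h1.neg.exp
    rw [h2.deriv]
    ring
  have hFTC2 : ∫ s in (0 : ℝ)..b, -(g s * Real.exp (-H s)) = f b - f 0 := by
    rw [← hFTC]
    refine intervalIntegral.integral_congr_ae ?_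
    filter_upwards [hderiv] with x hx hxI
    exact (hx (Set.uIoc_subset_uIcc hxI)).symm
  rw [intervalIntegral.integral_neg, intervalIntegral.integral_of_le hb] at hFTC2
  have hcont : ContinuousOn H (Set.Icc 0 b) := by
    have := hHac.continuousOn; rwa [Set.uIcc_of_le hb] at this
  have hint2 : IntegrableOn (fun s => g s * Real.exp (-H s)) (Set.Ioc 0 b) := by
    refine Integrable.mono' hint ?_ ?_
    · refine hg.aestronglyMeasurable.mul (ContinuousOn.aestronglyMeasurable ?_ measurableSet_Ioc)
      exact (hcont.mono Set.Ioc_subset_Icc_self).neg.rexp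
    · filter_upwards [ae_restrict_mem measurableSet_Ioc] with s hs
      have h1 := hHpos s (by rw [Set.uIcc_of_le hb]; exact Set.Ioc_subset_Icc_self hs)
      rw [Real.norm_eq_abs, abs_of_nonneg (mul_nonneg (hg0 s) (Real.exp_pos _).le)]
      exact mul_le_of_le_one_right (hg0 s) (Real.exp_le_one_iff.2 (by linarith))
  have hfin2 : ∫ s in Set.Ioc 0 b, g s * Real.exp (-H s) = 1 - Real.exp (-H b) := by
    have e : f 0 = 1 := by simp [hf, hH0]
    have e2 : f b = Real.exp (-H b) := rfl
    linarith
  rw [← hHeq b hb, ← hfin2, ofReal_integral_eq_lintegral_ofReal hint2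
    (ae_of_all _ fun s => mul_nonneg (hg0 s) (Real.exp_pos _).le)]
  refine setLIntegral_congr_fun measurableSet_Ioc fun s hs => ?_
  rw [← hHeq s hs.1.le, ENNReal.ofReal_mul (hg0 s)]

/-- Two finite measures carried by `I` agree if they agree on the half-lines ending in `I`. -/
theorem measure_eq_of_Iic {μ₁ μ₂ : Measure ℝ} [IsFiniteMeasure μ₁]
    {I : Set ℝ} (hI0 : ∀ s ∈ I, 0 < s) (hIdown : ∀ t ∈ I, ∀ s, 0 < s → s ≤ t → s ∈ I)
    (hIq : ∀ s ∈ I, ∃ q : ℚ, s ≤ q ∧ (q : ℝ) ∈ I) (h1 : μ₁ Iᶜ = 0) (h2 : μ₂ Iᶜ = 0)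
    (h : ∀ b ∈ I, μ₁ (Set.Iic b) = μ₂ (Set.Iic b)) : μ₁ = μ₂ := by
  refine Measure.ext_of_Iic μ₁ μ₂ fun b => ?_
  by_cases hb : b ∈ I
  · exact h b hb
  rcases le_or_gt b 0 with hb0 | hb0
  · have hsub : Set.Iic b ⊆ Iᶜ := fun s hs hsI => absurd (hI0 s hsI) (not_lt.2 (le_trans hs hb0))
    rw [measure_mono_null hsub h1, measure_mono_null hsub h2]
  -- A positive bound outside I lies above all of I, and the half-lines ending at rational points of
  -- I exhaust I.
  set W : {q : ℚ // (q : ℝ) ∈ I} → Set ℝ := fun q => Set.Iic (q.1 : ℝ) with hW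
  have hWdir : Directed (· ⊆ ·) W := by
    intro q r
    rcases le_total q.1 r.1 with hqr | hqr
    · exact ⟨r, Set.Iic_subset_Iic.2 (by exact_mod_cast hqr), subset_rfl⟩
    · exact ⟨q, subset_rfl, Set.Iic_subset_Iic.2 (by exact_mod_cast hqr)⟩
  have hW1 : (⋃ q, W q) ⊆ Set.Iic b := by
    refine Set.iUnion_subset fun q => Set.Iic_subset_Iic.2 ?_
    by_contra hlt
    exact hb (hIdown _ q.2 b hb0 (not_le.1 hlt).le)
  have hW2 : Set.Iic b ⊆ (⋃ q, W q) ∪ Iᶜ := by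
    intro s _
    by_cases hsI : s ∈ I
    · obtain ⟨q, hq, hqI⟩ := hIq s hsI
      exact Or.inl (Set.mem_iUnion.2 ⟨⟨q, hqI⟩, hq⟩)
    · exact Or.inr hsI
  have key : ∀ μ : Measure ℝ, μ Iᶜ = 0 → μ (Set.Iic b) = ⨆ q, μ (W q) := by
    intro μ hμ
    rw [← hWdir.measure_iUnion]
    refine le_antisymm ?_ (measure_mono hW1)
    refine (measure_mono hW2).trans ((measure_union_le _ _).trans ?_)
    rw [hμ, add_zero]
  rw [key μ₁ h1, key μ₂ h2]
  exact iSup_congr fun q => h _ q.2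

theorem measurable_lintegral_Ioc {F : Type*} [MeasurableSpace F] {k : ℝ → F → ℝ≥0∞}
    (hk : Measurable fun q : ℝ × F => k q.1 q.2) :
    Measurable fun q : ℝ × F => ∫⁻ r in Set.Ioc 0 q.1, k r q.2 := by
  have e : (fun q : ℝ × F => ∫⁻ r in Set.Ioc 0 q.1, k r q.2) =
      fun q => ∫⁻ r, ind (0 < r ∧ r ≤ q.1) * k r q.2 := by
    funext q
    rw [← lintegral_indicator measurableSet_Ioc]
    refine lintegral_congr fun r => ?_
    by_cases hr : r ∈ Set.Ioc 0 q.1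
    · rw [Set.indicator_of_mem hr, ind_true (show 0 < r ∧ r ≤ q.1 from hr), one_mul]
    · rw [Set.indicator_of_notMem hr, ind_false (show ¬(0 < r ∧ r ≤ q.1) from hr), zero_mul]
  rw [e]
  refine Measurable.lintegral_prod_right'
    (f := fun q : (ℝ × F) × ℝ => ind (0 < q.2 ∧ q.2 ≤ q.1.1) * k q.2 q.1.2) ?_
  refine (measurable_ind ?_).fun_mul
    (hk.comp (measurable_snd.prodMk (measurable_snd.comp measurable_fst) :
      Measurable fun q : (ℝ × F) × ℝ => (q.2, q.1.2)))
  exact (measurableSet_lt measurable_const measurable_snd).inter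
    (measurableSet_le measurable_snd (by fun_prop))

/-- A right-censored survival time whose survival function, given `π` and the censoring time, has
hazard `l s * w s (π ·)` on `I`. -/
theorem hasIntensity_of_survival {E F : Type*} [MeasurableSpace E] [MeasurableSpace F]
    {P : Measure E} [IsProbabilityMeasure P] {V U : E → ℝ} (hV : Measurable V) (hU : Measurable U)
    {π : E → F} (hπ : Measurable π) {l : ℝ → ℝ} (hl : Measurable l) (hl0 : ∀ s, 0 ≤ l s)
    {w : ℝ → F → ℝ} (hw : Measurable fun q : ℝ × F => w q.1 q.2) (hwpos : ∀ s u, 0 < w s u)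
    {I : Set ℝ} (hIm : MeasurableSet I) (hI0 : ∀ s ∈ I, 0 < s)
    (hIdown : ∀ t ∈ I, ∀ s, 0 < s → s ≤ t → s ∈ I)
    (hIq : ∀ s ∈ I, ∃ q : ℚ, s ≤ q ∧ (q : ℝ) ∈ I)
    (hfin : ∀ t ∈ I, ∀ u, ∫⁻ s in Set.Ioc 0 t, ENNReal.ofReal (l s * w s u) ≠ ⊤)
    (hsurv : ∀ t ∈ I, ∀ B : Set ℝ, MeasurableSet B → ∀ A : Set F, MeasurableSet A →
      P ({e | t < V e} ∩ (U ⁻¹' B ∩ π ⁻¹' A)) = ∫⁻ e in U ⁻¹' B ∩ π ⁻¹' A, ENNReal.ofReal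
        (Real.exp (-(∫⁻ s in Set.Ioc 0 t, ENNReal.ofReal (l s * w s (π e))).toReal)) ∂P)
    (hV0 : ∀ᵐ e ∂P, 0 < V e) (hT : ∀ t, P {e | min (V e) (U e) = t} = 0)
    (hTI : ∀ᵐ e ∂P, min (V e) (U e) ∈ I) :
    HasIntensity P (fun e => min (V e) (U e)) {e | V e ≤ U e} π w
      ((volume.restrict I).withDensity fun s => ENNReal.ofReal (l s)) := by
  set k : ℝ → F → ℝ≥0∞ := fun s u => ENNReal.ofReal (l s * w s u) with hk
  have hkm : Measurable fun q : ℝ × F => k q.1 q.2 :=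
    ((hl.comp measurable_fst).fun_mul hw).ennreal_ofReal
  set S : ℝ → F → ℝ := fun t u => Real.exp (-(∫⁻ s in Set.Ioc 0 t, k s u).toReal) with hS
  have hSm : Measurable fun q : ℝ × F => S q.1 q.2 :=
    Real.measurable_exp.comp (measurable_lintegral_Ioc hkm).ennreal_toReal.neg
  have hS1 : ∀ t u, S t u ≤ 1 := fun t u => Real.exp_le_one_iff.2 (by simp)
  set dens : ℝ × E → ℝ≥0∞ := fun q => k q.1 (π q.2) * ENNReal.ofReal (S q.1 (π q.2)) with hdens
  have hπ2 : Measurable fun q : ℝ × E => (q.1, π q.2) := by fun_prop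
  have hdm : Measurable dens := (hkm.comp hπ2).fun_mul (hSm.comp hπ2).ennreal_ofReal
  have hVI : MeasurableSet (V ⁻¹' I) := hV hIm
  -- μ₁ is the joint law of survival time, censoring time and covariate data on {V ∈ I}; μ₂ gives
  -- the survival time the conditional density hazard times survival. They agree on half-lines
  -- because both assign 1 - S(b) given the other data, and the compensator identity is read off
  -- from μ₁ = μ₂.
  set μ₁ : Measure (ℝ × ℝ × F) := (P.restrict (V ⁻¹' I)).map fun e => (V e, U e, π e) with hμ₁
  set μ₂ : Measure (ℝ × ℝ × F) := (((volume.restrict I).prod P).withDensity dens).map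
    fun q => (q.1, U q.2, π q.2) with hμ₂
  have hm1 : Measurable fun e => (V e, U e, π e) := by fun_prop
  have hm2 : Measurable fun q : ℝ × E => (q.1, U q.2, π q.2) := by fun_prop
  have : IsFiniteMeasure μ₁ := by rw [hμ₁]; infer_instance
  have hμ : μ₁ = μ₂ := by
    refine Measure.ext_prod₃ fun {s B A} hs hB hA => ?_
    set C : Set E := U ⁻¹' B ∩ π ⁻¹' A with hC
    have hCm : MeasurableSet C := (hU hB).inter (hπ hA)
    set ρ₁ : Measure ℝ := ((P.restrict (V ⁻¹' I)).restrict C).map V with hρ₁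
    set ρ₂ : Measure ℝ := ((((volume.restrict I).prod P).withDensity dens).restrict
      (Set.univ ×ˢ C)).map Prod.fst with hρ₂
    have e1 : ∀ s, MeasurableSet s → μ₁ (s ×ˢ B ×ˢ A) = ρ₁ s := by
      intro s hs
      rw [hμ₁, hρ₁, Measure.map_apply hm1 (hs.prod (hB.prod hA)), Measure.map_apply hV hs,
        Measure.restrict_apply (hV hs)]
      rfl
    have e2 : ∀ s, MeasurableSet s → μ₂ (s ×ˢ B ×ˢ A) = ρ₂ s := by
      intro s hs
      rw [hμ₂, hρ₂, Measure.map_apply hm2 (hs.prod (hB.prod hA)),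
        Measure.map_apply measurable_fst hs, Measure.restrict_apply (measurable_fst hs)]
      congr 1
      ext q
      simp [hC]
    rw [e1 s hs, e2 s hs]
    have hfin1 : IsFiniteMeasure ρ₁ := by rw [hρ₁]; infer_instance
    have hρ : ρ₁ = ρ₂ := by
      refine measure_eq_of_Iic hI0 hIdown hIq ?_ ?_ fun b hb => ?_
      · rw [hρ₁, Measure.map_apply hV hIm.compl, Measure.restrict_apply (hV hIm.compl),
          Measure.restrict_apply ((hV hIm.compl).inter hCm)]
        convert measure_empty (μ := P)
        ext e
        simp only [Set.mem_inter_iff, Set.mem_preimage, Set.mem_compl_iff,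
          Set.mem_empty_iff_false, iff_false]
        tauto
      · rw [hρ₂, Measure.map_apply measurable_fst hIm.compl,
          Measure.restrict_apply (measurable_fst hIm.compl)]
        refine measure_mono_null Set.inter_subset_left ?_
        refine withDensity_absolutelyContinuous _ _ ?_
        have : (Prod.fst ⁻¹' Iᶜ : Set (ℝ × E)) = Iᶜ ×ˢ Set.univ := by ext q; simp
        rw [this, Measure.prod_prod]
        simp [Measure.restrict_apply hIm.compl]
      · have hb0 := hI0 b hb
        have hset : Set.Iic b ∩ I = Set.Ioc 0 b := by
          ext r
          exact ⟨fun h => ⟨hI0 r h.2, h.1⟩, fun h => ⟨h.2, hIdown b hb r h.1 h.2⟩⟩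
        have hL : ρ₁ (Set.Iic b) = P C - P ({e | b < V e} ∩ C) := by
          rw [hρ₁, Measure.map_apply hV measurableSet_Iic,
            Measure.restrict_apply (hV measurableSet_Iic),
            Measure.restrict_apply ((hV measurableSet_Iic).inter hCm)]
          rw [← measure_sdiff Set.inter_subset_right
            ((measurableSet_lt measurable_const hV).inter hCm).nullMeasurableSet
            (measure_ne_top _ _)]
          refine measure_congr ?_
          filter_upwards [hV0] with e he
          refine propext ⟨fun h => ⟨h.1.2, fun h' => ?_⟩, fun h => ⟨⟨?_, h.1⟩, ?_⟩⟩
          · exact absurd (show V e ≤ b from h.1.1) (not_le.2 (show b < V e from h'.1))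
          · exact show V e ≤ b from not_lt.1 fun h' => h.2 ⟨h', h.1⟩
          · exact show V e ∈ I from
              hIdown b hb _ he (not_lt.1 fun h' => h.2 ⟨h', h.1⟩)
        have hR : ρ₂ (Set.Iic b) = ∫⁻ e in C, ENNReal.ofReal (1 - S b (π e)) ∂P := by
          rw [hρ₂, Measure.map_apply measurable_fst measurableSet_Iic,
            Measure.restrict_apply (measurable_fst measurableSet_Iic)]
          have hset2 : (Prod.fst ⁻¹' Set.Iic b ∩ Set.univ ×ˢ C : Set (ℝ × E)) =
              Set.Iic b ×ˢ C := by ext q; simp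
          rw [hset2, withDensity_apply _ (measurableSet_Iic.prod hCm),
            ← Measure.prod_restrict, Measure.restrict_restrict measurableSet_Iic, hset,
            lintegral_prod_symm' _ hdm]
          refine setLIntegral_congr_fun hCm fun e _ => ?_
          exact lintegral_hazard_mul_survival (g := fun s => l s * w s (π e))
            (hl.fun_mul (hw.comp (measurable_id.prodMk measurable_const)))
            (fun s => mul_nonneg (hl0 s) (hwpos _ _).le) hb0.le (hfin b hb (π e))
        have hSb : Measurable fun e => ENNReal.ofReal (S b (π e)) :=
          (hSm.comp (measurable_const.prodMk hπ)).ennreal_ofReal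
        rw [hL, hR, hsurv b hb B hB A hA]
        have h1 : ∀ e, ENNReal.ofReal (1 - S b (π e)) = 1 - ENNReal.ofReal (S b (π e)) :=
          fun e => by rw [ENNReal.ofReal_sub _ (Real.exp_pos _).le, ENNReal.ofReal_one]
        simp only [h1]
        have hne : ∫⁻ e in C, ENNReal.ofReal (S b (π e)) ∂P ≠ ⊤ := by
          refine ne_top_of_le_ne_top (measure_ne_top P C) ?_
          calc _ ≤ ∫⁻ _ in C, 1 ∂P := lintegral_mono fun e => by
                rw [← ENNReal.ofReal_one]; exact ENNReal.ofReal_le_ofReal (hS1 _ _)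
            _ = _ := by simp
        rw [lintegral_sub hSb hne (ae_of_all _ fun e => by
          rw [← ENNReal.ofReal_one]; exact ENNReal.ofReal_le_ofReal (hS1 _ _))]
        rw [setLIntegral_const, one_mul]
    rw [hρ]
  have hTm : Measurable fun e => min (V e) (U e) := hV.min hU
  have hDm : MeasurableSet {e | V e ≤ U e} := measurableSet_le hV hU
  refine ⟨hTm, hDm, hπ, hw, hwpos, hT, fun f hf => ?_⟩
  have hΦ : Measurable fun q : ℝ × ℝ × F => ind (q.1 ≤ q.2.1) * f q.1 q.2.2 :=
    (measurable_ind (measurableSet_le measurable_fst (by fun_prop))).fun_mul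
      (hf.comp (measurable_fst.prodMk (measurable_snd.comp measurable_snd)))
  have c1 : ∫⁻ e, ind (e ∈ {e | V e ≤ U e}) * f (min (V e) (U e)) (π e) ∂P =
      ∫⁻ q, ind (q.1 ≤ q.2.1) * f q.1 q.2.2 ∂μ₁ := by
    rw [hμ₁, lintegral_map hΦ hm1, ← lintegral_indicator hVI]
    refine lintegral_congr_ae ?_
    filter_upwards [hTI] with e he
    by_cases hD : V e ≤ U e
    · have : e ∈ V ⁻¹' I := by
        rw [min_eq_left hD] at he; exact he
      rw [Set.indicator_of_mem this, min_eq_left hD]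
    · rw [ind_false hD, zero_mul]
      by_cases he' : e ∈ V ⁻¹' I
      · rw [Set.indicator_of_mem he', ind_false hD, zero_mul]
      · rw [Set.indicator_of_notMem he']
  have mRHS : Measurable fun q : ℝ × E => ind (q.1 ≤ min (V q.2) (U q.2)) *
      (ENNReal.ofReal (w q.1 (π q.2)) * f q.1 (π q.2)) :=
    (measurable_ind (measurableSet_le measurable_fst (hTm.comp measurable_snd))).fun_mul
      ((hw.comp hπ2).ennreal_ofReal.fun_mul (hf.comp hπ2))
  rw [c1, hμ, hμ₂, lintegral_map hΦ hm2]
  have hΦ2 : Measurable fun q : ℝ × E => ind (q.1 ≤ U q.2) * f q.1 (π q.2) := hΦ.comp hm2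
  simp only
  rw [lintegral_withDensity_eq_lintegral_mul _ hdm hΦ2,
    lintegral_prod _ (hdm.mul hΦ2).aemeasurable,
    lintegral_withDensity_eq_lintegral_mul _ hl.ennreal_ofReal mRHS.lintegral_prod_right']
  refine setLIntegral_congr_fun hIm fun s hs => ?_
  simp only [Pi.mul_apply]
  have hg : Measurable fun u : F => k s u * f s u :=
    (hkm.comp (measurable_const.prodMk measurable_id)).fun_mul
      (hf.comp (measurable_const.prodMk measurable_id))
  have hSs : Measurable fun e => ENNReal.ofReal (S s (π e)) :=
    (hSm.comp (measurable_const.prodMk hπ)).ennreal_ofReal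
  have hUs : MeasurableSet (U ⁻¹' Set.Ici s) := hU measurableSet_Ici
  have hVs : MeasurableSet {e | s < V e} := measurableSet_lt measurable_const hV
  -- The survival factor in the density is now traded back for the event {s < V}, jointly with {s ≤
  -- U}: this creates the at-risk indicator.
  have hmeas : (P.restrict ({e | s < V e} ∩ U ⁻¹' Set.Ici s)).map π =
      ((P.restrict (U ⁻¹' Set.Ici s)).withDensity fun e => ENNReal.ofReal (S s (π e))).map π := by
    ext A hA
    rw [Measure.map_apply hπ hA, Measure.map_apply hπ hA, Measure.restrict_apply (hπ hA),
      withDensity_apply _ (hπ hA), Measure.restrict_restrict (hπ hA), Set.inter_comm (π ⁻¹' A),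
      Set.inter_comm (π ⁻¹' A), Set.inter_assoc]
    exact hsurv s hs _ measurableSet_Ici A hA
  have key := congrArg (fun μ : Measure F => ∫⁻ u, k s u * f s u ∂μ) hmeas
  rw [lintegral_map hg hπ, lintegral_map hg hπ,
    lintegral_withDensity_eq_lintegral_mul _ hSs
      (show Measurable fun e => k s (π e) * f s (π e) from hg.comp hπ),
    ← lintegral_indicator hUs, ← lintegral_indicator (hVs.inter hUs)] at key
  rw [← lintegral_const_mul _ (show Measurable fun e => ind (s ≤ min (V e) (U e)) *
    (ENNReal.ofReal (w s (π e)) * f s (π e)) from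
      mRHS.comp (measurable_const.prodMk measurable_id))]
  refine Eq.trans (lintegral_congr fun e => ?_) (key.symm.trans (lintegral_congr_ae ?_))
  · by_cases he : e ∈ U ⁻¹' Set.Ici s
    · rw [Set.indicator_of_mem he, ind_true (show s ≤ U e from he)]
      simp only [hdens, Pi.mul_apply]
      ring
    · rw [Set.indicator_of_notMem he, ind_false (show ¬s ≤ U e from he)]
      simp
  -- The events {s < V, s ≤ U} and {s ≤ T} differ only where T = s, which is null.
  · filter_upwards [compl_mem_ae_iff.2 (hT s)] with e he
    have he : ¬min (V e) (U e) = s := he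
    have hiff : e ∈ {e | s < V e} ∩ U ⁻¹' Set.Ici s ↔ s ≤ min (V e) (U e) := by
      constructor
      · exact fun h => le_min (le_of_lt h.1) h.2
      · intro h
        refine ⟨lt_of_le_of_ne (h.trans (min_le_left _ _)) fun h' => he ?_,
          h.trans (min_le_right _ _)⟩
        have := h.trans (min_le_right _ _)
        rw [← h']
        exact min_eq_left this
    by_cases h : s ≤ min (V e) (U e)
    · rw [Set.indicator_of_mem (hiff.2 h), ind_true h, one_mul]
      simp only [hk]
      rw [ENNReal.ofReal_mul (hl0 s)]
      ring
    · rw [Set.indicator_of_notMem (fun h' => h (hiff.1 h')), ind_false h]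
      simp

end

noncomputable section

universe u

/-! ### Regular versions of the covariate process -/

/-- The extension of a bounded Lipschitz function from the rational points of `S`, truncated at
the level `K`. -/
def clampExt {F : Type*} (S : Set ℝ) (K L : ℝ) (Z : ℝ → F → ℝ) (t : ℝ) (u : F) : ℝ :=
  max (-K) (min K (⨅ q : {q : ℚ // (q : ℝ) ∈ S}, (Z q.1 u + L * |(q.1 : ℝ) - t|)))

theorem measurable_clampExt {F : Type*} [MeasurableSpace F] {S : Set ℝ} (K L : ℝ)
    {Z : ℝ → F → ℝ} (hZ : ∀ t ∈ S, Measurable (Z t)) :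
    Measurable fun q : ℝ × F => clampExt S K L Z q.1 q.2 := by
  refine measurable_const.max (measurable_const.min (Measurable.iInf fun q => ?_))
  exact ((hZ _ q.2).comp measurable_snd).add (by fun_prop)

theorem abs_clampExt_le {F : Type*} (S : Set ℝ) {K : ℝ} (hK : 0 ≤ K) (L : ℝ) (Z : ℝ → F → ℝ)
    (t : ℝ) (u : F) : |clampExt S K L Z t u| ≤ K :=
  abs_le.2 ⟨le_max_left _ _, max_le (by linarith) (min_le_left _ _)⟩

/-- McShane's formula: the Lipschitz bound makes the infimum at least the true value, and nearby
rational points attain it in the limit. Using countably many points is what gives joint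
measurability, while the truncation is invisible on a good path. -/
theorem clampExt_eq {F : Type*} {S : Set ℝ} {K L : ℝ} (hL : 0 < L) {Z : ℝ → F → ℝ} {u : F}
    (hlip : ∀ s ∈ S, ∀ t ∈ S, |Z s u - Z t u| ≤ L * |s - t|)
    (hbd : ∀ q : ℚ, (q : ℝ) ∈ S → |Z q u| ≤ K) {t : ℝ} (ht : t ∈ S)
    (hdense : ∀ ε > 0, ∃ q : ℚ, (q : ℝ) ∈ S ∧ |(q : ℝ) - t| < ε) :
    clampExt S K L Z t u = Z t u := by
  have hlow : ∀ q : {q : ℚ // (q : ℝ) ∈ S}, Z t u ≤ Z q.1 u + L * |(q.1 : ℝ) - t| := fun q => by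
    have := (abs_le.1 (hlip _ q.2 t ht)).1
    linarith
  obtain ⟨q₀, hq₀, -⟩ := hdense 1 one_pos
  have : Nonempty {q : ℚ // (q : ℝ) ∈ S} := ⟨⟨q₀, hq₀⟩⟩
  have hinf : ⨅ q : {q : ℚ // (q : ℝ) ∈ S}, (Z q.1 u + L * |(q.1 : ℝ) - t|) = Z t u := by
    refine le_antisymm (le_of_forall_pos_le_add fun ε hε => ?_) (le_ciInf hlow)
    obtain ⟨q, hq, hqt⟩ := hdense (ε / (2 * L)) (by positivity)
    refine (ciInf_le ⟨Z t u, ?_⟩ ⟨q, hq⟩).trans ?_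
    · rintro _ ⟨q, rfl⟩; exact hlow q
    · have h1 := (abs_le.1 (hlip _ hq t ht)).2
      have h2 : L * |(q : ℝ) - t| ≤ ε / 2 := by
        calc L * |(q : ℝ) - t| ≤ L * (ε / (2 * L)) := by gcongr
          _ = ε / 2 := by field_simp
      simp only
      linarith
  have hK : |Z t u| ≤ K := by
    refine le_of_forall_pos_le_add fun ε hε => ?_
    obtain ⟨q, hq, hqt⟩ := hdense (ε / L) (by positivity)
    have h1 := hlip _ hq t ht
    have h2 : L * |(q : ℝ) - t| ≤ ε := by
      calc L * |(q : ℝ) - t| ≤ L * (ε / L) := by gcongr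
        _ = ε := by field_simp
    have h3 := hbd q hq
    have h4 := abs_sub_abs_le_abs_sub (Z t u) (Z q u)
    rw [abs_sub_comm] at h4
    linarith
  rw [clampExt, hinf, min_eq_right (abs_le.1 hK).2, max_eq_right (abs_le.1 hK).1]

/-- Conditional independence given `G`, as an identity between measures. -/
theorem measure_inter_eq_of_condExp {E : Type*} {G mE : MeasurableSpace E} (hG : G ≤ mE)
    {P : Measure E} [IsProbabilityMeasure P] {A₀ B₀ A : Set E} (hA₀ : MeasurableSet A₀)
    (hB₀ : MeasurableSet B₀) {S : E → ℝ} (hS : StronglyMeasurable[G] S) (hS0 : ∀ e, 0 ≤ S e)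
    (hS1 : ∀ e, S e ≤ 1)
    (h : P[(A₀ ∩ B₀).indicator (fun _ => (1 : ℝ)) | G] =ᵐ[P]
      S * P[B₀.indicator (fun _ => (1 : ℝ)) | G]) (hA : MeasurableSet[G] A) :
    P (A₀ ∩ (B₀ ∩ A)) = ∫⁻ e in B₀ ∩ A, ENNReal.ofReal (S e) ∂P := by
  have hint1 : Integrable ((A₀ ∩ B₀).indicator fun _ => (1 : ℝ)) P :=
    (integrable_const 1).indicator (hA₀.inter hB₀)
  have hint2 : Integrable (B₀.indicator fun _ => (1 : ℝ)) P :=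
    (integrable_const 1).indicator hB₀
  have hSint : Integrable S P := by
    refine Integrable.mono' (integrable_const 1) (hS.mono hG).aestronglyMeasurable
      (ae_of_all _ fun e => ?_)
    rw [Real.norm_eq_abs, abs_of_nonneg (hS0 e)]
    exact hS1 e
  have hmul : S * B₀.indicator (fun _ => (1 : ℝ)) = B₀.indicator S := by
    funext e
    by_cases he : e ∈ B₀ <;> simp [he]
  have hint3 : Integrable (S * B₀.indicator fun _ => (1 : ℝ)) P := by
    rw [hmul]; exact hSint.indicator hB₀
  have hpull := condExp_mul_of_stronglyMeasurable_left hS hint3 hint2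
  have key : ∫ e in A, (A₀ ∩ B₀).indicator (fun _ => (1 : ℝ)) e ∂P =
      ∫ e in A, B₀.indicator S e ∂P := by
    rw [← setIntegral_condExp hG hint1 hA, ← hmul, ← setIntegral_condExp hG hint3 hA]
    exact integral_congr_ae (ae_restrict_of_ae (h.trans hpull.symm))
  rw [setIntegral_indicator (hA₀.inter hB₀), setIntegral_indicator hB₀, setIntegral_const,
    smul_eq_mul, mul_one] at key
  rw [show A₀ ∩ (B₀ ∩ A) = A ∩ (A₀ ∩ B₀) by ac_rfl, Set.inter_comm B₀ A,
    ← ofReal_integral_eq_lintegral_ofReal hSint.integrableOn (ae_of_all _ hS0), ← key,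
    ofReal_measureReal]

namespace CoxModel

variable {p : ℕ} {E : Type*} [MeasurableSpace E] {m : CoxModel p E} {P : Measure E}

theorem zero_le_tPlus (m : CoxModel p E) (P : Measure E) : 0 ≤ m.tPlus P := by
  refine le_sInf ?_
  rintro _ ⟨t, ht, rfl⟩
  exact EReal.coe_nonneg.2 ht.1

theorem exists_rat_mem_timeSet {t : ℝ} (ht : t ∈ m.timeSet P) {ε : ℝ} (hε : 0 < ε) :
    ∃ q : ℚ, (q : ℝ) ∈ m.timeSet P ∧ |(q : ℝ) - t| < ε := by
  rcases ht.1.eq_or_lt with h0 | h0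
  · exact ⟨0, by simpa [h0] using ht, by simpa [← h0] using hε⟩
  · obtain ⟨q, hq1, hq2⟩ := exists_rat_btwn (max_lt h0 (sub_lt_self t hε))
    refine ⟨q, ⟨(le_max_left _ _).trans hq1.le, le_trans ?_ ht.2⟩, ?_⟩
    · exact_mod_cast hq2.le
    · rw [abs_sub_lt_iff]
      have := (le_max_right 0 (t - ε)).trans_lt hq1
      constructor <;> linarith

/-- The interior `(0, t₊)` of the time index set. -/
def openTimeSet (m : CoxModel p E) (P : Measure E) : Set ℝ :=
  {s | 0 < s ∧ (s : EReal) < m.tPlus P}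

theorem openTimeSet_subset : m.openTimeSet P ⊆ m.timeSet P := fun _ hs => ⟨hs.1.le, hs.2.le⟩

theorem measurableSet_openTimeSet : MeasurableSet (m.openTimeSet P) :=
  measurableSet_Ioi.inter (measurable_coe_real_ereal measurableSet_Iio)

theorem measure_obsTime_le_ne_one {t : ℝ} (ht : t ∈ m.openTimeSet P) :
    P {e | m.obsTime e ≤ t} ≠ 1 := fun h =>
  not_le.2 ht.2 (sInf_le ⟨t, ⟨ht.1.le, h⟩, rfl⟩)

theorem IsCox.measurable_obsTime (hm : m.IsCox P) : Measurable m.obsTime :=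
  hm.failureTime_measurable.min hm.censoringTime_measurable

theorem BoundedDensity.measure_obsTime_eq (hd : m.BoundedDensity P) (hm : m.IsCox P) (t : ℝ) :
    P {e | m.obsTime e = t} = 0 := by
  obtain ⟨f, C, -, -, hmap⟩ := hd
  have : P {e | m.obsTime e = t} = P.map m.obsTime {t} := by
    rw [Measure.map_apply hm.measurable_obsTime (measurableSet_singleton t)]
    rfl
  rw [this, hmap]
  exact withDensity_absolutelyContinuous _ _ (measure_singleton t)

/-- The observed time has no atoms, so both endpoints can be dropped. -/
theorem BoundedDensity.ae_mem_openTimeSet [IsProbabilityMeasure P] (hd : m.BoundedDensity P)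
    (hm : m.IsCox P) : ∀ᵐ e ∂P, m.obsTime e ∈ m.openTimeSet P := by
  have hne : ∀ t : ℝ, ∀ᵐ e ∂P, m.obsTime e ≠ t := fun t =>
    compl_mem_ae_iff.2 (hd.measure_obsTime_eq hm t)
  have hle : ∀ᵐ e ∂P, ∀ q : ℚ, m.tPlus P < ((q : ℝ) : EReal) → m.obsTime e ≤ q := by
    refine ae_all_iff.2 fun q => ?_
    by_cases hq : m.tPlus P < ((q : ℝ) : EReal)
    · obtain ⟨_, ⟨t, ht, rfl⟩, htq⟩ := sInf_lt_iff.1 hq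
      have hmeas : MeasurableSet {e | m.obsTime e ≤ t} :=
        measurableSet_le hm.measurable_obsTime measurable_const
      have h1 : ∀ᵐ e ∂P, m.obsTime e ≤ t := (prob_compl_eq_zero_iff hmeas).2 ht.2
      filter_upwards [h1] with e he _
      exact he.trans (EReal.coe_lt_coe_iff.1 htq).le
    · exact ae_of_all _ fun e h => absurd h hq
  -- When `tPlus` is `⊤` its `toReal` is the default 0; nothing is lost, since a real time never
  -- equals `⊤`.
  filter_upwards [hm.failureTime_nonneg, hm.censoringTime_nonneg, hne 0,
    hne (m.tPlus P).toReal, hle] with e h1 h2 h3 h4 h5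
  refine ⟨lt_of_le_of_ne (le_min h1 h2) (Ne.symm h3), ?_⟩
  refine lt_of_le_of_ne (not_lt.1 fun h => ?_) fun h => h4 ?_
  · obtain ⟨q, hq1, hq2⟩ := EReal.lt_iff_exists_rat_btwn.1 h
    exact not_lt.2 (h5 q hq1) (EReal.coe_lt_coe_iff.1 hq2)
  · rw [← h, EReal.toReal_coe]

theorem IsCox.covariateSigma_le (hm : m.IsCox P) : m.covariateSigma P ≤ ‹MeasurableSpace E› :=
  iSup₂_le fun t ht => measurable_iff_comap_le.1 (hm.covariate_measurable t ht)

theorem measurable_covariate_sigma {t : ℝ} (ht : t ∈ m.timeSet P) :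
    Measurable[m.covariateSigma P] (m.covariate t) :=
  measurable_iff_comap_le.2 (le_iSup₂_of_le t ht le_rfl)

theorem IsCox.measure_failureTime_gt [IsProbabilityMeasure P] (hm : m.IsCox P) {t : ℝ}
    (ht : t ∈ m.timeSet P) :
    P.real {e | t < m.failureTime e} = ∫ e, m.condSurvival t e ∂P := by
  have hmeas : MeasurableSet {e | t < m.failureTime e} :=
    measurableSet_lt measurable_const hm.failureTime_measurable
  rw [← integral_congr_ae (hm.hazard t ht), integral_condExp hm.covariateSigma_le,
    integral_indicator_const _ hmeas, smul_eq_mul, mul_one]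

theorem IsCox.failureTime_pos [IsProbabilityMeasure P] (hm : m.IsCox P) :
    ∀ᵐ e ∂P, 0 < m.failureTime e := by
  have h := hm.measure_failureTime_gt (t := 0) ⟨le_rfl, by simpa using m.zero_le_tPlus P⟩
  have h1 : ∀ e, m.condSurvival 0 e = 1 := fun e => by simp [condSurvival, cumHazard]
  simp only [h1, integral_const, probReal_univ, smul_eq_mul, mul_one] at h
  have hmeas : MeasurableSet {e | 0 < m.failureTime e} :=
    measurableSet_lt measurable_const hm.failureTime_measurable
  refine (prob_compl_eq_zero_iff hmeas).2 ?_
  rw [← ofReal_measureReal, h, ENNReal.ofReal_one]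

/-- A version `ζ` of the covariate process, as a function of the data `π`, which is jointly
measurable and bounded, and for which the observed time has the intensity of the Cox model. -/
structure IsRegularVersion (m : CoxModel p E) (P : Measure E) (K : ℝ) {F : Type*}
    [MeasurableSpace F] (π : E → F) (ζ : ℝ → F → Fin p → ℝ) (ν : Measure ℝ) : Prop where
  measurable : ∀ k, Measurable fun q : ℝ × F => ζ q.1 q.2 k
  abs_le : ∀ s u k, |ζ s u k| ≤ K
  sFinite : SFinite ν
  intensity : HasIntensity P m.obsTime {e | m.failureTime e ≤ m.censoringTime e} π
    (fun s u => Real.exp (m.coef ⬝ᵥ ζ s u)) ν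
  covariate_eq : ∀ᵐ e ∂P, ∀ t ∈ m.timeSet P, m.covariate t e = ζ t (π e)
  obsTime_mem : ∀ᵐ e ∂P, 0 ≤ m.obsTime e ∧ m.obsTime e ∈ m.timeSet P

/-- The data space is E itself with the σ-algebra generated by the covariates, and `π` is the
identity. Measurability on this space then means being determined by the covariate process, and
conditional expectations given that σ-algebra become integrals over its sets. -/
theorem IsCox.exists_isRegularVersion {p : ℕ} {E : Type u} [MeasurableSpace E] {m : CoxModel p E}
    {P : Measure E} [IsProbabilityMeasure P] (hm : m.IsCox P) {K : ℝ} (hK : 0 ≤ K)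
    (hb : m.BoundedCovariates P K) (hlip : m.LipschitzCovariates P) (hd : m.BoundedDensity P) :
    ∃ (F : Type u) (_ : MeasurableSpace F) (π : E → F) (ζ : ℝ → F → Fin p → ℝ) (ν : Measure ℝ),
      m.IsRegularVersion P K π ζ ν := by
  obtain ⟨L, hL, hlip⟩ := hlip
  have hG := hm.covariateSigma_le
  set ζ : ℝ → E → Fin p → ℝ := fun t e k =>
    clampExt (m.timeSet P) K L (fun s e => m.covariate s e k) t e with hζ
  have hζm : ∀ k, @Measurable (ℝ × E) ℝ (@Prod.instMeasurableSpace _ _ _ (m.covariateSigma P)) _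
      fun q => ζ q.1 q.2 k := fun k =>
    @measurable_clampExt E (m.covariateSigma P) _ K L (fun s e => m.covariate s e k)
      fun t ht => (measurable_pi_apply k).comp (measurable_covariate_sigma ht)
  have hζb : ∀ s e k, |ζ s e k| ≤ K := fun s e k => abs_clampExt_le _ hK _ _ _ _
  have hζeq : ∀ᵐ e ∂P, ∀ t ∈ m.timeSet P, m.covariate t e = ζ t e := by
    have hbq : ∀ᵐ e ∂P, ∀ q : ℚ, (q : ℝ) ∈ m.timeSet P → ‖m.covariate q e‖ ≤ K := by
      refine ae_all_iff.2 fun q => ?_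
      by_cases hq : (q : ℝ) ∈ m.timeSet P
      · filter_upwards [hb _ hq] with e he _ using he
      · exact ae_of_all _ fun e h => absurd h hq
    filter_upwards [hlip, hbq] with e h1 h2 t ht
    funext k
    refine (clampExt_eq (Z := fun s e => m.covariate s e k) (u := e) hL
      (fun s hs t ht => ?_) (fun q hq => ?_) ht
      fun ε hε => exists_rat_mem_timeSet ht hε).symm
    · exact (norm_le_pi_norm (m.covariate s e - m.covariate t e) k).trans (h1 s hs t ht)
    · exact (norm_le_pi_norm (m.covariate q e) k).trans (h2 q hq)
  have hTI := hd.ae_mem_openTimeSet hm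
  set w : ℝ → E → ℝ := fun s e => Real.exp (m.coef ⬝ᵥ ζ s e) with hw
  have hwm : @Measurable (ℝ × E) ℝ (@Prod.instMeasurableSpace _ _ _ (m.covariateSigma P)) _
      fun q => w q.1 q.2 := by
    refine Real.measurable_exp.comp ?_
    exact Finset.measurable_fun_sum _ fun k _ => (hζm k).const_mul _
  set H : ℝ → E → ℝ≥0∞ := fun t e =>
    ∫⁻ s in Set.Ioc 0 t, ENNReal.ofReal (m.baseline s * w s e) with hH
  have hHm : ∀ t, Measurable[m.covariateSigma P] (H t) := fun t =>
    (@measurable_lintegral_Ioc E (m.covariateSigma P) (fun s e => ENNReal.ofReal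
      (m.baseline s * w s e)) ((hm.baseline_measurable.comp measurable_fst).fun_mul
        hwm).ennreal_ofReal).comp (measurable_const.prodMk measurable_id)
  have hcum : ∀ t ∈ m.timeSet P, ∀ᵐ e ∂P, m.cumHazard t e = H t e := by
    intro t ht
    filter_upwards [hζeq] with e he
    refine setLIntegral_congr_fun measurableSet_Ioc fun s hs => ?_
    simp only [hw]
    rw [he s ⟨hs.1.le, le_trans (by exact_mod_cast hs.2) ht.2⟩]
  set B := K * l1norm m.coef with hB
  have hwle : ∀ s e, w s e ≤ Real.exp B := fun s e =>
    Real.exp_le_exp.2 ((le_abs_self _).trans (abs_dotProduct_le _ _ (hζb s e)))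
  have hwge : ∀ s e, Real.exp (-B) ≤ w s e := fun s e =>
    Real.exp_le_exp.2 (abs_le.1 (abs_dotProduct_le _ _ (hζb s e))).1
  -- The relative risk is bounded below, so an infinite baseline integral before `tPlus` would make
  -- survival at t impossible and force T ≤ t almost surely, against t < `tPlus`.
  have hbase : ∀ t ∈ m.openTimeSet P,
      ∫⁻ s in Set.Ioc 0 t, ENNReal.ofReal (m.baseline s) ≠ ⊤ := by
    intro t ht htop
    have h0 : ∀ᵐ e ∂P, m.condSurvival t e = 0 := by
      filter_upwards [hcum t (openTimeSet_subset ht)] with e he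
      have : H t e = ⊤ := by
        refine top_le_iff.1 ?_
        calc (⊤ : ℝ≥0∞) = ENNReal.ofReal (Real.exp (-B)) *
              ∫⁻ s in Set.Ioc 0 t, ENNReal.ofReal (m.baseline s) := by
              rw [htop, ENNReal.mul_top (by simpa using Real.exp_pos _)]
          _ = ∫⁻ s in Set.Ioc 0 t, ENNReal.ofReal (Real.exp (-B)) *
              ENNReal.ofReal (m.baseline s) :=
              (lintegral_const_mul _ hm.baseline_measurable.ennreal_ofReal).symm
          _ ≤ H t e := lintegral_mono fun s => by
              rw [← ENNReal.ofReal_mul (Real.exp_pos _).le, mul_comm]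
              exact ENNReal.ofReal_le_ofReal
                (mul_le_mul_of_nonneg_left (hwge s e) (hm.baseline_nonneg s))
      rw [condSurvival, he, if_pos this]
    have h1 := hm.measure_failureTime_gt (openTimeSet_subset ht)
    rw [integral_congr_ae h0, integral_zero, measureReal_eq_zero_iff] at h1
    refine measure_obsTime_le_ne_one ht ((prob_compl_eq_zero_iff
      (measurableSet_le hm.measurable_obsTime measurable_const)).1 (measure_mono_null ?_ h1))
    intro e he
    have he : t < m.obsTime e := not_le.1 he
    exact he.trans_le (min_le_left _ _)
  have hfin : ∀ t ∈ m.openTimeSet P, ∀ e, H t e ≠ ⊤ := by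
    intro t ht e
    refine ne_top_of_le_ne_top (ENNReal.mul_ne_top (ENNReal.ofReal_ne_top (r := Real.exp B))
      (hbase t ht)) ?_
    rw [← lintegral_const_mul _ hm.baseline_measurable.ennreal_ofReal]
    refine lintegral_mono fun s => ?_
    rw [← ENNReal.ofReal_mul (Real.exp_pos _).le, mul_comm (Real.exp B)]
    exact ENNReal.ofReal_le_ofReal (mul_le_mul_of_nonneg_left (hwle s e) (hm.baseline_nonneg s))
  have hsurv : ∀ t ∈ m.openTimeSet P, ∀ B : Set ℝ, MeasurableSet B → ∀ A : Set E,
      MeasurableSet[m.covariateSigma P] A →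
      P ({e | t < m.failureTime e} ∩ (m.censoringTime ⁻¹' B ∩ id ⁻¹' A)) =
        ∫⁻ e in m.censoringTime ⁻¹' B ∩ id ⁻¹' A,
          ENNReal.ofReal (Real.exp (-(H t (id e)).toReal)) ∂P := by
    intro t ht B hB A hA
    refine measure_inter_eq_of_condExp hG
      (measurableSet_lt measurable_const hm.failureTime_measurable)
      (hm.censoringTime_measurable hB) (S := fun e => Real.exp (-(H t e).toReal))
      (Measurable.stronglyMeasurable
        (Real.measurable_exp.comp (hHm t).ennreal_toReal.neg)) (fun e => (Real.exp_pos _).le)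
      (fun e => Real.exp_le_one_iff.2 (by simp)) ?_ hA
    refine (hm.condIndep (Set.Ioi t) B measurableSet_Ioi hB).trans ?_
    filter_upwards [hm.hazard t (openTimeSet_subset ht), hcum t (openTimeSet_subset ht)]
      with e h1 h2
    have h3 : m.condSurvival t e = Real.exp (-(H t e).toReal) := by
      rw [condSurvival, h2, if_neg (hfin t ht e)]
    rw [Pi.mul_apply, Pi.mul_apply, ← h3, ← h1]
    rfl
  refine ⟨E, m.covariateSigma P, id, ζ, (volume.restrict (m.openTimeSet P)).withDensity fun s =>
    ENNReal.ofReal (m.baseline s), @IsRegularVersion.mk p E _ m P K E (m.covariateSigma P) id ζ _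
    hζm hζb inferInstance (@hasIntensity_of_survival E E _
    (m.covariateSigma P) P _ _ _ hm.failureTime_measurable hm.censoringTime_measurable id
    (measurable_id'' hG) m.baseline hm.baseline_measurable hm.baseline_nonneg w hwm
    (fun s e => Real.exp_pos _) (m.openTimeSet P) measurableSet_openTimeSet (fun s hs => hs.1)
    (fun t ht s hs hst => ⟨hs, lt_of_le_of_lt (by exact_mod_cast hst) ht.2⟩) ?_ hfin hsurv
    hm.failureTime_pos (hd.measure_obsTime_eq hm) hTI) hζeq ?_⟩
  · intro s hs
    obtain ⟨q, hq1, hq2⟩ := EReal.lt_iff_exists_rat_btwn.1 hs.2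
    have hq1 : s < (q : ℝ) := EReal.coe_lt_coe_iff.1 hq1
    exact ⟨q, hq1.le, hs.1.trans hq1, hq2⟩
  · filter_upwards [hTI] with e he
    exact ⟨he.1.le, openTimeSet_subset he⟩

end CoxModel

end

noncomputable section

/-! ### Averages over the risk sets and their population counterparts -/

/-- The population average of `g` over the individuals at risk at time `s`. -/
def popAvg {X F : Type*} [MeasurableSpace X] (ρ : Measure X) (T : X → ℝ) (π : X → F)
    (w g : ℝ → F → ℝ) (s : ℝ) : ℝ :=
  (∫ a, (ind (s ≤ T a)).toReal * w s (π a) * g s (π a) ∂ρ) /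
    ∫ a, (ind (s ≤ T a)).toReal * w s (π a) ∂ρ

theorem ind_toReal_nonneg (q : Prop) : 0 ≤ (ind q).toReal := ENNReal.toReal_nonneg

theorem ind_toReal_le_one (q : Prop) : (ind q).toReal ≤ 1 :=
  ENNReal.toReal_le_of_le_ofReal zero_le_one (by simpa using ind_le_one q)

section

variable {X F : Type*} [MeasurableSpace X] [MeasurableSpace F] {ρ : Measure X}
  {T : X → ℝ} {D : Set X} {π : X → F} {w g : ℝ → F → ℝ} {ν : Measure ℝ}
  {W : ℝ}

theorem HasIntensity.measurable_ind_le (h : HasIntensity ρ T D π w ν) :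
    Measurable fun q : ℝ × X => (ind (q.1 ≤ T q.2)).toReal :=
  (measurable_ind (measurableSet_le measurable_fst
    (h.measurable_time.comp measurable_snd))).ennreal_toReal

theorem HasIntensity.measurable_comp_proj (h : HasIntensity ρ T D π w ν)
    (hg : Measurable fun q : ℝ × F => g q.1 q.2) : Measurable fun q : ℝ × X => g q.1 (π q.2) :=
  hg.comp (measurable_fst.prodMk (h.measurable_proj.comp measurable_snd))

variable [IsProbabilityMeasure ρ]

theorem HasIntensity.measurable_popAvg (h : HasIntensity ρ T D π w ν)
    (hg : Measurable fun q : ℝ × F => g q.1 q.2) : Measurable (popAvg ρ T π w g) := by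
  have h1 := h.measurable_ind_le.fun_mul (h.measurable_comp_proj h.measurable_weight)
  have h2 := h1.fun_mul (h.measurable_comp_proj hg)
  exact (h2.stronglyMeasurable.integral_prod_right').measurable.div
    (h1.stronglyMeasurable.integral_prod_right').measurable

theorem HasIntensity.integrable_weight_mul (h : HasIntensity ρ T D π w ν)
    (hw : ∀ s u, w s u ≤ W) (hg : Measurable fun q : ℝ × F => g q.1 q.2) {b : ℝ}
    (hgb : ∀ s u, |g s u| ≤ b) (s : ℝ) :
    Integrable (fun a => (ind (s ≤ T a)).toReal * w s (π a) * g s (π a)) ρ := by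
  have h1 := (h.measurable_ind_le.fun_mul (h.measurable_comp_proj h.measurable_weight)).fun_mul
    (h.measurable_comp_proj hg)
  have h2 : Measurable fun a => (ind (s ≤ T a)).toReal * w s (π a) * g s (π a) :=
    h1.comp (measurable_const.prodMk measurable_id)
  refine Integrable.mono' (integrable_const (1 * W * b)) h2.aestronglyMeasurable
    (ae_of_all _ fun a => ?_)
  have hW : 0 ≤ W := (h.weight_pos s (π a)).le.trans (hw _ _)
  rw [norm_mul, norm_mul, Real.norm_eq_abs, Real.norm_eq_abs, Real.norm_eq_abs,
    abs_of_nonneg (ind_toReal_nonneg _), abs_of_pos (h.weight_pos _ _)]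
  exact mul_le_mul (mul_le_mul (ind_toReal_le_one _) (hw _ _) (h.weight_pos _ _).le zero_le_one)
    (hgb _ _) (abs_nonneg _) (by positivity)

theorem HasIntensity.integrable_weight (h : HasIntensity ρ T D π w ν)
    (hw : ∀ s u, w s u ≤ W) (s : ℝ) :
    Integrable (fun a => (ind (s ≤ T a)).toReal * w s (π a)) ρ := by
  simpa using h.integrable_weight_mul hw (g := fun _ _ => 1) measurable_const (b := 1)
    (fun _ _ => by simp) s

theorem HasIntensity.abs_popAvg_le (h : HasIntensity ρ T D π w ν) (hw : ∀ s u, w s u ≤ W)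
    {b : ℝ} (hb : 0 ≤ b) (hgb : ∀ s u, |g s u| ≤ b) (s : ℝ) : |popAvg ρ T π w g s| ≤ b := by
  have h0 : ∀ a, 0 ≤ (ind (s ≤ T a)).toReal * w s (π a) := fun a =>
    mul_nonneg (ind_toReal_nonneg _) (h.weight_pos _ _).le
  have hd : 0 ≤ ∫ a, (ind (s ≤ T a)).toReal * w s (π a) ∂ρ := integral_nonneg h0
  rw [popAvg, abs_div, abs_of_nonneg hd]
  refine div_le_of_le_mul₀ hd hb ?_
  rw [← integral_const_mul, ← Real.norm_eq_abs]
  refine norm_integral_le_of_norm_le ((h.integrable_weight hw s).const_mul b)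
    (ae_of_all _ fun a => ?_)
  rw [norm_mul, Real.norm_eq_abs, Real.norm_eq_abs, abs_of_nonneg (h0 a), mul_comm]
  exact mul_le_mul_of_nonneg_right (hgb _ _) (h0 a)

theorem HasIntensity.integral_weight_mul_eq (h : HasIntensity ρ T D π w ν)
    (hw : ∀ s u, w s u ≤ W) (g : ℝ → F → ℝ) (s : ℝ) :
    ∫ a, (ind (s ≤ T a)).toReal * w s (π a) * g s (π a) ∂ρ =
      popAvg ρ T π w g s * ∫ a, (ind (s ≤ T a)).toReal * w s (π a) ∂ρ := by
  by_cases hd : ∫ a, (ind (s ≤ T a)).toReal * w s (π a) ∂ρ = 0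
  -- The case 0/0: if nobody is at risk almost surely, the numerator vanishes as well.
  · have h0 := (integral_eq_zero_iff_of_nonneg (fun a => mul_nonneg (ind_toReal_nonneg _)
      (h.weight_pos _ _).le) (h.integrable_weight hw s)).1 hd
    rw [hd, mul_zero]
    refine integral_eq_zero_of_ae ?_
    filter_upwards [h0] with a ha
    have ha : (ind (s ≤ T a)).toReal * w s (π a) = 0 := ha
    rw [ha, zero_mul]
    rfl
  · rw [popAvg, div_mul_cancel₀ _ hd]

theorem HasIntensity.integral_centered (h : HasIntensity ρ T D π w ν) (hw : ∀ s u, w s u ≤ W)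
    (hg : Measurable fun q : ℝ × F => g q.1 q.2) {b : ℝ} (hgb : ∀ s u, |g s u| ≤ b) (s : ℝ) :
    ∫ a, (ind (s ≤ T a)).toReal * (w s (π a) * (g s (π a) - popAvg ρ T π w g s)) ∂ρ = 0 := by
  have e : ∀ a, (ind (s ≤ T a)).toReal * (w s (π a) * (g s (π a) - popAvg ρ T π w g s)) =
      (ind (s ≤ T a)).toReal * w s (π a) * g s (π a) -
        popAvg ρ T π w g s * ((ind (s ≤ T a)).toReal * w s (π a)) := fun a => by ring
  simp only [e]
  rw [integral_sub (h.integrable_weight_mul hw hg hgb s) ((h.integrable_weight hw s).const_mul _),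
    integral_const_mul, h.integral_weight_mul_eq hw g s, sub_self]

/-- The deviation is a centred risk sum divided by the total weight. The numerator is of order √L
times the root of the risk count and the denominator is at least the count over W, so the error is
measured by the actual size of the risk set. -/
theorem HasIntensity.measure_exists_riskAvg_gt_le (h : HasIntensity ρ T D π w ν) (hW : 0 < W)
    (hw : ∀ s u, w s u ≤ W) (hw' : ∀ s u, W⁻¹ ≤ w s u)
    (hg : Measurable fun q : ℝ × F => g q.1 q.2) {b : ℝ} (hb : 0 < b)
    (hgb : ∀ s u, |g s u| ≤ b) {L : ℝ} (hL : 1 ≤ L) (n : ℕ) :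
    (Measure.pi fun _ : Fin n => ρ)
      {x | ∃ i, 6 * b * W ^ 2 * √L * (1 / √(riskCount T x i : ℝ)) <
        |riskAvg T π w g (T (x i)) x - popAvg ρ T π w g (T (x i))|} ≤
      2 * (n : ℝ≥0∞) ^ 2 * ENNReal.ofReal (Real.exp (-L)) := by
  have hpm := h.measurable_popAvg hg
  refine (measure_mono ?_).trans (measure_exists_riskSum_gt_le h.measurable_time
    (b := 2 * b * W) (by positivity) hL
    (f := fun s a => w s (π a) * (g s (π a) - popAvg ρ T π w g s))
    ((h.measurable_comp_proj h.measurable_weight).fun_mul ((h.measurable_comp_proj hg).fun_sub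
      (hpm.comp measurable_fst))) (fun s a => ?_) (fun s => h.integral_centered hw hg hgb s) n)
  · rintro x ⟨i, hi⟩
    refine ⟨i, ?_⟩
    set s := T (x i)
    set c := popAvg ρ T π w g s
    set N := (riskCount T x i : ℝ) with hN
    have hNpos : 0 < N := Nat.cast_pos.2 (riskCount_pos T x i)
    set d := ∑ j, (ind (s ≤ T (x j))).toReal * w s (π (x j)) with hd
    have hdN : N * W⁻¹ ≤ d := by
      rw [hN, riskCount_eq_sum, Finset.sum_mul]
      exact Finset.sum_le_sum fun j _ => mul_le_mul_of_nonneg_left (hw' _ _) (ind_toReal_nonneg _)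
    have hdpos : 0 < d := lt_of_lt_of_le (by positivity) hdN
    have e : riskAvg T π w g s x - c =
        (∑ j, (ind (s ≤ T (x j))).toReal * (w s (π (x j)) * (g s (π (x j)) - c))) / d := by
      rw [riskAvg, wavg, eq_div_iff hdpos.ne', sub_mul, div_mul_cancel₀ _ hdpos.ne', hd,
        Finset.mul_sum, ← Finset.sum_sub_distrib]
      exact Finset.sum_congr rfl fun j _ => by ring
    rw [e, abs_div, abs_of_pos hdpos, lt_div_iff₀ hdpos] at hi
    refine lt_of_le_of_lt ?_ hi
    calc 3 * (2 * b * W) * √L * √N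
        = 6 * b * W ^ 2 * √L * (1 / √N) * (N * W⁻¹) := by
          have hs : √N ≠ 0 := (Real.sqrt_pos.2 hNpos).ne'
          field_simp
          rw [Real.sq_sqrt hNpos.le]
          ring
      _ ≤ _ := by gcongr
  · rw [abs_mul, abs_of_pos (h.weight_pos _ _)]
    calc w s (π a) * |g s (π a) - popAvg ρ T π w g s| ≤ W * (b + b) := by
          refine mul_le_mul (hw _ _) ((abs_sub _ _).trans (add_le_add (hgb _ _)
            (h.abs_popAvg_le hw hb.le hgb s))) (abs_nonneg _) hW.le
      _ = _ := by ring

/-- Marked averages agree when their compensators do. -/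
theorem HasIntensity.integral_mark_eq (h : HasIntensity ρ T D π w ν) (hw : ∀ s u, w s u ≤ W)
    {f₁ f₂ : ℝ → F → ℝ} (hf₁ : Measurable fun q : ℝ × F => f₁ q.1 q.2)
    (hf₂ : Measurable fun q : ℝ × F => f₂ q.1 q.2) {b : ℝ} (hb₁ : ∀ s u, |f₁ s u| ≤ b)
    (hb₂ : ∀ s u, |f₂ s u| ≤ b)
    (heq : ∀ s, ∫ a, (ind (s ≤ T a)).toReal * w s (π a) * f₁ s (π a) ∂ρ =
      ∫ a, (ind (s ≤ T a)).toReal * w s (π a) * f₂ s (π a) ∂ρ) :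
    ∫ a, (ind (a ∈ D)).toReal * f₁ (T a) (π a) ∂ρ =
      ∫ a, (ind (a ∈ D)).toReal * f₂ (T a) (π a) ∂ρ := by
  have hindm : Measurable fun a => (ind (a ∈ D)).toReal :=
    (measurable_ind h.measurableSet_mark).ennreal_toReal
  have hT2 : Measurable fun a => (T a, π a) := h.measurable_time.prodMk h.measurable_proj
  -- The compensator identity concerns functions with values in [0, ∞]; adding b makes f
  -- nonnegative, and the marked mass of the constant is subtracted afterwards.
  have key : ∀ f : ℝ → F → ℝ, (Measurable fun q : ℝ × F => f q.1 q.2) →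
      (∀ s u, |f s u| ≤ b) →
      ∫ a, (ind (a ∈ D)).toReal * f (T a) (π a) ∂ρ =
        (∫⁻ s, ENNReal.ofReal ((∫ a, (ind (s ≤ T a)).toReal * w s (π a) * f s (π a) ∂ρ) +
          b * ∫ a, (ind (s ≤ T a)).toReal * w s (π a) ∂ρ) ∂ν).toReal -
          b * ∫ a, (ind (a ∈ D)).toReal ∂ρ := by
    intro f hf hfb
    have hf0 : ∀ s u, 0 ≤ f s u + b := fun s u => by
      have := (abs_le.1 (hfb s u)).1; linarith
    have hfm : Measurable fun a => f (T a) (π a) := hf.comp hT2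
    have hi1 : Integrable (fun a => (ind (a ∈ D)).toReal) ρ :=
      Integrable.mono' (integrable_const 1) hindm.aestronglyMeasurable (ae_of_all _ fun a => by
        rw [Real.norm_eq_abs, abs_of_nonneg (ind_toReal_nonneg _)]; exact ind_toReal_le_one _)
    have hi2 : Integrable (fun a => (ind (a ∈ D)).toReal * f (T a) (π a)) ρ :=
      Integrable.mono' (integrable_const (1 * b)) (hindm.fun_mul hfm).aestronglyMeasurable
        (ae_of_all _ fun a => by
          rw [norm_mul, Real.norm_eq_abs, Real.norm_eq_abs, abs_of_nonneg (ind_toReal_nonneg _)]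
          exact mul_le_mul (ind_toReal_le_one _) (hfb _ _) (abs_nonneg _) zero_le_one)
    have h1 : ∫ a, (ind (a ∈ D)).toReal * (f (T a) (π a) + b) ∂ρ =
        ∫ a, (ind (a ∈ D)).toReal * f (T a) (π a) ∂ρ + b * ∫ a, (ind (a ∈ D)).toReal ∂ρ := by
      rw [← integral_const_mul, ← integral_add hi2 (hi1.const_mul b)]
      exact integral_congr_ae (ae_of_all _ fun a => by simp only; ring)
    have h2 : ∫ a, (ind (a ∈ D)).toReal * (f (T a) (π a) + b) ∂ρ =
        (∫⁻ a, ind (a ∈ D) * ENNReal.ofReal (f (T a) (π a) + b) ∂ρ).toReal := by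
      rw [integral_eq_lintegral_of_nonneg_ae
        (ae_of_all _ fun a => mul_nonneg (ind_toReal_nonneg _) (hf0 _ _))
        (hindm.fun_mul (hfm.add_const b)).aestronglyMeasurable]
      congr 1
      refine lintegral_congr fun a => ?_
      rw [ENNReal.ofReal_mul (ind_toReal_nonneg _),
        ENNReal.ofReal_toReal (ne_top_of_le_ne_top ENNReal.one_ne_top (ind_le_one _))]
    have h3 := h.compensator (fun s u => ENNReal.ofReal (f s u + b))
      (hf.add_const b).ennreal_ofReal
    rw [eq_sub_iff_add_eq, ← h1, h2, h3]
    congr 1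
    refine lintegral_congr fun s => ?_
    rw [← integral_const_mul, ← integral_add (h.integrable_weight_mul hw hf hfb s)
      ((h.integrable_weight hw s).const_mul b), ofReal_integral_eq_lintegral_ofReal
        ((h.integrable_weight_mul hw hf hfb s).fun_add ((h.integrable_weight hw s).const_mul b))]
    · refine lintegral_congr fun a => ?_
      rw [show (ind (s ≤ T a)).toReal * w s (π a) * f s (π a) +
        b * ((ind (s ≤ T a)).toReal * w s (π a)) = (ind (s ≤ T a)).toReal *
          (w s (π a) * (f s (π a) + b)) by ring, ENNReal.ofReal_mul (ind_toReal_nonneg _),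
        ENNReal.ofReal_mul (h.weight_pos _ _).le,
        ENNReal.ofReal_toReal (ne_top_of_le_ne_top ENNReal.one_ne_top (ind_le_one _))]
    · refine ae_of_all _ fun a => ?_
      have : (ind (s ≤ T a)).toReal * w s (π a) * f s (π a) +
        b * ((ind (s ≤ T a)).toReal * w s (π a)) = (ind (s ≤ T a)).toReal * w s (π a) *
          (f s (π a) + b) := by ring
      change 0 ≤ (ind (s ≤ T a)).toReal * w s (π a) * f s (π a) +
        b * ((ind (s ≤ T a)).toReal * w s (π a))
      rw [this]
      exact mul_nonneg (mul_nonneg (ind_toReal_nonneg _) (h.weight_pos _ _).le) (hf0 _ _)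
  rw [key f₁ hf₁ hb₁, key f₂ hf₂ hb₂]
  simp only [heq]

end

end

/-! ### Concentration of the score, of `Vhat` and of the Hessian at the true coefficient -/

noncomputable section

theorem measure_iUnion_le_card_mul {Y ι : Type*} [MeasurableSpace Y] [Fintype ι] {μ : Measure Y}
    {S : ι → Set Y} {c : ℝ≥0∞} (h : ∀ k, μ (S k) ≤ c) : μ (⋃ k, S k) ≤ Fintype.card ι * c := by
  refine (measure_iUnion_fintype_le μ S).trans ((Finset.sum_le_sum fun k _ => h k).trans ?_)
  rw [Finset.sum_const, Finset.card_univ, nsmul_eq_mul]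

theorem bias_add_sampling_error_le {K W L a : ℝ} {n : ℕ} (hW : 1 ≤ W)
    (h : a ≤ 2 * (24 * K ^ 2 * W ^ 2 * √L) / √(n : ℝ) + 8 * K ^ 2 * √(2 * L) / √(n : ℝ)) :
    a ≤ 60 * K ^ 2 * W ^ 2 * √L / √(n : ℝ) := by
  refine h.trans ?_
  rw [← add_div]
  gcongr
  -- The constant 60 is 48 + 8 · 3/2.
  have h1 : √(2 * L) ≤ 3 / 2 * √L := by
    rw [Real.sqrt_mul zero_le_two]
    gcongr
    rw [Real.sqrt_le_left (by norm_num)]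
    norm_num
  have h2 : 1 ≤ W ^ 2 := one_le_pow₀ hW
  calc 2 * (24 * K ^ 2 * W ^ 2 * √L) + 8 * K ^ 2 * √(2 * L)
      ≤ 2 * (24 * K ^ 2 * W ^ 2 * √L) + 8 * K ^ 2 * (3 / 2 * √L) * W ^ 2 := by
        refine add_le_add le_rfl ?_
        calc 8 * K ^ 2 * √(2 * L) ≤ 8 * K ^ 2 * (3 / 2 * √L) := by gcongr
          _ ≤ _ := le_mul_of_one_le_right (by positivity) h2
    _ = _ := by ring

namespace CoxModel

section

variable {p n : ℕ} {E : Type*} {m : CoxModel p E} {x : Fin n → E}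

theorem failInd_eq_ind (e : E) :
    m.failInd e = (ind (e ∈ {e | m.failureTime e ≤ m.censoringTime e})).toReal := by
  unfold failInd
  split_ifs with h
  · rw [ind_true (show e ∈ {e | m.failureTime e ≤ m.censoringTime e} from h)]; rfl
  · rw [ind_false (show e ∉ {e | m.failureTime e ≤ m.censoringTime e} from h)]; rfl

theorem atRisk_eq_ind (t : ℝ) (e : E) : m.atRisk t e = (ind (t ≤ m.obsTime e)).toReal := by
  unfold atRisk
  split_ifs with h
  · rw [ind_true h]; rfl
  · rw [ind_false h]; rfl

/-- Individual errors need not be small for late failures, but the reciprocal roots of the risk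
counts sum to at most 2√n, so on average the error is of order n^{-1/2}. -/
theorem abs_failAvg_sub_le_of_riskCount {f g : Fin n → ℝ} {c : ℝ} (hc : 0 ≤ c)
    (h : ∀ i, |f i - g i| ≤ c * (1 / √(riskCount m.obsTime x i : ℝ))) :
    |m.failAvg x f - m.failAvg x g| ≤ 2 * c / √(n : ℝ) := by
  rw [← failAvg_sub]
  refine (m.abs_failAvg_le_failAvg x _).trans ((m.failAvg_mono x h).trans
    ((m.failAvg_le_avg x fun i => by positivity).trans ?_))
  rw [← Finset.mul_sum]
  have h1 := sum_one_div_sqrt_card_le (fun i => m.obsTime (x i)) (Finset.univ : Finset (Fin n))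
  rw [Finset.card_univ, Fintype.card_fin] at h1
  have h2 : ∑ i, 1 / √(riskCount m.obsTime x i : ℝ) ≤ 2 * √(n : ℝ) := h1
  rcases Nat.eq_zero_or_pos n with rfl | hn
  · simp
  have hn : (0 : ℝ) < n := by exact_mod_cast hn
  calc 1 / (n : ℝ) * (c * ∑ i, 1 / √(riskCount m.obsTime x i : ℝ))
      ≤ 1 / (n : ℝ) * (c * (2 * √(n : ℝ))) := by gcongr
    _ = 2 * c / √(n : ℝ) := by
        rw [eq_div_iff (Real.sqrt_pos.2 hn).ne']
        have := Real.mul_self_sqrt hn.le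
        field_simp
        rw [sq, this, mul_comm]

theorem abs_failAvg_sub_le_of_sum {f : E → ℝ} {a b : ℝ} (hn : 0 < n)
    (h : |∑ i, (m.failInd (x i) * f (x i) - a)| ≤ b * √(n : ℝ)) :
    |m.failAvg x (fun i => f (x i)) - a| ≤ b / √(n : ℝ) := by
  have hn : (0 : ℝ) < n := by exact_mod_cast hn
  have e : m.failAvg x (fun i => f (x i)) - a =
      (∑ i, (m.failInd (x i) * f (x i) - a)) / n := by
    rw [Finset.sum_sub_distrib, Finset.sum_const, Finset.card_univ, Fintype.card_fin,
      nsmul_eq_mul, failAvg]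
    field_simp
  rw [e, abs_div, abs_of_pos hn, div_le_div_iff₀ hn (Real.sqrt_pos.2 hn)]
  calc |∑ i, (m.failInd (x i) * f (x i) - a)| * √(n : ℝ) ≤ b * √(n : ℝ) * √(n : ℝ) := by gcongr
    _ = b * n := by rw [mul_assoc, Real.mul_self_sqrt hn.le]

end

section

variable {p n : ℕ} {E F : Type*} [MeasurableSpace E] (m : CoxModel p E) (P : Measure E)
  (π : E → F) (ζ : ℝ → F → Fin p → ℝ)

/-- The relative risk, as a function of the covariate data. -/
def relRisk (s : ℝ) (u : F) : ℝ := Real.exp (m.coef ⬝ᵥ ζ s u)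

/-- The population average of a function of the covariate data over the individuals at risk. -/
def popMean (g : ℝ → F → ℝ) (s : ℝ) : ℝ := popAvg P m.obsTime π (m.relRisk ζ) g s

/-- The marked covariance kernel around the population averages. -/
def popResidual (k l : Fin p) (s : ℝ) (u : F) : ℝ :=
  (ζ s u k - m.popMean P π ζ (fun s u => ζ s u k) s) *
    (ζ s u l - m.popMean P π ζ (fun s u => ζ s u l) s)

/-- The population covariance of two covariates over the individuals at risk. -/
def popCov (k l : Fin p) (s : ℝ) : ℝ :=
  m.popMean P π ζ (fun s u => ζ s u k * ζ s u l) s -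
    m.popMean P π ζ (fun s u => ζ s u k) s * m.popMean P π ζ (fun s u => ζ s u l) s

/-- The individuals of the sample whose covariates agree with the regular version. -/
def SampleRegular (x : Fin n → E) : Prop :=
  ∀ j, (∀ t ∈ m.timeSet P, m.covariate t (x j) = ζ t (π (x j))) ∧ m.obsTime (x j) ∈ m.timeSet P

variable {m P π ζ} {x : Fin n → E}

theorem SampleRegular.riskCov_eq (h : m.SampleRegular P π ζ x) (i j : Fin n) (k : Fin p) :
    m.riskCov x i k j = ζ (m.obsTime (x i)) (π (x j)) k := by
  rw [riskCov, (h j).1 _ (h i).2]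

theorem SampleRegular.riskWeight_eq (h : m.SampleRegular P π ζ x) (i : Fin n) :
    m.riskWeight x m.coef i = fun j => (ind (m.obsTime (x i) ≤ m.obsTime (x j))).toReal *
      m.relRisk ζ (m.obsTime (x i)) (π (x j)) := by
  funext j
  rw [riskWeight, weight, atRisk_eq_ind, (h j).1 _ (h i).2, relRisk]

theorem SampleRegular.wavg_eq (h : m.SampleRegular P π ζ x) (i : Fin n) (k : Fin p) :
    wavg (m.riskWeight x m.coef i) (m.riskCov x i k) =
      riskAvg m.obsTime π (m.relRisk ζ) (fun s u => ζ s u k) (m.obsTime (x i)) x := by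
  rw [h.riskWeight_eq, riskAvg]
  congr 1
  exact funext fun j => h.riskCov_eq i j k

theorem SampleRegular.wavg_mul_eq (h : m.SampleRegular P π ζ x) (i : Fin n) (k l : Fin p) :
    wavg (m.riskWeight x m.coef i) (fun j => m.riskCov x i k j * m.riskCov x i l j) =
      riskAvg m.obsTime π (m.relRisk ζ) (fun s u => ζ s u k * ζ s u l) (m.obsTime (x i)) x := by
  rw [h.riskWeight_eq, riskAvg]
  congr 1
  exact funext fun j => by rw [h.riskCov_eq i j k, h.riskCov_eq i j l]

theorem SampleRegular.sampleBounded {K : ℝ} (hK : 0 ≤ K) (hζ : ∀ s u k, |ζ s u k| ≤ K)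
    (h : m.SampleRegular P π ζ x) : m.SampleBounded x K := fun i j =>
  (pi_norm_le_iff_of_nonneg hK).2 fun k => by
    have := h.riskCov_eq i j k
    rw [riskCov] at this
    rw [this]
    exact hζ _ _ _

theorem SampleRegular.score_eq_sum (h : m.SampleRegular P π ζ x) (k : Fin p) :
    m.score x m.coef k = (1 / (n : ℝ)) * ∑ i,
      (ind (x i ∈ {e | m.failureTime e ≤ m.censoringTime e})).toReal *
        (ζ (m.obsTime (x i)) (π (x i)) k - riskAvg m.obsTime π (m.relRisk ζ) (fun s u => ζ s u k)
          (m.obsTime (x i)) x) := by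
  rw [score_eq]
  congr 1
  exact Finset.sum_congr rfl fun i _ => by
    rw [h.wavg_eq, h.riskCov_eq, failInd_eq_ind]

end

section

variable {p n : ℕ} {E F : Type*} [MeasurableSpace E] [MeasurableSpace F] {m : CoxModel p E}
  {P : Measure E} {π : E → F} {ζ : ℝ → F → Fin p → ℝ} {ν : Measure ℝ}
  {K W : ℝ}

namespace IsRegularVersion

theorem relRisk_le (h : m.IsRegularVersion P K π ζ ν) (hW : Real.exp (K * l1norm m.coef) ≤ W)
    (s : ℝ) (u : F) : m.relRisk ζ s u ≤ W :=
  (Real.exp_le_exp.2 ((le_abs_self _).trans (abs_dotProduct_le _ _ (h.abs_le s u)))).trans hW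

theorem le_relRisk (h : m.IsRegularVersion P K π ζ ν) (hW : Real.exp (K * l1norm m.coef) ≤ W)
    (s : ℝ) (u : F) : W⁻¹ ≤ m.relRisk ζ s u := by
  have h1 : W⁻¹ ≤ Real.exp (-(K * l1norm m.coef)) := by
    rw [Real.exp_neg]
    exact inv_anti₀ (Real.exp_pos _) hW
  exact h1.trans (Real.exp_le_exp.2 (_root_.abs_le.1 (abs_dotProduct_le _ _ (h.abs_le s u))).1)

theorem hasIntensity (h : m.IsRegularVersion P K π ζ ν) :
    HasIntensity P m.obsTime {e | m.failureTime e ≤ m.censoringTime e} π (m.relRisk ζ) ν :=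
  h.intensity

theorem mu_eq (h : m.IsRegularVersion P K π ζ ν) {s : ℝ} (hs : s ∈ m.timeSet P) (k : Fin p) :
    m.mu P s m.coef k = m.popMean P π ζ (fun s u => ζ s u k) s := by
  rw [mu, popMean, popAvg]
  congr 1
  · refine integral_congr_ae ?_
    filter_upwards [h.covariate_eq] with e he
    rw [weight, atRisk_eq_ind, he s hs, relRisk]
    ring
  · refine integral_congr_ae ?_
    filter_upwards [h.covariate_eq] with e he
    rw [weight, atRisk_eq_ind, he s hs, relRisk]

theorem abs_mul_le (h : m.IsRegularVersion P K π ζ ν) (hK : 0 ≤ K) (k l : Fin p) (s : ℝ) (u : F) :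
    |ζ s u k * ζ s u l| ≤ K ^ 2 := by
  rw [abs_mul, sq]
  exact mul_le_mul (h.abs_le _ _ _) (h.abs_le _ _ _) (abs_nonneg _) hK

theorem Sigma_eq (h : m.IsRegularVersion P K π ζ ν) (k l : Fin p) :
    m.Sigma P k l = ∫ e, m.failInd e * m.popResidual P π ζ k l (m.obsTime e) (π e) ∂P := by
  rw [Sigma, Matrix.of_apply]
  refine integral_congr_ae ?_
  filter_upwards [h.covariate_eq, h.obsTime_mem] with e h1 h2
  rw [popResidual, h1 _ h2.2, h.mu_eq h2.2, h.mu_eq h2.2]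

variable [IsProbabilityMeasure P]

theorem ae_sampleRegular (h : m.IsRegularVersion P K π ζ ν) (n : ℕ) :
    ∀ᵐ x ∂(Measure.pi fun _ : Fin n => P), m.SampleRegular P π ζ x := by
  refine ae_all_iff.2 fun j => ?_
  have := (measurePreserving_eval (fun _ : Fin n => P) j).quasiMeasurePreserving.ae
    (h.covariate_eq.and h.obsTime_mem)
  filter_upwards [this] with x hx
  exact ⟨hx.1, hx.2.2⟩

theorem measurable_popMean (h : m.IsRegularVersion P K π ζ ν) {g : ℝ → F → ℝ}
    (hg : Measurable fun q : ℝ × F => g q.1 q.2) : Measurable (m.popMean P π ζ g) :=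
  h.hasIntensity.measurable_popAvg hg

theorem abs_popMean_le (h : m.IsRegularVersion P K π ζ ν) {g : ℝ → F → ℝ} {b : ℝ} (hb : 0 ≤ b)
    (hgb : ∀ s u, |g s u| ≤ b) (s : ℝ) : |m.popMean P π ζ g s| ≤ b :=
  h.hasIntensity.abs_popAvg_le (h.relRisk_le le_rfl) hb hgb s

theorem measurable_popResidual (h : m.IsRegularVersion P K π ζ ν) (k l : Fin p) :
    Measurable fun q : ℝ × F => m.popResidual P π ζ k l q.1 q.2 :=
  ((h.measurable k).fun_sub ((h.measurable_popMean (h.measurable k)).comp measurable_fst)).fun_mul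
    ((h.measurable l).fun_sub ((h.measurable_popMean (h.measurable l)).comp measurable_fst))

theorem abs_popResidual_le (h : m.IsRegularVersion P K π ζ ν) (hK : 0 ≤ K) (k l : Fin p) (s : ℝ)
    (u : F) : |m.popResidual P π ζ k l s u| ≤ 4 * K ^ 2 := by
  have h1 : ∀ k, |ζ s u k - m.popMean P π ζ (fun s u => ζ s u k) s| ≤ 2 * K := fun k =>
    (abs_sub _ _).trans (by
      linarith [h.abs_le s u k, h.abs_popMean_le hK (fun s u => h.abs_le s u k) s])
  rw [popResidual, abs_mul]
  calc _ ≤ (2 * K) * (2 * K) := mul_le_mul (h1 k) (h1 l) (abs_nonneg _) (by positivity)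
    _ = _ := by ring

theorem measurable_popCov (h : m.IsRegularVersion P K π ζ ν) (k l : Fin p) :
    Measurable (m.popCov P π ζ k l) :=
  (h.measurable_popMean ((h.measurable k).fun_mul (h.measurable l))).sub
    ((h.measurable_popMean (h.measurable k)).mul (h.measurable_popMean (h.measurable l)))

theorem abs_popCov_le (h : m.IsRegularVersion P K π ζ ν) (hK : 0 ≤ K) (k l : Fin p) (s : ℝ) :
    |m.popCov P π ζ k l s| ≤ 4 * K ^ 2 := by
  have h1 := h.abs_popMean_le (by positivity) (h.abs_mul_le hK k l) s
  have h2 : |m.popMean P π ζ (fun s u => ζ s u k) s * m.popMean P π ζ (fun s u => ζ s u l) s| ≤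
      K * K := by
    rw [abs_mul]
    exact mul_le_mul (h.abs_popMean_le hK (fun s u => h.abs_le s u k) s)
      (h.abs_popMean_le hK (fun s u => h.abs_le s u l) s) (abs_nonneg _) hK
  refine (abs_sub _ _).trans ?_
  nlinarith [sq_nonneg K]

/-- The covariance over the risk set is the risk-set mean of the residual product, so the two
integrands have the same compensator. This is why `Vhat` and the negative Hessian estimate the same
matrix. -/
theorem Sigma_eq_integral_popCov (h : m.IsRegularVersion P K π ζ ν) (hK : 0 ≤ K) (k l : Fin p) :
    m.Sigma P k l = ∫ e, m.failInd e * m.popCov P π ζ k l (m.obsTime e) ∂P := by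
  rw [h.Sigma_eq]
  simp only [failInd_eq_ind]
  have hI := h.hasIntensity
  have hw := h.relRisk_le le_rfl
  refine hI.integral_mark_eq hw (h.measurable_popResidual k l)
    (f₂ := fun s _ => m.popCov P π ζ k l s) ((h.measurable_popCov k l).comp measurable_fst)
    (h.abs_popResidual_le hK k l) (fun s _ => h.abs_popCov_le hK k l s) fun s => ?_
  set a := m.popMean P π ζ (fun s u => ζ s u k) s with ha
  set b := m.popMean P π ζ (fun s u => ζ s u l) s with hb
  have i1 := hI.integrable_weight_mul hw ((h.measurable k).fun_mul (h.measurable l))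
    (h.abs_mul_le hK k l) s
  have i2 := hI.integrable_weight_mul hw (h.measurable k) (fun s u => h.abs_le s u k) s
  have i3 := hI.integrable_weight_mul hw (h.measurable l) (fun s u => h.abs_le s u l) s
  have i4 := hI.integrable_weight hw s
  have i5 : Integrable (fun e => (ind (s ≤ m.obsTime e)).toReal * m.relRisk ζ s (π e) *
      (ζ s (π e) k * ζ s (π e) l) - b * ((ind (s ≤ m.obsTime e)).toReal * m.relRisk ζ s (π e) *
        ζ s (π e) k)) P := i1.sub (i2.const_mul b)
  have i6 : Integrable (fun e => (ind (s ≤ m.obsTime e)).toReal * m.relRisk ζ s (π e) *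
      (ζ s (π e) k * ζ s (π e) l) - b * ((ind (s ≤ m.obsTime e)).toReal * m.relRisk ζ s (π e) *
        ζ s (π e) k) - a * ((ind (s ≤ m.obsTime e)).toReal * m.relRisk ζ s (π e) *
          ζ s (π e) l)) P := i5.sub (i3.const_mul a)
  have e1 := hI.integral_weight_mul_eq hw (fun s u => ζ s u k * ζ s u l) s
  have e2 := hI.integral_weight_mul_eq hw (fun s u => ζ s u k) s
  have e3 := hI.integral_weight_mul_eq hw (fun s u => ζ s u l) s
  have e : ∀ e, (ind (s ≤ m.obsTime e)).toReal * m.relRisk ζ s (π e) *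
      m.popResidual P π ζ k l s (π e) =
      (((ind (s ≤ m.obsTime e)).toReal * m.relRisk ζ s (π e) * (ζ s (π e) k * ζ s (π e) l) -
        b * ((ind (s ≤ m.obsTime e)).toReal * m.relRisk ζ s (π e) * ζ s (π e) k)) -
        a * ((ind (s ≤ m.obsTime e)).toReal * m.relRisk ζ s (π e) * ζ s (π e) l)) +
        a * b * ((ind (s ≤ m.obsTime e)).toReal * m.relRisk ζ s (π e)) := fun e => by
    rw [popResidual, ← ha, ← hb]; ring
  simp only [e]
  rw [integral_add i6 (i4.const_mul _),
    integral_sub i5 (i3.const_mul a), integral_sub i1 (i2.const_mul b),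
    integral_const_mul, integral_const_mul, integral_const_mul, integral_mul_const, e1, e2, e3,
    popCov, ← ha, ← hb]
  change m.popMean P π ζ (fun s u => ζ s u k * ζ s u l) s * _ - b * (a * _) - a * (b * _) + _ = _
  ring

variable {x : Fin n → E}

/-- Replacing sample means by population means costs a multiple of 1/√(risk count) for each failure;
what remains is an average of independent bounded terms with mean `Sigma`. -/
theorem abs_Vhat_sub_Sigma_le (h : m.IsRegularVersion P K π ζ ν) (hK : 0 < K) (hW : 1 ≤ W)
    {L : ℝ} (hn : 0 < n) (hx : m.SampleRegular P π ζ x) (k l : Fin p)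
    (h1 : ∀ k i, |riskAvg m.obsTime π (m.relRisk ζ) (fun s u => ζ s u k) (m.obsTime (x i)) x -
      m.popMean P π ζ (fun s u => ζ s u k) (m.obsTime (x i))| ≤
        6 * K * W ^ 2 * √L * (1 / √(riskCount m.obsTime x i : ℝ)))
    (h2 : |∑ i, (m.failInd (x i) * m.popResidual P π ζ k l (m.obsTime (x i)) (π (x i)) -
      m.Sigma P k l)| ≤ 8 * K ^ 2 * √(2 * L) * √(n : ℝ)) :
    |m.Vhat x m.coef k l - m.Sigma P k l| ≤ 60 * K ^ 2 * W ^ 2 * √L / √(n : ℝ) := by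
  have hb := hx.sampleBounded hK.le h.abs_le
  have e1 : |m.Vhat x m.coef k l - m.failAvg x fun i =>
      m.popResidual P π ζ k l (m.obsTime (x i)) (π (x i))| ≤
      2 * (24 * K ^ 2 * W ^ 2 * √L) / √(n : ℝ) := by
    rw [Vhat_apply]
    refine abs_failAvg_sub_le_of_riskCount (by positivity) fun i => ?_
    rw [popResidual]
    have h3 : ∀ k, |(m.riskCov x i k i - wavg (m.riskWeight x m.coef i) (m.riskCov x i k)) -
        (ζ (m.obsTime (x i)) (π (x i)) k - m.popMean P π ζ (fun s u => ζ s u k)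
          (m.obsTime (x i)))| ≤ 6 * K * W ^ 2 * √L * (1 / √(riskCount m.obsTime x i : ℝ)) := by
      intro k
      have := h1 k i
      rw [← hx.wavg_eq] at this
      rw [hx.riskCov_eq, sub_sub_sub_cancel_left, abs_sub_comm]
      exact this
    have h4 : |m.riskCov x i l i - wavg (m.riskWeight x m.coef i) (m.riskCov x i l)| ≤ 2 * K :=
      (abs_sub _ _).trans (by
        linarith [hb.abs_riskCov_le i l i, abs_wavg_le (m.riskWeight_nonneg x m.coef i)
          (m.sum_riskWeight_pos x m.coef i) fun j => hb.abs_riskCov_le i l j])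
    have h5 : |ζ (m.obsTime (x i)) (π (x i)) k - m.popMean P π ζ (fun s u => ζ s u k)
        (m.obsTime (x i))| ≤ 2 * K := (abs_sub _ _).trans (by
      linarith [h.abs_le (m.obsTime (x i)) (π (x i)) k,
        h.abs_popMean_le hK.le (fun s u => h.abs_le s u k) (m.obsTime (x i))])
    exact (abs_mul_sub_mul_le h4 h5 (h3 k) (h3 l)).trans (le_of_eq (by ring))
  have e2 := abs_failAvg_sub_le_of_sum (m := m) (x := x)
    (f := fun e => m.popResidual P π ζ k l (m.obsTime e) (π e)) hn h2
  exact bias_add_sampling_error_le hW ((abs_sub_le _ _ _).trans (add_le_add e1 e2))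

theorem abs_hessian_add_Sigma_le (h : m.IsRegularVersion P K π ζ ν) (hK : 0 < K) (hW : 1 ≤ W)
    {L : ℝ} (hn : 0 < n) (hx : m.SampleRegular P π ζ x) (k l : Fin p)
    (h1 : ∀ k i, |riskAvg m.obsTime π (m.relRisk ζ) (fun s u => ζ s u k) (m.obsTime (x i)) x -
      m.popMean P π ζ (fun s u => ζ s u k) (m.obsTime (x i))| ≤
        6 * K * W ^ 2 * √L * (1 / √(riskCount m.obsTime x i : ℝ)))
    (h1' : ∀ i, |riskAvg m.obsTime π (m.relRisk ζ) (fun s u => ζ s u k * ζ s u l)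
      (m.obsTime (x i)) x - m.popMean P π ζ (fun s u => ζ s u k * ζ s u l) (m.obsTime (x i))| ≤
        6 * K ^ 2 * W ^ 2 * √L * (1 / √(riskCount m.obsTime x i : ℝ)))
    (h2 : |∑ i, (m.failInd (x i) * m.popCov P π ζ k l (m.obsTime (x i)) - m.Sigma P k l)| ≤
      8 * K ^ 2 * √(2 * L) * √(n : ℝ)) :
    |m.hessian x m.coef k l + m.Sigma P k l| ≤ 60 * K ^ 2 * W ^ 2 * √L / √(n : ℝ) := by
  have hb := hx.sampleBounded hK.le h.abs_le
  have e1 : |(m.failAvg x fun i => wcov (m.riskWeight x m.coef i) (m.riskCov x i k)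
      (m.riskCov x i l)) - m.failAvg x fun i => m.popCov P π ζ k l (m.obsTime (x i))| ≤
      2 * (24 * K ^ 2 * W ^ 2 * √L) / √(n : ℝ) := by
    refine abs_failAvg_sub_le_of_riskCount (by positivity) fun i => ?_
    rw [popCov, wcov, hx.wavg_eq, hx.wavg_eq, hx.wavg_mul_eq, sub_sub_sub_comm]
    have h4 : |riskAvg m.obsTime π (m.relRisk ζ) (fun s u => ζ s u l) (m.obsTime (x i)) x| ≤ K := by
      rw [← hx.wavg_eq]
      exact abs_wavg_le (m.riskWeight_nonneg x m.coef i) (m.sum_riskWeight_pos x m.coef i)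
        fun j => hb.abs_riskCov_le i l j
    have h5 := h.abs_popMean_le hK.le (fun s u => h.abs_le s u k) (m.obsTime (x i))
    refine (abs_sub _ _).trans ((add_le_add (h1' i)
      (abs_mul_sub_mul_le h4 h5 (h1 k i) (h1 l i))).trans ?_)
    -- The second moment contributes 6 and the product of means 12; the sum 18 is rounded up to 24
    -- to share the final constant with `Vhat`.
    have : 0 ≤ K ^ 2 * W ^ 2 * √L * (1 / √(riskCount m.obsTime x i : ℝ)) := by positivity
    linarith
  have e2 := abs_failAvg_sub_le_of_sum (m := m) (x := x)
    (f := fun e => m.popCov P π ζ k l (m.obsTime e)) hn h2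
  have e3 : m.hessian x m.coef k l + m.Sigma P k l = -((m.failAvg x fun i =>
      wcov (m.riskWeight x m.coef i) (m.riskCov x i k) (m.riskCov x i l)) - m.Sigma P k l) := by
    rw [hessian_eq, failAvg]; ring
  rw [e3, abs_neg]
  exact bias_add_sampling_error_le hW ((abs_sub_le _ _ _).trans (add_le_add e1 e2))

/-- With high probability the score is small and both estimators of `Sigma` are close to it. -/
theorem measure_deviation_le (h : m.IsRegularVersion P K π ζ ν) (hK : 0 < K)
    (hW : Real.exp (K * l1norm m.coef) ≤ W) {n : ℕ} (hn : 0 < n) {L : ℝ} (hL : 1 ≤ L) :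
    (Measure.pi fun _ : Fin n => P) {x | ¬(m.SampleBounded x K ∧
      (∀ k, |m.score x m.coef k| ≤ 2 * K * √(2 * L) / √(n : ℝ)) ∧
      (∀ k l, |m.Vhat x m.coef k l - m.Sigma P k l| ≤ 60 * K ^ 2 * W ^ 2 * √L / √(n : ℝ)) ∧
      ∀ k l, |m.hessian x m.coef k l + m.Sigma P k l| ≤ 60 * K ^ 2 * W ^ 2 * √L / √(n : ℝ))} ≤
      10 * ((n : ℝ≥0∞) ^ 2 * (p : ℝ≥0∞) ^ 2 * ENNReal.ofReal (Real.exp (-L))) := by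
  have hI := h.hasIntensity
  have hw := h.relRisk_le hW
  have hw' := h.le_relRisk hW
  have hW1 : 1 ≤ W := (Real.one_le_exp (mul_nonneg hK.le (l1norm_nonneg _))).trans hW
  have hW0 : 0 < W := by linarith
  have hL0 : 0 < L := by linarith
  have := h.sFinite
  set Q := Measure.pi fun _ : Fin n => P with hQ
  set e := ENNReal.ofReal (Real.exp (-L)) with he
  set D := {e | m.failureTime e ≤ m.censoringTime e} with hD
  set T := m.obsTime with hT
  have hTm := hI.measurable_time
  have hδm : Measurable m.failInd := by
    have : m.failInd = fun e => (ind (e ∈ D)).toReal := funext failInd_eq_ind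
    rw [this]
    exact (measurable_ind hI.measurableSet_mark).ennreal_toReal
  set N : Set (Fin n → E) := {x | ¬m.SampleRegular P π ζ x}
  set S₁ : Fin p → Set (Fin n → E) := fun k => {x | 2 * K * √(2 * L) * √(n : ℝ) <
    ∑ i, (ind (x i ∈ D)).toReal * (ζ (T (x i)) (π (x i)) k -
      riskAvg T π (m.relRisk ζ) (fun s u => ζ s u k) (T (x i)) x)}
  -- The supermartingale bound is one-sided; the lower tail comes from applying it to -ζ.
  set S₂ : Fin p → Set (Fin n → E) := fun k => {x | 2 * K * √(2 * L) * √(n : ℝ) <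
    ∑ i, (ind (x i ∈ D)).toReal * (-ζ (T (x i)) (π (x i)) k -
      riskAvg T π (m.relRisk ζ) (fun s u => -ζ s u k) (T (x i)) x)}
  set A : Fin p → Set (Fin n → E) := fun k =>
    {x | ∃ i, 6 * K * W ^ 2 * √L * (1 / √(riskCount T x i : ℝ)) <
      |riskAvg T π (m.relRisk ζ) (fun s u => ζ s u k) (T (x i)) x -
        popAvg P T π (m.relRisk ζ) (fun s u => ζ s u k) (T (x i))|}
  set B : Fin p × Fin p → Set (Fin n → E) := fun k =>
    {x | ∃ i, 6 * K ^ 2 * W ^ 2 * √L * (1 / √(riskCount T x i : ℝ)) <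
      |riskAvg T π (m.relRisk ζ) (fun s u => ζ s u k.1 * ζ s u k.2) (T (x i)) x -
        popAvg P T π (m.relRisk ζ) (fun s u => ζ s u k.1 * ζ s u k.2) (T (x i))|}
  set C : Fin p × Fin p → Set (Fin n → E) := fun k => {x | 8 * K ^ 2 * √(2 * L) * √(n : ℝ) <
    |∑ i, (m.failInd (x i) * m.popResidual P π ζ k.1 k.2 (T (x i)) (π (x i)) -
      m.Sigma P k.1 k.2)|}
  set H : Fin p × Fin p → Set (Fin n → E) := fun k => {x | 8 * K ^ 2 * √(2 * L) * √(n : ℝ) <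
    |∑ i, (m.failInd (x i) * m.popCov P π ζ k.1 k.2 (T (x i)) - m.Sigma P k.1 k.2)|}
  have hmark : ∀ f : E → ℝ, Measurable f → ∀ k l, (∀ a, |f a| ≤ 4 * K ^ 2) →
      m.Sigma P k l = ∫ a, m.failInd a * f a ∂P →
      Q {x | 8 * K ^ 2 * √(2 * L) * √(n : ℝ) <
        |∑ i, (m.failInd (x i) * f (x i) - m.Sigma P k l)|} ≤ 2 * e := by
    intro f hf k l hfb hS
    have hb : ∀ a, |m.failInd a * f a| ≤ 4 * K ^ 2 := fun a => by
      rw [abs_mul, abs_of_nonneg (m.failInd_nonneg a)]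
      exact (mul_le_of_le_one_left (abs_nonneg _) (m.failInd_le_one a)).trans (hfb a)
    have hint : Integrable (fun a => m.failInd a * f a) P :=
      Integrable.mono' (integrable_const (4 * K ^ 2)) (hδm.fun_mul hf).aestronglyMeasurable
        (ae_of_all _ hb)
    have hSb : |m.Sigma P k l| ≤ 4 * K ^ 2 := by
      rw [hS, ← Real.norm_eq_abs]
      refine (norm_integral_le_of_norm_le_const (ae_of_all _ hb)).trans (le_of_eq ?_)
      simp
    refine measure_abs_sum_gt_le (b := 8 * K ^ 2) (by positivity) hL0
      (f := fun a => m.failInd a * f a - m.Sigma P k l)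
      ((hδm.fun_mul hf).sub_const _) (fun a => ?_) ?_ hn
    · exact (abs_sub _ _).trans (by linarith [hb a])
    · rw [integral_sub hint (integrable_const _), ← hS]
      simp
  have hTπ : Measurable fun a => (T a, π a) := hTm.prodMk hI.measurable_proj
  have hT0 : ∀ᵐ a ∂P, 0 ≤ T a := h.obsTime_mem.mono fun a ha => ha.1
  have bN : Q N = 0 := h.ae_sampleRegular n
  have bS₁ : ∀ k, Q (S₁ k) ≤ e := fun k =>
    hI.measure_score_gt_le hT0 (h.measurable k) hK hL0 (fun s u => h.abs_le s u k) hn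
  have bS₂ : ∀ k, Q (S₂ k) ≤ e := fun k =>
    hI.measure_score_gt_le hT0 (z := fun s u => -ζ s u k) (h.measurable k).neg hK hL0
      (fun s u => by rw [abs_neg]; exact h.abs_le s u k) hn
  have bA : ∀ k, Q (A k) ≤ 2 * (n : ℝ≥0∞) ^ 2 * e := fun k =>
    hI.measure_exists_riskAvg_gt_le hW0 hw hw' (h.measurable k) hK (fun s u => h.abs_le s u k) hL n
  have bB : ∀ k, Q (B k) ≤ 2 * (n : ℝ≥0∞) ^ 2 * e := fun k =>
    hI.measure_exists_riskAvg_gt_le hW0 hw hw' ((h.measurable k.1).fun_mul (h.measurable k.2))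
      (by positivity) (h.abs_mul_le hK.le k.1 k.2) hL n
  have bC : ∀ k, Q (C k) ≤ 2 * e := fun k =>
    hmark _ ((h.measurable_popResidual k.1 k.2).comp hTπ) k.1 k.2
      (fun a => h.abs_popResidual_le hK.le _ _ _ _) (h.Sigma_eq _ _)
  have bH : ∀ k, Q (H k) ≤ 2 * e := fun k =>
    hmark _ ((h.measurable_popCov k.1 k.2).comp hTm) k.1 k.2
      (fun a => h.abs_popCov_le hK.le _ _ _) (h.Sigma_eq_integral_popCov hK.le _ _)
  have hsub : {x | ¬(m.SampleBounded x K ∧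
      (∀ k, |m.score x m.coef k| ≤ 2 * K * √(2 * L) / √(n : ℝ)) ∧
      (∀ k l, |m.Vhat x m.coef k l - m.Sigma P k l| ≤ 60 * K ^ 2 * W ^ 2 * √L / √(n : ℝ)) ∧
      ∀ k l, |m.hessian x m.coef k l + m.Sigma P k l| ≤ 60 * K ^ 2 * W ^ 2 * √L / √(n : ℝ))} ⊆
      N ∪ ((⋃ k, S₁ k) ∪ ((⋃ k, S₂ k) ∪ ((⋃ k, A k) ∪ ((⋃ k, B k) ∪ ((⋃ k, C k) ∪
        ⋃ k, H k))))) := by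
    intro x hx
    by_contra hc
    simp only [Set.mem_union, Set.mem_iUnion, not_or, not_exists] at hc
    obtain ⟨c0, c1, c2, c3, c4, c5, c6⟩ := hc
    have c0 : m.SampleRegular P π ζ x := not_not.1 c0
    have d3 : ∀ k i, |riskAvg T π (m.relRisk ζ) (fun s u => ζ s u k) (T (x i)) x -
        m.popMean P π ζ (fun s u => ζ s u k) (T (x i))| ≤
        6 * K * W ^ 2 * √L * (1 / √(riskCount T x i : ℝ)) := fun k i =>
      not_lt.1 fun hlt => c3 k ⟨i, hlt⟩
    have d4 : ∀ k l i, |riskAvg T π (m.relRisk ζ) (fun s u => ζ s u k * ζ s u l) (T (x i)) x -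
        m.popMean P π ζ (fun s u => ζ s u k * ζ s u l) (T (x i))| ≤
        6 * K ^ 2 * W ^ 2 * √L * (1 / √(riskCount T x i : ℝ)) := fun k l i =>
      not_lt.1 fun hlt => c4 (k, l) ⟨i, hlt⟩
    refine hx ⟨c0.sampleBounded hK.le h.abs_le, fun k => ?_,
      fun k l => h.abs_Vhat_sub_Sigma_le hK hW1 hn c0 k l d3 (not_lt.1 fun hlt => c5 (k, l) hlt),
      fun k l => h.abs_hessian_add_Sigma_le hK hW1 hn c0 k l d3 (d4 k l)
        (not_lt.1 fun hlt => c6 (k, l) hlt)⟩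
    have hn' : (0 : ℝ) < n := by exact_mod_cast hn
    have d1 := not_lt.1 (show ¬2 * K * √(2 * L) * √(n : ℝ) < _ from c1 k)
    have d2 := not_lt.1 (show ¬2 * K * √(2 * L) * √(n : ℝ) < _ from c2 k)
    have e2 : ∀ i, riskAvg T π (m.relRisk ζ) (fun s u => -ζ s u k) (T (x i)) x =
        -riskAvg T π (m.relRisk ζ) (fun s u => ζ s u k) (T (x i)) x := fun i => by
      simp only [riskAvg, wavg, mul_neg, Finset.sum_neg_distrib, neg_div]
    simp only [e2, ← neg_sub', mul_neg, Finset.sum_neg_distrib] at d2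
    rw [c0.score_eq_sum, abs_mul, abs_of_pos (by positivity : 0 < 1 / (n : ℝ)),
      le_div_iff₀ (Real.sqrt_pos.2 hn')]
    have d := abs_le'.2 ⟨d1, d2⟩
    calc _ ≤ 1 / (n : ℝ) * (2 * K * √(2 * L) * √(n : ℝ)) * √(n : ℝ) := by gcongr
      _ = 2 * K * √(2 * L) * (√(n : ℝ) * √(n : ℝ) / n) := by ring
      _ = _ := by rw [Real.mul_self_sqrt hn'.le, div_self hn'.ne', mul_one]
  set M := (n : ℝ≥0∞) ^ 2 * (p : ℝ≥0∞) ^ 2 with hM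
  have hn1 : 1 ≤ n ^ 2 := Nat.one_le_pow _ _ hn
  have q1 : (p : ℝ≥0∞) ≤ M := by
    have : p ≤ n ^ 2 * p ^ 2 := (Nat.le_self_pow two_ne_zero p).trans (Nat.le_mul_of_pos_left _ hn1)
    rw [hM]; exact_mod_cast this
  have q2 : (p : ℝ≥0∞) * (n : ℝ≥0∞) ^ 2 ≤ M := by
    have : p * n ^ 2 ≤ n ^ 2 * p ^ 2 := by
      rw [mul_comm]; exact Nat.mul_le_mul_left _ (Nat.le_self_pow two_ne_zero p)
    rw [hM]; exact_mod_cast this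
  have q3 : ((p * p : ℕ) : ℝ≥0∞) ≤ M := by
    have : p * p ≤ n ^ 2 * p ^ 2 := by
      rw [← sq]; exact Nat.le_mul_of_pos_left _ hn1
    rw [hM]; exact_mod_cast this
  have q4 : ((p * p : ℕ) : ℝ≥0∞) * (n : ℝ≥0∞) ^ 2 ≤ M := by
    rw [hM]; push_cast; rw [← sq, mul_comm]
  have t1 := measure_iUnion_le_card_mul bS₁
  have t2 := measure_iUnion_le_card_mul bS₂
  have t3 := measure_iUnion_le_card_mul bA
  have t4 := measure_iUnion_le_card_mul bB
  have t5 := measure_iUnion_le_card_mul bC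
  have t6 := measure_iUnion_le_card_mul bH
  simp only [Fintype.card_prod, Fintype.card_fin] at t1 t2 t3 t4 t5 t6
  have u1 : (p : ℝ≥0∞) * e ≤ M * e := by gcongr
  have u3 : (p : ℝ≥0∞) * (2 * (n : ℝ≥0∞) ^ 2 * e) ≤ 2 * (M * e) := by
    calc _ = 2 * ((p : ℝ≥0∞) * (n : ℝ≥0∞) ^ 2 * e) := by ring
      _ ≤ _ := by gcongr
  have u4 : ((p * p : ℕ) : ℝ≥0∞) * (2 * (n : ℝ≥0∞) ^ 2 * e) ≤ 2 * (M * e) := by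
    calc _ = 2 * (((p * p : ℕ) : ℝ≥0∞) * (n : ℝ≥0∞) ^ 2 * e) := by ring
      _ ≤ _ := by gcongr
  have u5 : ((p * p : ℕ) : ℝ≥0∞) * (2 * e) ≤ 2 * (M * e) := by
    calc _ = 2 * (((p * p : ℕ) : ℝ≥0∞) * e) := by ring
      _ ≤ _ := by gcongr
  refine (measure_mono hsub).trans ?_
  calc _ ≤ Q N + (Q (⋃ k, S₁ k) + (Q (⋃ k, S₂ k) + (Q (⋃ k, A k) + (Q (⋃ k, B k) +
        (Q (⋃ k, C k) + Q (⋃ k, H k)))))) := by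
        iterate 6 refine (measure_union_le _ _).trans (add_le_add le_rfl ?_)
        exact le_rfl
    _ ≤ 0 + (M * e + (M * e + (2 * (M * e) + (2 * (M * e) + (2 * (M * e) + 2 * (M * e)))))) := by
        rw [bN]
        exact add_le_add le_rfl (add_le_add (t1.trans u1) (add_le_add (t2.trans u1)
          (add_le_add (t3.trans u3) (add_le_add (t4.trans u4) (add_le_add (t5.trans u5)
            (t6.trans u5))))))
    _ = 10 * (M * e) := by ring

end IsRegularVersion

end

end CoxModel

end

noncomputable section

/-! ### The error of the debiased estimator on a fixed sample -/

/-- A diagonal entry of S S⁻¹ equals 1, so the inverse of a matrix with bounded entries cannot be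
small. This lets the squared norm in the sparsity assumption absorb a first power. -/
theorem one_le_mul_opNormOne_inv {p : ℕ} {S : Matrix (Fin p) (Fin p) ℝ} (hS : IsUnit S.det)
    (j : Fin p) {a : ℝ} (ha : ∀ k l, |S k l| ≤ a) : 1 ≤ a * opNormOne S⁻¹ := by
  have h1 : (S * S⁻¹) j j = 1 := by rw [Matrix.mul_nonsing_inv _ hS, Matrix.one_apply_eq]
  have ha0 : 0 ≤ a := (abs_nonneg _).trans (ha j j)
  rw [Matrix.mul_apply] at h1
  calc (1 : ℝ) = |∑ k, S j k * S⁻¹ k j| := by rw [h1, abs_one]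
    _ ≤ ∑ k, a * |S⁻¹ k j| := (Finset.abs_sum_le_sum_abs _ _).trans (Finset.sum_le_sum fun k _ => by
        rw [abs_mul]; exact mul_le_mul_of_nonneg_right (ha j k) (abs_nonneg _))
    _ ≤ a * opNormOne S⁻¹ := by
        rw [← Finset.mul_sum]
        exact mul_le_mul_of_nonneg_left (sum_abs_col_le_opNormOne _ j) ha0

theorem one_le_maxColSupport_inv {p : ℕ} {S : Matrix (Fin p) (Fin p) ℝ} (hS : IsUnit S.det)
    (j : Fin p) : 1 ≤ maxColSupport S⁻¹ := by
  have h1 : (S * S⁻¹) j j = 1 := by rw [Matrix.mul_nonsing_inv _ hS, Matrix.one_apply_eq]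
  rw [Matrix.mul_apply] at h1
  obtain ⟨k, -, hk⟩ := Finset.exists_ne_zero_of_sum_ne_zero (h1.trans_ne one_ne_zero)
  refine le_trans ?_ (Finset.le_sup (f := fun j => (Finset.univ.filter fun i => S⁻¹ i j ≠ 0).card)
    (Finset.mem_univ j))
  exact Finset.card_pos.2 ⟨k, Finset.mem_filter.2 ⟨Finset.mem_univ _, right_ne_zero_of_mul hk⟩⟩

namespace CoxModel

variable {p n : ℕ} {E : Type*} {m : CoxModel p E} {x : Fin n → E} {K : ℝ}

theorem sq_sum_support_le_of_kappa {C : ℝ≥0} (hC : 0 < C) (h : (m.kappa x)⁻¹ ≤ C)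
    {v : Fin p → ℝ} (hv : v ≠ 0)
    (hcone : ∑ j ∈ m.supportᶜ, |v j| ≤ 2 * ∑ j ∈ m.support, |v j|) :
    (∑ j ∈ m.support, |v j|) ^ 2 ≤
      (C : ℝ) ^ 2 * m.sparsity * (v ⬝ᵥ (-m.hessian x m.coef) *ᵥ v) := by
  set s := ∑ j ∈ m.support, |v j| with hs
  set q := v ⬝ᵥ (-m.hessian x m.coef) *ᵥ v with hq
  have h1 : (C : ℝ≥0∞)⁻¹ ≤ ENNReal.ofReal (√(m.sparsity : ℝ) * √q / s) := by
    rw [ENNReal.inv_le_iff_inv_le]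
    exact (ENNReal.inv_le_inv.2 (iInf₂_le v ⟨hv, hcone⟩)).trans h
  have hC' : (0 : ℝ) < C := hC
  have h2 : (C : ℝ)⁻¹ ≤ √(m.sparsity : ℝ) * √q / s := by
    have e : (C : ℝ≥0∞)⁻¹ = ENNReal.ofReal (C : ℝ)⁻¹ := by
      rw [ENNReal.ofReal_inv_of_pos hC', ENNReal.ofReal_coe_nnreal]
    rw [e] at h1
    by_contra hlt
    exact absurd h1 (not_le.2 ((ENNReal.ofReal_lt_ofReal_iff (by positivity)).2 (not_le.1 hlt)))
  have hs0 : 0 ≤ s := Finset.sum_nonneg fun _ _ => abs_nonneg _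
  -- Division by zero would make the ratio 0, below the positive lower bound 1/C; the same bound
  -- excludes q ≤ 0, where the real square root vanishes.
  have hspos : 0 < s := lt_of_le_of_ne hs0 fun h0 => by
    rw [← h0, div_zero] at h2
    exact absurd h2 (not_le.2 (by positivity))
  have h3 : s ≤ C * (√(m.sparsity : ℝ) * √q) := by
    rw [le_div_iff₀ hspos, inv_mul_le_iff₀ hC'] at h2
    exact h2
  have hqpos : 0 < q := by
    by_contra h0
    rw [Real.sqrt_eq_zero_of_nonpos (not_lt.1 h0), mul_zero, mul_zero] at h3
    linarith
  calc s ^ 2 ≤ (C * (√(m.sparsity : ℝ) * √q)) ^ 2 := pow_le_pow_left₀ hs0 h3 2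
    _ = C ^ 2 * m.sparsity * q := by
        rw [mul_pow, mul_pow, Real.sq_sqrt (Nat.cast_nonneg _), Real.sq_sqrt hqpos.le]
        ring

/-- The error of the debiased estimator in terms of the rates `r` of the score and of the
estimators of `S`, and `γ` of the tuning parameter of the CLIME estimator. -/
theorem SampleBounded.debias_error_le (h : m.SampleBounded x K) (hK : 0 < K)
    {lam lamN r γ q C₁ c₁ c₂ c₃ : ℝ} {C : ℝ≥0} (hC : 0 < C) (hlam : 0 < lam)
    (hlam2 : lam ≤ c₂ * r) (hr : 0 ≤ r) (hC₁ : 0 ≤ C₁) (hc₂ : 0 ≤ c₂)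
    {b : Fin p → ℝ} (hb : m.IsLasso x lam b) (hz : ∀ j, |m.score x m.coef j| ≤ lam / 3)
    (hκ : (m.kappa x)⁻¹ ≤ C) (hsmall : 40 * K * (C : ℝ) ^ 2 * (m.sparsity * (c₂ * r)) < 1)
    {S Th : Matrix (Fin p) (Fin p) ℝ} (hS : S.IsSymm) (hdet : IsUnit S.det)
    (hTh : IsClime (m.Vhat x b) lamN Th) {bt : Fin p → Fin p → ℝ}
    (hbt : m.IsTaylorPoints x b bt)
    (hV : ∀ k l, |m.Vhat x m.coef k l - S k l| ≤ C₁ * r)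
    (hH : ∀ k l, |m.hessian x m.coef k l + S k l| ≤ C₁ * r)
    (hγ : m.sparsity * (q * r) ≤ γ) (hγ0 : 0 ≤ γ)
    (hq : (C₁ + 640 * K ^ 3 * (C : ℝ) ^ 2 * c₂) * c₁ ≤ q)
    (hq0 : 0 < q) (hlamN : 0 < lamN) (hlamN1 : opNormOne S⁻¹ * γ ≤ c₁ * lamN)
    (hlamN2 : lamN ≤ c₃ * (opNormOne S⁻¹ * γ)) (hc₃ : 0 ≤ c₃)
    {c : Fin p → ℝ} (hc : l1norm c = 1) :
    |c ⬝ᵥ ((Th * m.rowHessian x bt + 1) *ᵥ (b - m.coef))| ≤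
      16 * c₂ * c₃ * (opNormOne S⁻¹ ^ 2 * γ * maxColSupport S⁻¹ * r) +
        (20 * C₁ * (C : ℝ) ^ 2 * c₂ + 315 * K * (C : ℝ) ^ 2 * c₂ ^ 2) *
          (opNormOne S⁻¹ * (m.sparsity * r * r)) := by
  have ho := opNormOne_nonneg S⁻¹
  set o := opNormOne S⁻¹ with hoo
  set d : ℝ := (m.sparsity : ℝ) with hd
  have hd0 : 0 ≤ d := Nat.cast_nonneg _
  set s : ℝ := (maxColSupport S⁻¹ : ℝ) with hs
  have hs0 : 0 ≤ s := Nat.cast_nonneg _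
  have hdl : d * lam ≤ d * (c₂ * r) := mul_le_mul_of_nonneg_left hlam2 hd0
  have hsm : 2 * K * (20 * ((C : ℝ) ^ 2 * d * lam)) < 1 := by
    refine lt_of_le_of_lt ?_ hsmall
    calc 2 * K * (20 * ((C : ℝ) ^ 2 * d * lam)) = 40 * K * (C : ℝ) ^ 2 * (d * lam) := by ring
      _ ≤ _ := by gcongr
  have hbD : m.IsLasso x lam (m.coef + (b - m.coef)) := by rwa [add_sub_cancel]
  obtain ⟨hl1, hl2⟩ := h.lasso_bound hK hlam hbD hz
    (fun v hv hcone => sq_sum_support_le_of_kappa hC hκ hv hcone) (by positivity) hsm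
  set D := b - m.coef with hD
  have hl1n := l1norm_nonneg D
  -- Without relevant covariates the Lasso bound forces D = 0. Otherwise d ≥ 1, so the sampling
  -- error C₁r is at most C₁dr and can be merged with the error from `betaHat`.
  rcases Nat.eq_zero_or_pos m.sparsity with h0 | hpos
  · have hd00 : d = 0 := by rw [hd, h0, Nat.cast_zero]
    rw [← hd, hd00, mul_zero, zero_mul, mul_zero] at hl1
    have hD0 : D = 0 := by
      funext k
      have h1 := (Finset.sum_eq_zero_iff_of_nonneg fun _ _ => abs_nonneg _).1
        (le_antisymm hl1 hl1n) k (Finset.mem_univ k)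
      exact abs_eq_zero.1 h1
    rw [hD0, Matrix.mulVec_zero, dotProduct_zero, abs_zero]
    positivity
  have hd1 : 1 ≤ d := Nat.one_le_cast.2 hpos
  have hl1' : l1norm D ≤ 20 * (C : ℝ) ^ 2 * c₂ * (d * r) := by
    calc l1norm D ≤ 20 * ((C : ℝ) ^ 2 * d * lam) := hl1
      _ = 20 * (C : ℝ) ^ 2 * (d * lam) := by ring
      _ ≤ 20 * (C : ℝ) ^ 2 * (d * (c₂ * r)) := by gcongr
      _ = _ := by ring
  have hl2' : D ⬝ᵥ (-m.hessian x m.coef) *ᵥ D ≤ 45 * (C : ℝ) ^ 2 * c₂ ^ 2 * (d * r * r) := by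
    calc _ ≤ 45 * ((C : ℝ) ^ 2 * d * lam ^ 2) := hl2
      _ ≤ 45 * ((C : ℝ) ^ 2 * d * (c₂ * r) ^ 2) := by gcongr
      _ = _ := by ring
  -- The error of `Vhat` at `betaHat` is of order dr, whereas γ dominates dqr. The spare factor q
  -- absorbs the constants A and c₁, so the row is feasible without any lower bound on the constant
  -- in λ_n.
  have hfeas : (C₁ * r + 32 * K ^ 3 * l1norm D) * o ≤ lamN := by
    set A := C₁ + 640 * K ^ 3 * (C : ℝ) ^ 2 * c₂ with hA
    have hA0 : 0 ≤ A := by positivity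
    have h1 : C₁ * r + 32 * K ^ 3 * l1norm D ≤ A * (d * r) := by
      calc C₁ * r + 32 * K ^ 3 * l1norm D
          ≤ C₁ * (d * r) + 32 * K ^ 3 * (20 * (C : ℝ) ^ 2 * c₂ * (d * r)) := by
            gcongr
            exact le_mul_of_one_le_left hr hd1
        _ = _ := by rw [hA]; ring
    have h2 : q * (A * (d * r) * o) ≤ q * lamN := by
      calc q * (A * (d * r) * o) = A * (o * (d * (q * r))) := by ring
        _ ≤ A * (o * γ) := by gcongr
        _ ≤ A * (c₁ * lamN) := by gcongr
        _ = A * c₁ * lamN := by ring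
        _ ≤ q * lamN := by gcongr
    exact (mul_le_mul_of_nonneg_right h1 ho).trans (le_of_mul_le_mul_left h2 hq0)
  refine (CoxModel.debias_error_bound h hK.le hlam.le hb hz hS hdet hTh hbt ?_
    (by positivity) hV hH hfeas hc).trans ?_
  · calc 2 * K * l1norm (b - m.coef) ≤ 2 * K * (20 * ((C : ℝ) ^ 2 * d * lam)) := by gcongr
      _ ≤ 1 := hsm.le
  · refine add_le_add ?_ ?_
    · calc 16 * (s * o * lamN * lam) ≤ 16 * (s * o * (c₃ * (o * γ)) * (c₂ * r)) := by gcongr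
        _ = _ := by ring
    · calc o * (C₁ * r * l1norm D + 7 * K * (D ⬝ᵥ (-m.hessian x m.coef) *ᵥ D))
          ≤ o * (C₁ * r * (20 * (C : ℝ) ^ 2 * c₂ * (d * r)) +
            7 * K * (45 * (C : ℝ) ^ 2 * c₂ ^ 2 * (d * r * r))) := by gcongr
        _ = _ := by ring

end CoxModel

/-! ### Samples of independent copies -/

section

universe u

variable {p n : ℕ} {E : Type u} {Ω : Type*} [MeasurableSpace E] [MeasurableSpace Ω]
  {Q : Measure Ω} {P : Measure E} [IsProbabilityMeasure Q] {ξ : Fin n → Ω → E}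

/-- The inequality holds for outer measures, so the set of samples need not be measurable. -/
theorem IsIIDSample.measure_preimage_le (h : IsIIDSample Q P ξ)
    (s : Set (Fin n → E)) : Q {ω | (fun i => ξ i ω) ∈ s} ≤ (Measure.pi fun _ : Fin n => P) s := by
  have hm : ∀ i, AEMeasurable (ξ i) Q := fun i => (h.law i).measurable.aemeasurable
  have hmap := (iIndepFun_iff_map_fun_eq_pi_map hm).1 h.indep
  simp only [fun i => (h.law i).map_eq] at hmap
  rw [← hmap]
  exact Measure.le_map_apply (aemeasurable_pi_lambda _ hm) s

theorem CoxModel.Sigma_isSymm (m : CoxModel p E) (P : Measure E) : (m.Sigma P).IsSymm :=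
  Matrix.IsSymm.ext fun k l => integral_congr_ae (ae_of_all _ fun e => by simp only; ring)

variable [IsProbabilityMeasure P] {m : CoxModel p E} {K : ℝ}

theorem CoxModel.IsRegularVersion.abs_Sigma_le {F : Type*} [MeasurableSpace F] {π : E → F}
    {ζ : ℝ → F → Fin p → ℝ} {ν : Measure ℝ} (h : m.IsRegularVersion P K π ζ ν) (hK : 0 ≤ K)
    (k l : Fin p) : |m.Sigma P k l| ≤ 4 * K ^ 2 := by
  rw [h.Sigma_eq, ← Real.norm_eq_abs]
  refine (norm_integral_le_of_norm_le_const (C := 4 * K ^ 2) (ae_of_all _ fun a => ?_)).trans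
    (le_of_eq (by simp))
  rw [norm_mul, Real.norm_eq_abs, Real.norm_eq_abs, abs_of_nonneg (m.failInd_nonneg a)]
  exact (mul_le_of_le_one_left (abs_nonneg _) (m.failInd_le_one a)).trans
    (h.abs_popResidual_le hK _ _ _ _)

/-- The choice L = 3 log(np) beats the n²p² events of the union bound and leaves 1/(np) ≤ 1/n. -/
theorem sq_mul_exp_neg_three_log_le {n p : ℕ} (hn : 0 < n) (hp : 0 < p) :
    (n : ℝ≥0∞) ^ 2 * (p : ℝ≥0∞) ^ 2 *
      ENNReal.ofReal (Real.exp (-(3 * Real.log ((n : ℝ) * p)))) ≤ (n : ℝ≥0∞)⁻¹ := by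
  have hn' : (0 : ℝ) < n := by exact_mod_cast hn
  have hp' : (1 : ℝ) ≤ p := by exact_mod_cast hp
  have hnp : (0 : ℝ) < n * p := by positivity
  have e1 : Real.exp (-(3 * Real.log ((n : ℝ) * p))) = (((n : ℝ) * p) ^ 3)⁻¹ := by
    rw [Real.exp_neg, mul_comm, show (3 : ℝ) = ((3 : ℕ) : ℝ) by norm_num, Real.exp_mul,
      Real.exp_log hnp, Real.rpow_natCast]
  have e2 : (n : ℝ≥0∞) ^ 2 * (p : ℝ≥0∞) ^ 2 = ENNReal.ofReal (((n : ℝ) * p) ^ 2) := by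
    rw [ENNReal.ofReal_pow hnp.le, ENNReal.ofReal_mul hn'.le, mul_pow, ENNReal.ofReal_natCast,
      ENNReal.ofReal_natCast]
  rw [e1, e2, ← ENNReal.ofReal_mul (by positivity), ← ENNReal.ofReal_natCast n,
    ← ENNReal.ofReal_inv_of_pos hn']
  refine ENNReal.ofReal_le_ofReal ?_
  calc ((n : ℝ) * p) ^ 2 * (((n : ℝ) * p) ^ 3)⁻¹ = ((n : ℝ) * p)⁻¹ := by field_simp
    _ ≤ (n : ℝ)⁻¹ := inv_anti₀ hn' (le_mul_of_one_le_right hn'.le hp')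

/-- The deviations of the score and of the estimators of `Sigma` at the rate
`n^{-1/2} log^{1/2} (np)`. -/
theorem CoxModel.IsCox.measure_deviation_le (hm : m.IsCox P) (hK : 0 < K)
    (hb : m.BoundedCovariates P K) (hlip : m.LipschitzCovariates P) (hd : m.BoundedDensity P)
    (hξ : IsIIDSample Q P ξ) {B : ℝ} (hB : l1norm m.coef ≤ B) (hn : 0 < n) (hp : 0 < p)
    (hL : 1 ≤ Real.log ((n : ℝ) * p)) :
    Q {ω | ¬(m.SampleBounded (fun i => ξ i ω) K ∧
      (∀ k, |m.score (fun i => ξ i ω) m.coef k| ≤ 5 * K *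
        (√(Real.log ((n : ℝ) * p)) / √(n : ℝ))) ∧
      (∀ k l, |m.Vhat (fun i => ξ i ω) m.coef k l - m.Sigma P k l| ≤
        120 * K ^ 2 * Real.exp (K * B) ^ 2 * (√(Real.log ((n : ℝ) * p)) / √(n : ℝ))) ∧
      ∀ k l, |m.hessian (fun i => ξ i ω) m.coef k l + m.Sigma P k l| ≤
        120 * K ^ 2 * Real.exp (K * B) ^ 2 * (√(Real.log ((n : ℝ) * p)) / √(n : ℝ)))} ≤
      10 * (n : ℝ≥0∞)⁻¹ := by
  obtain ⟨F, _, π, ζ, ν, h⟩ := hm.exists_isRegularVersion hK.le hb hlip hd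
  set ℓ := Real.log ((n : ℝ) * p) with hℓ
  have h1 := h.measure_deviation_le hK (Real.exp_le_exp.2 (mul_le_mul_of_nonneg_left hB hK.le)) hn
    (L := 3 * ℓ) (by linarith)
  have h2 := h1.trans (mul_le_mul_right (sq_mul_exp_neg_three_log_le hn hp) 10)
  refine le_trans (measure_mono fun ω hω => ?_) ((hξ.measure_preimage_le _).trans h2)
  -- The numerical facts are √6 ≤ 5/2 and √3 ≤ 2; the first yields 5K for the score, the second 120
  -- for the matrices.
  have s1 : √(2 * (3 * ℓ)) ≤ 5 / 2 * √ℓ := by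
    rw [← mul_assoc, Real.sqrt_mul (by norm_num)]
    gcongr
    rw [Real.sqrt_le_left (by norm_num)]
    norm_num
  have s2 : √(3 * ℓ) ≤ 2 * √ℓ := by
    rw [Real.sqrt_mul (by norm_num)]
    gcongr
    rw [Real.sqrt_le_left (by norm_num)]
    norm_num
  have s3 : 60 * K ^ 2 * Real.exp (K * B) ^ 2 * √(3 * ℓ) / √(n : ℝ) ≤
      120 * K ^ 2 * Real.exp (K * B) ^ 2 * (√ℓ / √(n : ℝ)) := by
    calc _ ≤ 60 * K ^ 2 * Real.exp (K * B) ^ 2 * (2 * √ℓ) / √(n : ℝ) := by gcongr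
      _ = _ := by ring
  refine fun hgood => hω ⟨hgood.1, fun k => (hgood.2.1 k).trans ?_,
    fun k l => (hgood.2.2.1 k l).trans s3, fun k l => (hgood.2.2.2 k l).trans s3⟩
  calc 2 * K * √(2 * (3 * ℓ)) / √(n : ℝ) ≤ 2 * K * (5 / 2 * √ℓ) / √(n : ℝ) := by gcongr
    _ = _ := by ring

theorem CoxModel.IsCox.abs_Sigma_le (hm : m.IsCox P) (hK : 0 < K)
    (hb : m.BoundedCovariates P K) (hlip : m.LipschitzCovariates P) (hd : m.BoundedDensity P)
    (k l : Fin p) : |m.Sigma P k l| ≤ 4 * K ^ 2 := by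
  obtain ⟨F, _, π, ζ, ν, h⟩ := hm.exists_isRegularVersion hK.le hb hlip hd
  exact h.abs_Sigma_le hK.le k l

end

end

noncomputable section

/-! ### Asymptotics -/

theorem pos_of_l1norm_eq_one {p : ℕ} {c : Fin p → ℝ} (hc : l1norm c = 1) : 0 < p := by
  rcases Nat.eq_zero_or_pos p with rfl | h
  · simp [l1norm] at hc
  · exact h

theorem tendsto_log_mul_atTop {p : ℕ → ℕ} (hp : ∀ n, 0 < p n) :
    Tendsto (fun n : ℕ => Real.log ((n : ℝ) * p n)) atTop atTop := by
  refine tendsto_atTop_mono' _ ?_ (Real.tendsto_log_atTop.comp tendsto_natCast_atTop_atTop)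
  filter_upwards [eventually_gt_atTop 0] with n hn
  have hn : (0 : ℝ) < n := by exact_mod_cast hn
  exact Real.log_le_log hn (le_mul_of_one_le_right hn.le (by exact_mod_cast hp n))

/-- A deterministic bound on the intersection of a tight event, an almost sure event and one of
probability tending to 1 suffices. Only monotonicity and subadditivity are used, so the estimators
may be arbitrary functions of ω. -/
theorem isLittleOp_of_eventually {Ω : ℕ → Type*} [∀ n, MeasurableSpace (Ω n)]
    {Q : ∀ n, Measure (Ω n)} {X : ∀ n, Ω n → ℝ} {a : ℕ → ℝ} {R : ∀ n, Ω n → ℝ≥0∞}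
    {G H : ∀ n, Ω n → Prop} (hR : IsBigOpOne Q R) (hG : ∀ n, ∀ᵐ ω ∂Q n, G n ω)
    (hH : Tendsto (fun n => Q n {ω | ¬H n ω}) atTop (𝓝 0))
    (h : ∀ ε : ℝ, 0 < ε → ∀ C : ℝ≥0, 0 < C → ∀ᶠ n in atTop, ∀ ω, R n ω ≤ C → G n ω → H n ω →
      |X n ω| ≤ ε * a n) :
    IsLittleOp Q X a := by
  intro ε hε
  rw [ENNReal.tendsto_nhds_zero]
  intro τ hτ
  obtain ⟨C, hC⟩ := hR (τ / 2) (ENNReal.half_pos hτ.ne')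
  -- Tightness may return the constant 0, while the deterministic bound wants a positive one: hence
  -- C + 1.
  filter_upwards [hC, ENNReal.tendsto_nhds_zero.1 hH (τ / 2) (ENNReal.half_pos hτ.ne'),
    h ε hε (C + 1) (by positivity)] with n h1 h2 h3
  have hsub : {ω | ε * a n < |X n ω|} ⊆ {ω | ¬G n ω} ∪ ({ω | (C : ℝ≥0∞) < R n ω} ∪
      {ω | ¬H n ω}) := by
    intro ω hω
    have hω : ε * a n < |X n ω| := hω
    by_contra hc
    simp only [Set.mem_union, Set.mem_ofPred_eq, not_or, not_not, not_lt] at hc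
    refine absurd (h3 ω (hc.2.1.trans ?_) hc.1 hc.2.2) (not_le.2 hω)
    exact_mod_cast le_self_add
  calc Q n {ω | ε * a n < |X n ω|} ≤ Q n {ω | ¬G n ω} + (Q n {ω | (C : ℝ≥0∞) < R n ω} +
        Q n {ω | ¬H n ω}) := (measure_mono hsub).trans ((measure_union_le _ _).trans
          (add_le_add le_rfl (measure_union_le _ _)))
    _ ≤ 0 + (τ / 2 + τ / 2) := add_le_add (le_of_eq (hG n)) (add_le_add h1 h2)
    _ = τ := by rw [zero_add, ENNReal.add_halves]

theorem natCast_rpow_neg_half (n : ℕ) : (n : ℝ) ^ (-(1 / 2) : ℝ) = 1 / √(n : ℝ) := by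
  rw [Real.rpow_neg (Nat.cast_nonneg n), ← Real.sqrt_eq_rpow, one_div]

end

/-! ### Assembly of the rates -/

theorem proposition3 (K : ℝ) (hK : 0 < K) :
    ∃ A₀ : ℝ, 0 < A₀ ∧
    ∀ (p : ℕ → ℕ) (E Ω : ℕ → Type*)
      [∀ n, MeasurableSpace (E n)] [∀ n, MeasurableSpace (Ω n)]
      (P : ∀ n, Measure (E n)) (Q : ∀ n, Measure (Ω n))
      [∀ n, IsProbabilityMeasure (P n)] [∀ n, IsProbabilityMeasure (Q n)]
      (m : ∀ n, CoxModel (p n) (E n)) (ξ : ∀ n, Fin n → Ω n → E n)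
      (c : ∀ n, Fin (p n) → ℝ) (δ₀ : ℝ) (lam lamN : ℕ → ℝ)
      (betaHat : ∀ n, Ω n → Fin (p n) → ℝ)
      (Theta : ∀ n, Ω n → Matrix (Fin (p n)) (Fin (p n)) ℝ)
      (betaTilde : ∀ n, Ω n → Fin (p n) → Fin (p n) → ℝ),
      -- the model: `n` independent copies of a generic individual following a Cox model
      (∀ n, (m n).IsCox (P n)) →
      (∀ n, IsIIDSample (Q n) (P n) (ξ n)) →
      (∃ B : ℝ, ∀ n, l1norm (m n).coef ≤ B) →
      -- bounded and Lipschitz covariates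
      (∀ n, (m n).BoundedCovariates (P n) K) →
      (∀ n, (m n).LipschitzCovariates (P n)) →
      -- bounded density of the observed time
      (∀ n, (m n).BoundedDensity (P n)) →
      -- sparsity of the regression vector
      ((fun n => ((m n).sparsity : ℝ)) =o[atTop]
        fun n => Real.sqrt n / Real.sqrt (Real.log ((n : ℝ) * p n))) →
      -- the compatibility factor is bounded away from zero in probability
      IsBigOpOne Q (fun n ω => ((m n).kappa fun i => ξ n i ω)⁻¹) →
      -- the diagonal of the population matrix is bounded
      ((fun n => ⨆ j, (m n).Sigma (P n) j j) =O[atTop] fun _ => (1 : ℝ)) →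
      -- the inverse of the population matrix exists and is sparse
      (∀ n, IsUnit ((m n).Sigma (P n)).det) →
      0 < δ₀ →
      ((fun n => opNormOne ((m n).Sigma (P n))⁻¹ ^ 2 *
          climeRate p (fun k => (m k).sparsity) δ₀ n *
          (maxColSupport ((m n).Sigma (P n))⁻¹ : ℝ)) =o[atTop]
        fun n => 1 / Real.sqrt (Real.log ((n : ℝ) * p n))) →
      -- the tuning parameters
      (∀ n, 0 < lam n) →
      (lam =Θ[atTop] lassoRate p) →
      (∀ᶠ n in atTop, A₀ * lassoRate p n ≤ lam n) →
      (∀ n, 0 < lamN n) →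
      (lamN =Θ[atTop] fun n => opNormOne ((m n).Sigma (P n))⁻¹ *
          climeRate p (fun k => (m k).sparsity) δ₀ n) →
      -- the estimators and the intermediate points of the Taylor expansion
      (∀ n, ∀ᵐ ω ∂Q n, (m n).IsLasso (fun i => ξ n i ω) (lam n) (betaHat n ω)) →
      (∀ n, ∀ᵐ ω ∂Q n,
        IsClime ((m n).Vhat (fun i => ξ n i ω) (betaHat n ω)) (lamN n) (Theta n ω)) →
      (∀ n, ∀ᵐ ω ∂Q n,
        (m n).IsTaylorPoints (fun i => ξ n i ω) (betaHat n ω) (betaTilde n ω)) →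
      (∀ n, l1norm (c n) = 1) →
      IsLittleOp Q
        (fun n ω => c n ⬝ᵥ
          ((Theta n ω * (m n).rowHessian (fun i => ξ n i ω) (betaTilde n ω) + 1) *ᵥ
            (betaHat n ω - (m n).coef)))
        (fun n => (n : ℝ) ^ (-(1 / 2) : ℝ)) := by
  -- The score at `coef` is at most 5Kr with high probability, and the Lasso analysis needs it below
  -- λ/3.
  refine ⟨15 * K, by positivity, ?_⟩
  intro p E Ω _ _ P Q _ _ m ξ c δ₀ lam lamN betaHat Theta betaTilde hcox hiid hB hbd hlip hdens
    hsparse hkappa _ hdet _ hA4 hlam0 hlamTheta hlamA hlamN0 hlamNTheta hlasso hclime htaylor hc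
  obtain ⟨B, hB⟩ := hB
  have hp : ∀ n, 0 < p n := fun n => pos_of_l1norm_eq_one (hc n)
  have hlog := tendsto_log_mul_atTop hp
  set C₁ := 120 * K ^ 2 * Real.exp (K * B) ^ 2 with hC₁
  have hC₁0 : 0 ≤ C₁ := by positivity
  obtain ⟨c₂, hc₂, hlam2⟩ := hlamTheta.1.exists_pos
  obtain ⟨c₃, hc₃, hlamN2⟩ := hlamNTheta.1.exists_pos
  obtain ⟨c₁, hc₁, hlamN1⟩ := hlamNTheta.2.exists_pos
  refine isLittleOp_of_eventually hkappa
    (G := fun n ω => (m n).IsLasso (fun i => ξ n i ω) (lam n) (betaHat n ω) ∧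
      IsClime ((m n).Vhat (fun i => ξ n i ω) (betaHat n ω)) (lamN n) (Theta n ω) ∧
      (m n).IsTaylorPoints (fun i => ξ n i ω) (betaHat n ω) (betaTilde n ω))
    (H := fun n ω => (m n).SampleBounded (fun i => ξ n i ω) K ∧
      (∀ k, |(m n).score (fun i => ξ n i ω) (m n).coef k| ≤ 5 * K * lassoRate p n) ∧
      (∀ k l, |(m n).Vhat (fun i => ξ n i ω) (m n).coef k l - (m n).Sigma (P n) k l| ≤
        C₁ * lassoRate p n) ∧
      ∀ k l, |(m n).hessian (fun i => ξ n i ω) (m n).coef k l + (m n).Sigma (P n) k l| ≤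
        C₁ * lassoRate p n)
    (fun n => (hlasso n).and ((hclime n).and (htaylor n))) ?_ ?_
  · have hlim : Tendsto (fun n : ℕ => 10 * (n : ℝ≥0∞)⁻¹) atTop (𝓝 0) := by
      have := ENNReal.Tendsto.const_mul (a := 10) ENNReal.tendsto_inv_nat_nhds_zero
        (Or.inr (by norm_num))
      rwa [mul_zero] at this
    refine tendsto_of_tendsto_of_tendsto_of_le_of_le' tendsto_const_nhds hlim
      (Eventually.of_forall fun _ => zero_le) ?_
    filter_upwards [eventually_gt_atTop 0, hlog.eventually_ge_atTop 1] with n hn hL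
    exact (hcox n).measure_deviation_le hK (hbd n) (hlip n) (hdens n) (hiid n) (hB n) hn (hp n) hL
  intro ε hε C hC
  set A₁ := 16 * c₂ * c₃ with hA₁
  set A₂ := 20 * C₁ * (C : ℝ) ^ 2 * c₂ + 315 * K * (C : ℝ) ^ 2 * c₂ ^ 2 with hA₂
  have hA₁0 : 0 < A₁ := by positivity
  have hA₂0 : 0 ≤ A₂ := by positivity
  -- The two error terms will be at most A₁τ/√n and A₂ · 4K²τ/√n, which add up to ε/√n.
  set τ := ε / (A₁ + A₂ * (4 * K ^ 2)) with hτ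
  have hτ0 : 0 < τ := by positivity
  have hsm0 : 0 < 1 / (40 * K * (C : ℝ) ^ 2 * c₂ + 1) := by positivity
  -- Since log(np) tends to infinity, q eventually exceeds 1 and the constant required for CLIME
  -- feasibility.
  have hlogq := hlog.eventually_ge_atTop
    (max 1 (((C₁ + 640 * K ^ 3 * (C : ℝ) ^ 2 * c₂) * c₁) ^ 2))
  filter_upwards [eventually_gt_atTop 0, hlogq, hlamA, hlam2.bound, hlamN1.bound, hlamN2.bound,
    hsparse.bound hsm0, hA4.bound hτ0] with n hn hL hlA hl2 hN1 hN2 hsp hA ω hR hG hH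
  have hn' : (0 : ℝ) < n := by exact_mod_cast hn
  have hsn : 0 < √(n : ℝ) := Real.sqrt_pos.2 hn'
  set q := √(Real.log ((n : ℝ) * p n)) with hq
  have hq1 : 1 ≤ q := Real.one_le_sqrt.2 ((le_max_left _ _).trans hL)
  have hq0 : 0 < q := by linarith
  have hqA : (C₁ + 640 * K ^ 3 * (C : ℝ) ^ 2 * c₂) * c₁ ≤ q :=
    Real.le_sqrt_of_sq_le ((le_max_right _ _).trans hL)
  set r := lassoRate p n with hr
  have hrq : r = q / √(n : ℝ) := rfl
  have hr0 : 0 ≤ r := by rw [hrq]; positivity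
  set γ := climeRate p (fun k => (m k).sparsity) δ₀ n with hγ
  set o := opNormOne ((m n).Sigma (P n))⁻¹ with ho
  have ho0 : 0 ≤ o := opNormOne_nonneg _
  set s : ℝ := (maxColSupport ((m n).Sigma (P n))⁻¹ : ℝ) with hs
  have hs1 : 1 ≤ s := Nat.one_le_cast.2 (one_le_maxColSupport_inv (hdet n) ⟨0, hp n⟩)
  have ho1 : 1 ≤ 4 * K ^ 2 * o := one_le_mul_opNormOne_inv (hdet n) ⟨0, hp n⟩
    ((hcox n).abs_Sigma_le hK (hbd n) (hlip n) (hdens n))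
  set d : ℝ := ((m n).sparsity : ℝ) with hd
  have hd0 : 0 ≤ d := Nat.cast_nonneg _
  have hγ0 : 0 ≤ γ := (Real.rpow_nonneg hn'.le _).trans (le_max_right _ _)
  -- Here d q r = d log(np)/√n is the first entry of the maximum defining γ.
  have hγd : d * (q * r) ≤ γ := by
    refine le_trans (le_of_eq ?_) (le_max_left _ _)
    rw [hrq, mul_div_assoc' q, ← mul_div_assoc, hq, Real.mul_self_sqrt]
    linarith [(le_max_left _ _).trans hL]
  have hl2' : lam n ≤ c₂ * r := by
    rwa [Real.norm_of_nonneg (hlam0 n).le, Real.norm_of_nonneg hr0] at hl2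
  have hN1' : o * γ ≤ c₁ * lamN n := by
    rwa [Real.norm_of_nonneg (hlamN0 n).le, Real.norm_of_nonneg (by positivity)] at hN1
  have hN2' : lamN n ≤ c₃ * (o * γ) := by
    rwa [Real.norm_of_nonneg (hlamN0 n).le, Real.norm_of_nonneg (by positivity)] at hN2
  have hdr : d * r ≤ 1 / (40 * K * (C : ℝ) ^ 2 * c₂ + 1) := by
    rw [Real.norm_of_nonneg hd0, Real.norm_of_nonneg (by positivity)] at hsp
    calc d * r ≤ 1 / (40 * K * (C : ℝ) ^ 2 * c₂ + 1) * (√(n : ℝ) / q) * r := by gcongr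
      _ = 1 / (40 * K * (C : ℝ) ^ 2 * c₂ + 1) := by rw [hrq]; field_simp
  have hsmall : 40 * K * (C : ℝ) ^ 2 * (d * (c₂ * r)) < 1 := by
    calc 40 * K * (C : ℝ) ^ 2 * (d * (c₂ * r)) = 40 * K * (C : ℝ) ^ 2 * c₂ * (d * r) := by ring
      _ ≤ 40 * K * (C : ℝ) ^ 2 * c₂ * (1 / (40 * K * (C : ℝ) ^ 2 * c₂ + 1)) := by gcongr
      _ < 1 := by
        rw [mul_one_div, div_lt_one (by positivity)]
        linarith
  have hA' : o ^ 2 * γ * s * q ≤ τ := by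
    rw [Real.norm_of_nonneg (by positivity), Real.norm_of_nonneg (by positivity)] at hA
    calc o ^ 2 * γ * s * q ≤ τ * (1 / q) * q := by gcongr
      _ = τ := by field_simp
  have hscore : ∀ k, |(m n).score (fun i => ξ n i ω) (m n).coef k| ≤ lam n / 3 := fun k =>
    (hH.2.1 k).trans (by linarith)
  refine (hH.1.debias_error_le hK hC (hlam0 n) hl2' hr0 hC₁0 hc₂.le hG.1 hscore hR hsmall
    ((m n).Sigma_isSymm (P n)) (hdet n) hG.2.1 hG.2.2 hH.2.2.1 hH.2.2.2 hγd hγ0 hqA hq0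
    (hlamN0 n) hN1' hN2' hc₃.le (hc n)).trans ?_
  have t1 : o ^ 2 * γ * s * r ≤ τ / √(n : ℝ) := by
    rw [hrq, mul_div_assoc']
    gcongr
  -- The assumption controls o²γsq only. Since d q r ≤ γ, one factor r leaves oγ/√n, and 1 ≤ 4K²o, 1
  -- ≤ s and 1 ≤ q raise oγ to the controlled product.
  have t2 : o * (d * r * r) ≤ 4 * K ^ 2 * τ / √(n : ℝ) := by
    calc o * (d * r * r) = o * (d * (q * r)) / √(n : ℝ) := by rw [hrq]; ring
      _ ≤ o * γ / √(n : ℝ) := by gcongr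
      _ ≤ (4 * K ^ 2 * o) * (o * γ) * s * q / √(n : ℝ) := by
          refine div_le_div_of_nonneg_right ?_ hsn.le
          have h0 : 0 ≤ o * γ := by positivity
          calc o * γ ≤ (4 * K ^ 2 * o) * (o * γ) := le_mul_of_one_le_left h0 ho1
            _ ≤ (4 * K ^ 2 * o) * (o * γ) * s := le_mul_of_one_le_right (by positivity) hs1
            _ ≤ _ := le_mul_of_one_le_right (by positivity) hq1
      _ = 4 * K ^ 2 * (o ^ 2 * γ * s * q) / √(n : ℝ) := by ring
      _ ≤ _ := by gcongr
  calc A₁ * (o ^ 2 * γ * s * r) + A₂ * (o * (d * r * r))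
      ≤ A₁ * (τ / √(n : ℝ)) + A₂ * (4 * K ^ 2 * τ / √(n : ℝ)) := by gcongr
    _ = τ * (A₁ + A₂ * (4 * K ^ 2)) * (1 / √(n : ℝ)) := by ring
    _ = ε * (n : ℝ) ^ (-(1 / 2) : ℝ) := by
        rw [natCast_rpow_neg_half, hτ, div_mul_cancel₀ _ (by positivity)]
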